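/- **Theorem (bifurcation of geostrophic equilibria for $Q\neq 0$).** Consider the rotating shallow water equations on $\mathbb R^2$ with isotropic backscatter and bottom drag, $$\partial_t\mathbf v+(\mathbf v\cdot\nabla)\mathbf v=-f\mathbf v^\perp-g\nabla\eta-(d\Delta^2+b\Delta)\mathbf v-\frac{C+Q|\mathbf v|}{H_0+\eta}\mathbf v,\qquad \partial_t\eta+(\mathbf v\cdot\nabla)\eta=-(H_0+\eta)\nabla\cdot\mathbf v,$$ with $d,b,H_0,g>0$, $f\in\mathbb R$, $Q>0$ and $(x,y)^\perp=(-y,x)$, for classical solutions with $H_0+\eta>0$. Let $\tilde f=f/g$, $k_c=\sqrt{b/(2d)}$, $C_c=b^2H_0/(4d)$, $C=C_c-\alpha H_0$. For $\mathbf k\in\mathbb R^2$ with $|\mathbf k|=k_c+\kappa$ consider the steady plane waves $$\mathbf v=\phi'(\mathbf k\cdot\mathbf x)\,\mathbf k^\perp,\qquad \eta=\tilde f\,\phi(\mathbf k\cdot\mathbf x),\qquad \phi\ 2\pi\text{-periodic, } C^5,\ \text{with mean zero}. \tag{1}$$ Write $\langle\phi,e_1\rangle=\frac1{2\pi}\int_0^{2\pi}\phi(\xi)e^{-i\xi}\,d\xi$.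 Let $d,b,H_0,M>0$. There are $\varepsilon,\rho,\delta,K>0$, depending only on $d,b,H_0,M$, such that for all $0<Q\le M$, $g>0$ and $f$ with $|\tilde f|\le M$ there are a real function $\mathcal R_{ns}(A_1,\alpha,\kappa)$ and wave shapes $\phi_{ns}(\cdot\,;A_1,\alpha,\kappa)$ with the following properties. (a) For $|A_1|<\rho$, $|\alpha|,|\kappa|<\varepsilon$, $$\mathcal R_{ns}=Q\tilde f\,R_1+(Q+|\tilde f|)R_2+R_3,\quad |R_1|\le K|A_1|^2,\ \ |R_2|\le K|A_1|(|A_1|+|\alpha|+|\kappa|),\ \ |R_3|\le K|\kappa|^3 .$$ (b) Let $|\alpha|,|\kappa|<\varepsilon$ and let $\mathbf k$ be any wave vector with $|\mathbf k|=k_c+\kappa$. Then $A_1\mapsto\phi_{ns}(\cdot\,;A_1,\alpha,\kappa)$ is a bijection from the set of real roots $A_1$, $|A_1|<\rho$, of $$0=A_1\Big(\alpha-2b\kappa^2-\frac{16Q\sqrt b}{3\pi H_0\sqrt{2d}}|A_1|+\mathcal R_{ns}(A_1,\alpha,\kappa)\Big)\tag{2}$$ onto the set of shapes $\phi$ of waves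 (1) with $\|\phi\|_{H^5}<\delta$, $|\langle\phi,e_1\rangle|<\rho$ and $\langle\phi,e_1\rangle\in\mathbb R$. Its inverse is $\phi\mapsto\langle\phi,e_1\rangle$, and $$\|\phi_{ns}(\cdot\,;A_1,\alpha,\kappa)-2A_1\cos\|_{H^5}\le K|A_1|(|A_1|+|\alpha|+|\kappa|).$$ Every wave (1) with $\|\phi\|_{H^5}<\delta$ and $|\langle\phi,e_1\rangle|<\rho$ is a translate of some $\phi_{ns}(\cdot\,;A_1,\alpha,\kappa)$ with $A_1$ such a root, and the shapes of two roots $A_1,A_1'$ are translates of each other if and only if $A_1'=\pm A_1$. Thus the waves up to translation correspond one-to-one to the small roots of (2) up to sign. (c) (Supercritical, degenerate pitchfork.) There are $0<\varepsilon_1\le\varepsilon$, $0<\rho_1\le\rho$, $K_1>0$ and a function $\alpha_*$ (which may depend also on $Q,f,g$) such that for $|\alpha|,|\kappa|<\varepsilon_1$: $|\alpha_*(\kappa)-2b\kappa^2|\le K_1|\kappa|^3$; for $|\mathbf k|=k_c+\kappa$ the linearization in $(\mathbf v,\eta)=(0,0)$ has an eigenvalue with positive real part at wave vector $\mathbf k$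 if and only if $\alpha>\alpha_*(\kappa)$; if $\alpha\le\alpha_*(\kappa)$, the only root of (2) with $|A_1|<\rho_1$ is $0$; if $\alpha>\alpha_*(\kappa)$, the roots with $|A_1|<\rho_1$ are exactly $0,a,-a$ for some $a>0$ with $$\Big|a-\frac{3\pi H_0\sqrt{2d}}{16Q\sqrt b}\,(\alpha-\alpha_*(\kappa))\Big|\le K_1(\alpha-\alpha_*(\kappa))(|\alpha|+|\kappa|).$$ -/

import Mathlib

open Real Set

noncomputable section

/-- The horizontal plane `ℝ²`. -/
abbrev Plane : Type := EuclideanSpace ℝ (Fin 2)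

/-- The rotation `(x, y)^⊥ = (-y, x)`. -/
def perp (v : Plane) : Plane := !₂[-(v 1), v 0]

/-- Parameters of the rotating shallow water equations with isotropic backscatter and bottom
drag: linear and quadratic drag coefficients `C`, `Q`, hyperviscosity `d`, backscatter `b`,
mean fluid depth `H₀`, Coriolis parameter `f`, gravity acceleration `g`. -/
structure Params where
  C : ℝ
  Q : ℝ
  d : ℝ
  b : ℝ
  H₀ : ℝ
  f : ℝ
  g : ℝ

/-- The isotropic backscatter operator `B v = d Δ² v + b Δ v`. -/
def backscatter (p : Params) (v : Plane → Plane) (x : Plane) : Plane :=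
  p.d • Laplacian.laplacian (Laplacian.laplacian v) x + p.b • Laplacian.laplacian v x

/-- The bottom drag `F(v, η) = (C + Q |v|) / (H₀ + η) v` (pointwise in space and time). -/
def bottomDrag (p : Params) (v : Plane) (η : ℝ) : Plane :=
  ((p.C + p.Q * ‖v‖) / (p.H₀ + η)) • v

/-- The divergence of a planar vector field. -/
def divergence (v : Plane → Plane) (x : Plane) : ℝ :=
  ∑ j : Fin 2, (fderiv ℝ v x (EuclideanSpace.single j 1)) j

/-- `(v, η)` is a classical solution, with positive fluid thickness `H₀ + η`, of
`∂ₜ v + (v·∇) v = - f v^⊥ - g ∇η - B v - F(v, η)`,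
`∂ₜ η + (v·∇) η = - (H₀ + η) ∇·v`. -/
structure IsShallowWaterSolution (p : Params) (v : ℝ → Plane → Plane) (η : ℝ → Plane → ℝ) :
    Prop where
  contDiff_v : ∀ t, 0 < t → ContDiff ℝ 4 (v t)
  contDiff_η : ∀ t, 0 < t → ContDiff ℝ 1 (η t)
  differentiableAt_v : ∀ t x, 0 < t → DifferentiableAt ℝ (fun s => v s x) t
  differentiableAt_η : ∀ t x, 0 < t → DifferentiableAt ℝ (fun s => η s x) t
  depth_pos : ∀ t x, 0 < t → 0 < p.H₀ + η t x
  momentum : ∀ t x, 0 < t →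
    deriv (fun s => v s x) t + fderiv ℝ (v t) x (v t x) =
      -(p.f • perp (v t x)) - p.g • gradient (η t) x - backscatter p (v t) x
        - bottomDrag p (v t x) (η t x)
  mass : ∀ t x, 0 < t →
    deriv (fun s => η s x) t + fderiv ℝ (η t) x (v t x) =
      -((p.H₀ + η t x) * divergence (v t) x)

/-- The wave shape `φ` is `C⁵`, `2π`-periodic, of mean zero, and the steady plane wave
`v = φ'(k·x) k^⊥`, `η = (f/g) φ(k·x)` solves the shallow water equations. -/
structure IsSteadyPlaneWave (p : Params) (k : Plane) (φ : ℝ → ℝ) : Prop where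
  contDiff : ContDiff ℝ 5 φ
  periodic : Function.Periodic φ (2 * π)
  mean_zero : ∫ ξ in (0 : ℝ)..(2 * π), φ ξ = 0
  solution : IsShallowWaterSolution p
    (fun _ x => deriv φ (inner ℝ k x) • perp k)
    (fun _ x => p.f / p.g * φ (inner ℝ k x))

/-- The `H⁵`-norm of a `C⁵` function on the period interval `[0, 2π]`. -/
def normH5 (φ : ℝ → ℝ) : ℝ :=
  √(∑ n ∈ Finset.range 6,
    1 / (2 * π) * ∫ ξ in (0 : ℝ)..(2 * π), (iteratedDeriv n φ ξ) ^ 2)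

/-- The Fourier coefficient `⟨φ, e^{iξ}⟩ = (1/2π) ∫₀^{2π} φ(ξ) e^{-iξ} dξ`. -/
def firstFourierCoeff (φ : ℝ → ℝ) : ℂ :=
  1 / (2 * (π : ℂ)) *
    ∫ ξ in (0 : ℝ)..(2 * π), (φ ξ : ℂ) * Complex.exp (-(Complex.I * (ξ : ℂ)))

/-- The translate `ξ ↦ φ(ξ + θ)`. -/
def shift (φ : ℝ → ℝ) (θ : ℝ) : ℝ → ℝ := fun ξ => φ (ξ + θ)

/-- The critical wave number `k_c = √(b / (2d))`. -/
def kCrit (d b : ℝ) : ℝ := √(b / (2 * d))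

/-- The critical linear drag `C_c = b² H₀ / (4d)`. -/
def CCrit (d b H₀ : ℝ) : ℝ := b ^ 2 * H₀ / (4 * d)

/-- The parameters with linear drag `C = C_c - α H₀`. -/
def paramsAt (d b H₀ Q f g α : ℝ) : Params where
  C := CCrit d b H₀ - α * H₀
  Q := Q
  d := d
  b := b
  H₀ := H₀
  f := f
  g := g

/-- The coefficient `16 Q √b / (3 π H₀ √(2d))`. -/
def dragCoeff (d b H₀ Q : ℝ) : ℝ := 16 * Q * √b / (3 * π * H₀ * √(2 * d))

/-- The steady plane waves of wave vector `k` in a neighbourhood of zero, given by the bounds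
`δ` for the `H⁵`-norm and `ρ` for the modulus of the first Fourier coefficient. -/
def smallWaves (p : Params) (k : Plane) (δ ρ : ℝ) : Set (ℝ → ℝ) :=
  {φ | IsSteadyPlaneWave p k φ ∧ normH5 φ < δ ∧ ‖firstFourierCoeff φ‖ < ρ}

/-- The real roots `A`, `|A| < ρ`, of `0 = A (α - 2bκ² - c |A| + R(A, α, κ))`. -/
def smallRoots (b c : ℝ) (R : ℝ → ℝ → ℝ → ℝ) (α κ ρ : ℝ) : Set ℝ :=
  {A | |A| < ρ ∧ 0 = A * (α - 2 * b * κ ^ 2 - c * |A| + R A α κ)}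

/-- The Fourier symbol, at wave vector `k`, of the linearization of the shallow water equations
in the trivial flow `(v, η) = (0, 0)`. -/
def linearSymbol (p : Params) (k : Plane) : Matrix (Fin 3) (Fin 3) ℂ :=
  let F : ℂ := ((p.d * ‖k‖ ^ 4 - p.b * ‖k‖ ^ 2 + p.C / p.H₀ : ℝ) : ℂ)
  !![-F, (p.f : ℂ), -((p.g : ℂ) * (Complex.I * (k 0 : ℂ)));
     -(p.f : ℂ), -F, -((p.g : ℂ) * (Complex.I * (k 1 : ℂ)));
     -((p.H₀ : ℂ) * (Complex.I * (k 0 : ℂ))), -((p.H₀ : ℂ) * (Complex.I * (k 1 : ℂ))), 0]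

/-- The trivial flow is spectrally unstable with respect to perturbations of wave vector `k`. -/
def TrivialFlowUnstable (p : Params) (k : Plane) : Prop :=
  ∃ z ∈ spectrum ℂ (linearSymbol p k), 0 < z.re

end

/-!
A plane wave `v = φ'(k·x) k^⊥`, `η = (f/g) φ(k·x)` is transported trivially, is divergence free and
in geostrophic balance, so that it solves the shallow water equations if and only if its depth is
positive and its shape solves the ordinary differential equation
`L φ + ν(φ, φ') = 0`, where `L = d |k|⁴ ∂⁵ + b |k|² ∂³ + (C / H₀) ∂` is the linear part and `ν` is
the nonlinear part of the bottom drag (`isSteadyPlaneWave_iff`). On `e^{inξ}` the operator `L` acts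
as multiplication by `i n (d (|k|² n² - k_c²)² - α)` (`waveSymbol_eq`), which is small for `n = ±1`,
vanishes for `n = 0`, and is invertible on the other modes with a gain of five derivatives.

The drag `ν` is not smooth at `φ' = 0`, but it is Lipschitz and homogeneous of degree two up to
the variation of the depth. Hence `φ = a χ` with `a = |⟨φ, e₁⟩|` turns the equation on the modes
`|n| ≥ 2` into a fixed point problem `χ = 2 cos - a L⁻¹ P ν_a(χ, χ')` with small parameter `a`,
which is solved by contraction in `C¹` (`exists_isShape`), in a Lipschitz way in `a`
(`IsShape.stability`). The solution is unique and therefore even, as its reflection is another one;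
so its load `ν_a(χ, χ')` is odd. An odd load has no mode `0`, and its modes `±1` form a multiple
of `sin`. So the remaining equations reduce to the single real equation
`a (α - α_* + a σ(a)) = 0` (`IsShape.equation`), where `α_*(κ) = d ((k_c + κ)² - k_c²)²` is the
value of `α` at which the symbol of `L` vanishes for `n = 1`, and the response `σ` is the projection
of the load on `sin`. At `a = 0` the load is evaluated along `2 cos`, and only the quadratic drag
`|φ'| φ'` contributes, which gives `σ(0) = -16 Q |k| / (3π H₀)` (`response_drag_zero`). Together
with the Lipschitz bound this is the form of the bifurcation equation; `α_* = 2bκ² + O(κ³)`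
by expansion.

Conversely, a wave that is small in `H⁵` is small in `C¹`. The equation on the modes `|n| ≥ 2` then
bounds its distance to `2a cos` by a small multiple of its `C¹` norm, since `ν` is quadratic; hence
`φ / a` stays in the box where the contraction is set up, and `φ = a χ` (`eq_mul_of_isShape`).
Translations rotate the first Fourier coefficient, so that every wave can be normalized, and half a
period exchanges `A` and `-A`.

The map `a ↦ a σ(a)` is strictly decreasing for small `a`, and `σ` is close to `-c` with `c > 0`. So
there is exactly one positive root for `α > α_*` and none otherwise (`pitchfork`). Finally
`α > α_*` is also the condition for linear instability: dividing the characteristic polynomial by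
`z (z + F)` shows that an eigenvalue `z` with positive real part exists only if the drag symbol `F`
is negative, and the intermediate value theorem provides one in this case
(`trivialFlowUnstable_iff`).
-/

noncomputable section

/-! ### Fourier series of periodic functions -/

/-- The `n`-th Fourier coefficient `(1/2π) ∫₀^{2π} h(ξ) e^{-inξ} dξ` of a real function. -/
def coeff (h : ℝ → ℝ) (n : ℤ) : ℂ :=
  1 / (2 * (π : ℂ)) * ∫ ξ in (0 : ℝ)..(2 * π), (h ξ : ℂ) * Complex.exp (-(Complex.I * n * ξ))

/-- The real part of the trigonometric series `∑ aₙ e^{inξ}`. Coefficient sequences are not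
required to be Hermitian; taking the real part makes the sum a real function in all cases. -/
def trigSum (a : ℤ → ℂ) (ξ : ℝ) : ℝ := (∑' n : ℤ, a n * Complex.exp (Complex.I * n * ξ)).re

lemma firstFourierCoeff_eq_coeff (h : ℝ → ℝ) : firstFourierCoeff h = coeff h 1 := by
  simp [firstFourierCoeff, coeff]

lemma periodic_deriv {f : ℝ → ℝ} {T : ℝ} (hp : Function.Periodic f T) :
    Function.Periodic (deriv f) T := by
  intro x
  have : (fun y => f (y + T)) = f := funext hp
  rw [← deriv_comp_add_const, this]

lemma norm_exp_mode (n : ℤ) (ξ : ℝ) : ‖Complex.exp (Complex.I * n * ξ)‖ = 1 := by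
  have : Complex.I * n * ξ = ((n * ξ : ℝ) : ℂ) * Complex.I := by push_cast; ring
  rw [this, Complex.norm_exp_ofReal_mul_I]

lemma norm_exp_neg_mode (n : ℤ) (ξ : ℝ) : ‖Complex.exp (-(Complex.I * n * ξ))‖ = 1 := by
  have := norm_exp_mode (-n) ξ
  push_cast at this
  rwa [mul_neg, neg_mul] at this

lemma continuous_coeff_integrand {h : ℝ → ℝ} (hh : Continuous h) (n : ℤ) :
    Continuous fun ξ : ℝ => (h ξ : ℂ) * Complex.exp (-(Complex.I * n * ξ)) := by
  fun_prop

lemma coeff_sub {h g : ℝ → ℝ} (hh : Continuous h) (hg : Continuous g) (n : ℤ) :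
    coeff (fun ξ => h ξ - g ξ) n = coeff h n - coeff g n := by
  unfold coeff
  rw [← mul_sub, ← intervalIntegral.integral_sub
    ((continuous_coeff_integrand hh n).intervalIntegrable _ _)
    ((continuous_coeff_integrand hg n).intervalIntegrable _ _)]
  congr 2; funext ξ; push_cast; ring

lemma coeff_add {h g : ℝ → ℝ} (hh : Continuous h) (hg : Continuous g) (n : ℤ) :
    coeff (fun ξ => h ξ + g ξ) n = coeff h n + coeff g n := by
  unfold coeff
  rw [← mul_add, ← intervalIntegral.integral_add
    ((continuous_coeff_integrand hh n).intervalIntegrable _ _)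
    ((continuous_coeff_integrand hg n).intervalIntegrable _ _)]
  congr 2; funext ξ; push_cast; ring

lemma coeff_const_mul (c : ℝ) (h : ℝ → ℝ) (n : ℤ) :
    coeff (fun ξ => c * h ξ) n = c * coeff h n := by
  unfold coeff
  rw [mul_left_comm, ← intervalIntegral.integral_const_mul (c : ℂ)]
  congr 2; funext ξ; push_cast; ring

lemma norm_coeff_le {h : ℝ → ℝ} {D : ℝ} (hD : ∀ ξ, |h ξ| ≤ D) (n : ℤ) : ‖coeff h n‖ ≤ D := by
  have h1 : ‖∫ ξ in (0 : ℝ)..(2 * π), (h ξ : ℂ) * Complex.exp (-(Complex.I * n * ξ))‖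
      ≤ D * |2 * π - 0| := by
    apply intervalIntegral.norm_integral_le_of_norm_le_const
    intro x _
    rw [norm_mul, norm_exp_neg_mode, mul_one, Complex.norm_real]
    exact hD x
  unfold coeff
  rw [norm_mul]
  have h2 : ‖(1 / (2 * (π : ℂ)))‖ = 1 / (2 * π) := by
    simp [abs_of_pos pi_pos]
  rw [h2]
  rw [sub_zero, abs_of_pos two_pi_pos] at h1
  calc _ ≤ 1 / (2 * π) * (D * (2 * π)) := by gcongr
    _ = D := by field_simp

lemma coeff_conj (h : ℝ → ℝ) (n : ℤ) : (starRingEnd ℂ) (coeff h n) = coeff h (-n) := by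
  unfold coeff
  rw [map_mul, ← intervalIntegral.intervalIntegral_conj]
  congr 1
  · simp [map_ofNat]
  · congr 1
    ext ξ
    rw [map_mul, ← Complex.exp_conj]
    simp

lemma periodic_integrand {h : ℝ → ℝ} (hp : Function.Periodic h (2 * π)) (n : ℤ) :
    Function.Periodic (fun ξ : ℝ => (h ξ : ℂ) * Complex.exp (-(Complex.I * n * ξ))) (2 * π) := by
  intro ξ
  simp only [hp ξ]
  congr 1
  rw [Complex.exp_eq_exp_iff_exists_int]
  exact ⟨-n, by push_cast; ring⟩

/-- Translation rotates the Fourier coefficients. -/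
lemma coeff_shift {h : ℝ → ℝ} (hp : Function.Periodic h (2 * π)) (θ : ℝ) (n : ℤ) :
    coeff (shift h θ) n = Complex.exp (Complex.I * n * θ) * coeff h n := by
  unfold coeff shift
  rw [mul_left_comm, ← intervalIntegral.integral_const_mul (Complex.exp (Complex.I * n * θ))]
  congr 1
  have h1 : ∀ ξ : ℝ, (h (ξ + θ) : ℂ) * Complex.exp (-(Complex.I * n * ξ)) =
      (fun y : ℝ => Complex.exp (Complex.I * n * θ) *
        ((h y : ℂ) * Complex.exp (-(Complex.I * n * y)))) (ξ + θ) := by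
    intro ξ
    simp only
    rw [mul_left_comm, ← Complex.exp_add]
    congr 2
    push_cast; ring
  simp_rw [h1]
  rw [intervalIntegral.integral_comp_add_right
    (fun y : ℝ => Complex.exp (Complex.I * n * θ) *
        ((h y : ℂ) * Complex.exp (-(Complex.I * n * y))))]
  rw [intervalIntegral.integral_const_mul, intervalIntegral.integral_const_mul]
  have := (periodic_integrand hp n).intervalIntegral_add_eq θ 0
  rw [zero_add] at this
  rw [zero_add, add_comm (2 * π) θ, this]

lemma coeff_reflect {h : ℝ → ℝ} (hp : Function.Periodic h (2 * π)) (n : ℤ) :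
    coeff (fun ξ => h (-ξ)) n = coeff h (-n) := by
  unfold coeff
  congr 1
  have h1 : ∀ ξ : ℝ, (h (-ξ) : ℂ) * Complex.exp (-(Complex.I * n * ξ)) =
      (fun y : ℝ => (h y : ℂ) * Complex.exp (-(Complex.I * (-n : ℤ) * y))) (-ξ) := by
    intro ξ; simp
  simp_rw [h1]
  rw [intervalIntegral.integral_comp_neg
    (fun y : ℝ => (h y : ℂ) * Complex.exp (-(Complex.I * (-n : ℤ) * y)))]
  have := (periodic_integrand hp (-n)).intervalIntegral_add_eq (-(2 * π)) 0
  rw [neg_add_cancel, zero_add] at this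
  rw [neg_zero, this]

lemma coeff_deriv {h : ℝ → ℝ} (hh : ContDiff ℝ 1 h) (hp : Function.Periodic h (2 * π)) (n : ℤ) :
    coeff (deriv h) n = Complex.I * n * coeff h n := by
  have hd : ∀ x, HasDerivAt (fun ξ : ℝ => (h ξ : ℂ)) ((deriv h x : ℝ) : ℂ) x := fun x =>
    ((hh.differentiable one_ne_zero) x).hasDerivAt.ofReal_comp
  have he : ∀ x : ℝ, HasDerivAt (fun ξ : ℝ => Complex.exp (-(Complex.I * n * ξ)))
      (Complex.exp (-(Complex.I * n * x)) * (-(Complex.I * n))) x := by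
    intro x
    have h1 : HasDerivAt (fun ξ : ℝ => -(Complex.I * n * (ξ : ℂ))) (-(Complex.I * n)) x := by
      simpa using ((hasDerivAt_id x).ofReal_comp.const_mul (-(Complex.I * n)))
    exact h1.cexp
  have hc : Continuous (deriv h) := hh.continuous_deriv (le_refl _)
  have key := intervalIntegral.integral_deriv_mul_eq_sub (a := 0) (b := 2 * π)
    (u := fun ξ : ℝ => (h ξ : ℂ)) (v := fun ξ : ℝ => Complex.exp (-(Complex.I * n * ξ)))
    (fun x _ => hd x) (fun x _ => he x)
    (Continuous.intervalIntegrable (by fun_prop) _ _)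
    (Continuous.intervalIntegrable (by fun_prop) _ _)
  have hper := periodic_integrand hp n 0
  simp only [zero_add] at hper
  simp only [hper, sub_self] at key
  rw [intervalIntegral.integral_add (Continuous.intervalIntegrable (by fun_prop) _ _)
    (Continuous.intervalIntegrable (by have := hh.continuous; fun_prop) _ _)] at key
  unfold coeff
  have h2 : ∫ x in (0 : ℝ)..(2 * π), (h x : ℂ) *
      (Complex.exp (-(Complex.I * n * x)) * (-(Complex.I * n))) =
      (-(Complex.I * n)) * ∫ x in (0 : ℝ)..(2 * π), (h x : ℂ) *
      Complex.exp (-(Complex.I * n * x)) := by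
    rw [← intervalIntegral.integral_const_mul]
    congr 1; ext x; ring
  rw [h2] at key
  linear_combination (1 / (2 * (π : ℂ))) * key

/-- The function on the circle `ℝ / 2πℤ` induced by a continuous periodic function. -/
def circleLift (h : ℝ → ℝ) (hh : Continuous h) (hp : Function.Periodic h (2 * π)) :
    C(AddCircle (2 * π), ℂ) where
  toFun := (hp.comp (fun x : ℝ => (x : ℂ))).lift
  continuous_toFun := continuous_coinduced_dom.mpr (by
    show Continuous fun x => ((h x : ℝ) : ℂ)
    fun_prop)

lemma fourier_two_pi (n : ℤ) (x : ℝ) :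
    fourier n (x : AddCircle (2 * π)) = Complex.exp (Complex.I * n * x) := by
  rw [fourier_coe_apply]
  congr 1
  have : (π : ℂ) ≠ 0 := by exact_mod_cast pi_ne_zero
  push_cast
  field_simp

instance twoPiPos : Fact (0 < 2 * π) := ⟨two_pi_pos⟩

lemma fourierCoeff_circleLift {h : ℝ → ℝ} (hh : Continuous h) (hp : Function.Periodic h (2 * π))
    (n : ℤ) : fourierCoeff (circleLift h hh hp) n = coeff h n := by
  rw [fourierCoeff_eq_intervalIntegral _ n 0, zero_add, coeff, Complex.real_smul]
  congr 1
  · push_cast; ring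
  · congr 1
    ext x
    rw [fourier_two_pi, smul_eq_mul, mul_comm]
    congr 2
    push_cast; ring

/-- Fourier inversion for absolutely summable coefficients. -/
lemma eq_trigSum_coeff {h : ℝ → ℝ} (hh : Continuous h) (hp : Function.Periodic h (2 * π))
    (hs : Summable (coeff h)) (ξ : ℝ) : h ξ = trigSum (coeff h) ξ := by
  have h1 : fourierCoeff (circleLift h hh hp) = coeff h :=
    funext (fourierCoeff_circleLift hh hp)
  have := has_pointwise_sum_fourier_series_of_summable (f := circleLift h hh hp)
    (by rw [h1]; exact hs) (ξ : AddCircle (2 * π))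
  rw [h1] at this
  have h2 := this.tsum_eq
  unfold trigSum
  simp_rw [fourier_two_pi, smul_eq_mul] at h2
  rw [h2]
  show h ξ = ((h ξ : ℝ) : ℂ).re
  simp

/-- Bessel's inequality in qualitative form. -/
lemma summable_sq_coeff {h : ℝ → ℝ} (hh : Continuous h) (hp : Function.Periodic h (2 * π)) :
    Summable fun n => ‖coeff h n‖ ^ 2 := by
  have := (hasSum_sq_fourierCoeff (ContinuousMap.toLp 2 AddCircle.haarAddCircle ℂ
    (circleLift h hh hp))).summable
  simpa only [fourierCoeff_toLp, fourierCoeff_circleLift] using this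

/-- The Fourier coefficients of a `C¹` function are summable: `‖ĥ(n)‖ = ‖ĥ'(n)‖ / |n|` is a
product of two square summable sequences. -/
lemma summable_coeff {h : ℝ → ℝ} (hh : ContDiff ℝ 1 h) (hp : Function.Periodic h (2 * π)) :
    Summable fun n => ‖coeff h n‖ := by
  have hp' : Function.Periodic (deriv h) (2 * π) := periodic_deriv hp
  have h1 := summable_sq_coeff (hh.continuous_deriv (le_refl _)) hp'
  have h2 : Summable fun n : ℤ => 1 / (n : ℝ) ^ 2 := Real.summable_one_div_int_pow.mpr one_lt_two
  refine Summable.of_norm_bounded_eventually (h1.add h2) ?_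
  rw [Filter.eventually_cofinite]
  refine (Set.finite_singleton (0 : ℤ)).subset ?_
  intro n hn
  by_contra hn0
  apply hn
  have hn0 : (n : ℤ) ≠ 0 := hn0
  have hpos : 0 < |(n : ℝ)| := abs_pos.mpr (by exact_mod_cast hn0)
  rw [norm_norm, coeff_deriv hh hp, norm_mul, norm_mul, Complex.norm_I, one_mul,
    Complex.norm_intCast, ← sq_abs (n : ℝ)]
  set t := |(n : ℝ)|
  set c := ‖coeff h n‖
  have e : (t * c) * (1 / t) = c := by field_simp
  have e2 : (1 / t) ^ 2 = 1 / t ^ 2 := by rw [one_div_pow]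
  nlinarith [sq_nonneg (t * c - 1 / t), sq_nonneg (t * c), sq_nonneg (1 / t)]

lemma summable_trigSum {a : ℤ → ℂ} (ha : Summable fun n => ‖a n‖) (ξ : ℝ) :
    Summable fun n : ℤ => a n * Complex.exp (Complex.I * n * ξ) := by
  apply Summable.of_norm
  simpa [norm_mul, norm_exp_mode] using ha

lemma abs_trigSum_le {a : ℤ → ℂ} (ha : Summable fun n => ‖a n‖) (ξ : ℝ) :
    |trigSum a ξ| ≤ ∑' n, ‖a n‖ := by
  refine (Complex.abs_re_le_norm _).trans ?_
  have : Summable fun n : ℤ => ‖a n * Complex.exp (Complex.I * n * ξ)‖ := by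
    simpa [norm_mul, norm_exp_mode] using ha
  refine (norm_tsum_le_tsum_norm this).trans (le_of_eq ?_)
  simp [norm_exp_mode]

lemma continuous_trigSum {a : ℤ → ℂ} (ha : Summable fun n => ‖a n‖) : Continuous (trigSum a) := by
  refine Complex.continuous_re.comp (continuous_tsum (fun n => by fun_prop) ha ?_)
  intro n x
  simp [norm_exp_mode]

lemma periodic_trigSum (a : ℤ → ℂ) : Function.Periodic (trigSum a) (2 * π) := by
  intro ξ
  unfold trigSum
  congr 2
  ext n
  congr 1
  rw [Complex.exp_eq_exp_iff_exists_int]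
  exact ⟨n, by push_cast; ring⟩

lemma trigSum_add {a b : ℤ → ℂ} (ha : Summable fun n => ‖a n‖) (hb : Summable fun n => ‖b n‖)
    (ξ : ℝ) : trigSum (fun n => a n + b n) ξ = trigSum a ξ + trigSum b ξ := by
  unfold trigSum
  rw [← Complex.add_re, ← (summable_trigSum ha ξ).tsum_add (summable_trigSum hb ξ)]
  simp_rw [add_mul]

lemma trigSum_sub {a b : ℤ → ℂ} (ha : Summable fun n => ‖a n‖) (hb : Summable fun n => ‖b n‖)
    (ξ : ℝ) : trigSum (fun n => a n - b n) ξ = trigSum a ξ - trigSum b ξ := by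
  unfold trigSum
  rw [← Complex.sub_re, ← (summable_trigSum ha ξ).tsum_sub (summable_trigSum hb ξ)]
  simp_rw [sub_mul]

lemma trigSum_const_mul (c : ℝ) (a : ℤ → ℂ) (ξ : ℝ) :
    trigSum (fun n => c * a n) ξ = c * trigSum a ξ := by
  unfold trigSum
  simp_rw [mul_assoc]
  rw [tsum_mul_left, Complex.re_ofReal_mul]

/-- Term-by-term differentiation. -/
lemma hasDerivAt_trigSum {a : ℤ → ℂ} (ha : Summable fun n => ‖a n‖)
    (ha' : Summable fun n : ℤ => ‖Complex.I * n * a n‖) (ξ : ℝ) :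
    HasDerivAt (trigSum a) (trigSum (fun n => Complex.I * n * a n) ξ) ξ := by
  have h1 : ∀ (n : ℤ) (y : ℝ), HasDerivAt (fun y : ℝ => a n * Complex.exp (Complex.I * n * y))
      (Complex.I * n * a n * Complex.exp (Complex.I * n * y)) y := by
    intro n y
    have h1 : HasDerivAt (fun ξ : ℝ => (Complex.I * n * (ξ : ℂ))) (Complex.I * n) y := by
      simpa using ((hasDerivAt_id y).ofReal_comp.const_mul (Complex.I * n))
    have e : Complex.I * n * a n * Complex.exp (Complex.I * n * y) =
        a n * (Complex.exp (Complex.I * n * y) * (Complex.I * n)) := by ring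
    rw [e]
    exact h1.cexp.const_mul (a n)
  have h2 := hasDerivAt_tsum ha' h1 (fun n y => by simp [norm_exp_mode])
    (summable_trigSum ha 0) ξ
  exact (Complex.reCLM.hasFDerivAt.comp_hasDerivAt ξ h2)

lemma integral_exp_mode {n : ℤ} (hn : n ≠ 0) :
    ∫ ξ in (0 : ℝ)..(2 * π), Complex.exp (Complex.I * n * ξ) = 0 := by
  have hc : Complex.I * n ≠ 0 := mul_ne_zero Complex.I_ne_zero (by exact_mod_cast hn)
  rw [integral_exp_mul_complex hc]
  have : Complex.exp (Complex.I * n * ((2 * π : ℝ) : ℂ)) = 1 := by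
    rw [Complex.exp_eq_one_iff]; exact ⟨n, by push_cast; ring⟩
  rw [this]; simp

/-- A trigonometric series without a `k`-th and `-k`-th term has no `k`-th Fourier coefficient. -/
lemma coeff_trigSum_eq_zero {a : ℤ → ℂ} (ha : Summable fun n => ‖a n‖) {k : ℤ} (hk : a k = 0)
    (hk' : a (-k) = 0) : coeff (trigSum a) k = 0 := by
  have key : ∀ j : ℤ, a j = 0 → ∫ ξ in (0 : ℝ)..(2 * π),
      (∑' n : ℤ, a n * Complex.exp (Complex.I * n * ξ)) *
        Complex.exp (-(Complex.I * j * ξ)) = 0 := by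
    intro j hj
    have h1 : HasSum (fun n : ℤ => ∫ ξ in (0 : ℝ)..(2 * π),
        a n * Complex.exp (Complex.I * n * ξ) * Complex.exp (-(Complex.I * j * ξ)))
        (∫ ξ in (0 : ℝ)..(2 * π), (∑' n : ℤ, a n * Complex.exp (Complex.I * n * ξ)) *
          Complex.exp (-(Complex.I * j * ξ))) := by
      apply intervalIntegral.hasSum_integral_of_dominated_convergence (fun n _ => ‖a n‖)
      · intro n
        exact Continuous.aestronglyMeasurable (by fun_prop)
      · intro n
        refine Filter.Eventually.of_forall fun ξ _ => ?_
        rw [norm_mul, norm_mul, norm_exp_mode, norm_exp_neg_mode, mul_one, mul_one]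
      · exact Filter.Eventually.of_forall fun ξ _ => ha
      · exact continuous_const.intervalIntegrable _ _
      · refine Filter.Eventually.of_forall fun ξ _ => ?_
        exact (summable_trigSum ha ξ).hasSum.mul_right _
    rw [← h1.tsum_eq]
    convert tsum_zero with n
    by_cases hn : n = j
    · simp [hn, hj]
    · have : ∀ ξ : ℝ, a n * Complex.exp (Complex.I * n * ξ) * Complex.exp (-(Complex.I * j * ξ)) =
          a n * Complex.exp (Complex.I * (n - j : ℤ) * ξ) := by
        intro ξ
        rw [mul_assoc, ← Complex.exp_add]
        congr 2; push_cast; ring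
      simp_rw [this]
      rw [intervalIntegral.integral_const_mul, integral_exp_mode (sub_ne_zero.mpr hn), mul_zero]
  have hcont : Continuous fun ξ : ℝ => ∑' n : ℤ, a n * Complex.exp (Complex.I * n * ξ) :=
    continuous_tsum (fun n => by fun_prop) ha (fun n x => by simp [norm_exp_mode])
  -- the real part is half the sum of the series and its conjugate
  have e : ∀ ξ : ℝ, (trigSum a ξ : ℂ) * Complex.exp (-(Complex.I * k * ξ)) =
      1 / 2 * ((∑' n : ℤ, a n * Complex.exp (Complex.I * n * ξ)) *
          Complex.exp (-(Complex.I * k * ξ))) +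
      1 / 2 * (starRingEnd ℂ) ((∑' n : ℤ, a n * Complex.exp (Complex.I * n * ξ)) *
          Complex.exp (-(Complex.I * (-k : ℤ) * ξ))) := by
    intro ξ
    rw [trigSum, Complex.re_eq_add_conj, map_mul, ← Complex.exp_conj]
    simp only [map_neg, map_mul, Complex.conj_I, Complex.conj_ofReal, map_intCast]
    generalize (∑' n : ℤ, a n * Complex.exp (Complex.I * n * ξ)) = z
    push_cast
    ring_nf
  unfold coeff
  simp_rw [e]
  rw [intervalIntegral.integral_add, intervalIntegral.integral_const_mul,
    intervalIntegral.integral_const_mul, intervalIntegral.intervalIntegral_conj, key k hk,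
    key (-k) hk']
  · simp
  · exact Continuous.intervalIntegrable (by fun_prop) _ _
  · exact Continuous.intervalIntegrable (by
      refine continuous_const.mul (Complex.continuous_conj.comp ?_)
      fun_prop) _ _

/-! ### Inverting the wave operator off the critical modes -/

/-- The real symbol `m n = p₄ n⁴ - p₂ n² + p₀` of the operator `L = p₄ ∂⁵ + p₂ ∂³ + p₀ ∂`, which
acts on `e^{inξ}` as multiplication by `i n (m n)`. -/
def waveSymbol (p₄ p₂ p₀ : ℝ) (n : ℤ) : ℝ := p₄ * (n : ℝ) ^ 4 - p₂ * (n : ℝ) ^ 2 + p₀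

lemma waveSymbol_neg (p₄ p₂ p₀ : ℝ) (n : ℤ) :
    waveSymbol p₄ p₂ p₀ (-n) = waveSymbol p₄ p₂ p₀ n := by
  simp [waveSymbol, Even.neg_pow (show Even 4 by decide)]

/-- The Fourier multiplier `1 / (i n (m n))` on the modes `|n| ≥ 2`, extended by zero to the modes
`|n| ≤ 1` that carry the kernel. -/
def invSymbol (m : ℤ → ℝ) (n : ℤ) : ℂ := if 2 ≤ |n| then 1 / (Complex.I * n * m n) else 0

/-- The `j`-th derivative of the solution `w`, with modes `|n| ≥ 2` only, of `L w = P h`, where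
`L` has symbol `i n (m n)` and `P` removes the modes `|n| ≤ 1`. -/
def solOp (m : ℤ → ℝ) (j : ℕ) (h : ℝ → ℝ) : ℝ → ℝ :=
  trigSum fun n => (Complex.I * n) ^ j * (invSymbol m n * coeff h n)

/-- A bound for `solOp m j`, `j ≤ 3`, in the supremum norm when `m n ≥ c₀ n⁴` for `|n| ≥ 2`. -/
def solBound (c₀ : ℝ) : ℝ := ∑' n : ℤ, 1 / c₀ * (1 / (n : ℝ) ^ 2)

lemma summable_solBound (c₀ : ℝ) : Summable fun n : ℤ => 1 / c₀ * (1 / (n : ℝ) ^ 2) :=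
  (Real.summable_one_div_int_pow.mpr one_lt_two).mul_left _

lemma solBound_nonneg {c₀ : ℝ} (hc : 0 < c₀) : 0 ≤ solBound c₀ :=
  tsum_nonneg fun n => by positivity

section
variable {m : ℤ → ℝ} {c₀ : ℝ}

lemma norm_invSymbol_le (hc : 0 < c₀) (hm : ∀ n : ℤ, 2 ≤ |n| → c₀ * (n : ℝ) ^ 4 ≤ m n)
    {j : ℕ} {k : ℕ} (hj : j + k = 5) (n : ℤ) :
    ‖(Complex.I * n) ^ j * invSymbol m n‖ ≤ 1 / c₀ * (1 / |(n : ℝ)| ^ k) := by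
  unfold invSymbol
  split_ifs with h
  · have hn : 0 < |(n : ℝ)| := by
      rw [abs_pos, Int.cast_ne_zero]; rintro rfl; simp at h
    have h4 : 0 < c₀ * |(n : ℝ)| ^ 4 := by positivity
    have hmn : c₀ * |(n : ℝ)| ^ 4 ≤ m n := by
      have := hm n h
      rwa [← (show Even 4 by decide).pow_abs] at this
    have hm0 : 0 < m n := h4.trans_le hmn
    rw [norm_mul, norm_pow, norm_mul, norm_div, norm_mul, norm_mul, Complex.norm_I, one_mul,
      Complex.norm_intCast, Complex.norm_real, norm_one, Real.norm_eq_abs, abs_of_pos hm0]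
    rw [mul_one_div, div_mul_div_comm, one_mul, div_le_div_iff₀ (by positivity) (by positivity)]
    calc |(n : ℝ)| ^ j * (c₀ * |(n : ℝ)| ^ k) = |(n : ℝ)| * (c₀ * |(n : ℝ)| ^ 4) := by
          have : |(n : ℝ)| ^ j * |(n : ℝ)| ^ k = |(n : ℝ)| ^ 5 := by rw [← pow_add, hj]
          linear_combination c₀ * this
      _ ≤ |(n : ℝ)| * m n := by gcongr
      _ = 1 * (|(n : ℝ)| * m n) := by ring
  · simp; positivity

lemma norm_invSymbol_le_sq (hc : 0 < c₀) (hm : ∀ n : ℤ, 2 ≤ |n| → c₀ * (n : ℝ) ^ 4 ≤ m n)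
    {j : ℕ} (hj : j ≤ 3) (n : ℤ) :
    ‖(Complex.I * n) ^ j * invSymbol m n‖ ≤ 1 / c₀ * (1 / (n : ℝ) ^ 2) := by
  refine (norm_invSymbol_le hc hm (k := 5 - j) (by omega) n).trans ?_
  rcases eq_or_ne n 0 with rfl | hn
  · have : 5 - j ≠ 0 := by omega
    simp [this]
  · have h1 : 1 ≤ |(n : ℝ)| := by
      rw [← Int.cast_abs]; exact_mod_cast Int.one_le_abs hn
    rw [← sq_abs (n : ℝ)]
    have : |(n : ℝ)| ^ 2 ≤ |(n : ℝ)| ^ (5 - j) := pow_le_pow_right₀ h1 (by omega)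
    gcongr

lemma norm_solOp_term_le (hc : 0 < c₀) (hm : ∀ n : ℤ, 2 ≤ |n| → c₀ * (n : ℝ) ^ 4 ≤ m n)
    {j : ℕ} (hj : j ≤ 3) {h : ℝ → ℝ} {D : ℝ} (hD : ∀ ξ, |h ξ| ≤ D) (n : ℤ) :
    ‖(Complex.I * n) ^ j * (invSymbol m n * coeff h n)‖ ≤ 1 / c₀ * (1 / (n : ℝ) ^ 2) * D := by
  rw [← mul_assoc, norm_mul]
  exact mul_le_mul (norm_invSymbol_le_sq hc hm hj n) (norm_coeff_le hD n) (norm_nonneg _)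
    (by positivity)

lemma summable_solOp (hc : 0 < c₀) (hm : ∀ n : ℤ, 2 ≤ |n| → c₀ * (n : ℝ) ^ 4 ≤ m n)
    {j : ℕ} (hj : j ≤ 3) {h : ℝ → ℝ} {D : ℝ} (hD : ∀ ξ, |h ξ| ≤ D) :
    Summable fun n : ℤ => ‖(Complex.I * n) ^ j * (invSymbol m n * coeff h n)‖ :=
  Summable.of_nonneg_of_le (fun _ => norm_nonneg _) (norm_solOp_term_le hc hm hj hD)
    ((summable_solBound c₀).mul_right D)

/-- If `h` has summable Fourier coefficients, `solOp m 0 h` gains two more derivatives. -/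
lemma summable_solOp_of_summable (hc : 0 < c₀)
    (hm : ∀ n : ℤ, 2 ≤ |n| → c₀ * (n : ℝ) ^ 4 ≤ m n)
    {j : ℕ} (hj : j ≤ 5) {h : ℝ → ℝ} (hs : Summable fun n => ‖coeff h n‖) :
    Summable fun n : ℤ => ‖(Complex.I * n) ^ j * (invSymbol m n * coeff h n)‖ := by
  refine Summable.of_nonneg_of_le (fun _ => norm_nonneg _) (fun n => ?_) (hs.mul_left (1 / c₀))
  rw [← mul_assoc, norm_mul]
  refine mul_le_mul_of_nonneg_right ?_ (norm_nonneg _)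
  rcases eq_or_ne n 0 with rfl | hn
  · simp [invSymbol]; positivity
  · refine (norm_invSymbol_le hc hm (k := 5 - j) (by omega) n).trans ?_
    have h1 : 1 ≤ |(n : ℝ)| := by
      rw [← Int.cast_abs]; exact_mod_cast Int.one_le_abs hn
    have h2 : (1 : ℝ) ≤ |(n : ℝ)| ^ (5 - j) := one_le_pow₀ h1
    have h3 : 1 / |(n : ℝ)| ^ (5 - j) ≤ 1 := by
      rw [div_le_one (by positivity)]; exact h2
    calc _ ≤ 1 / c₀ * 1 := by gcongr
      _ = _ := mul_one _

lemma abs_solOp_le (hc : 0 < c₀) (hm : ∀ n : ℤ, 2 ≤ |n| → c₀ * (n : ℝ) ^ 4 ≤ m n)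
    {j : ℕ} (hj : j ≤ 3) {h : ℝ → ℝ} {D : ℝ} (hD : ∀ ξ, |h ξ| ≤ D) (ξ : ℝ) :
    |solOp m j h ξ| ≤ solBound c₀ * D := by
  refine (abs_trigSum_le (summable_solOp hc hm hj hD) ξ).trans ?_
  rw [solBound, ← tsum_mul_right]
  exact (summable_solOp hc hm hj hD).tsum_le_tsum (norm_solOp_term_le hc hm hj hD)
    ((summable_solBound c₀).mul_right D)

lemma solOp_sub (hc : 0 < c₀) (hm : ∀ n : ℤ, 2 ≤ |n| → c₀ * (n : ℝ) ^ 4 ≤ m n)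
    {j : ℕ} (hj : j ≤ 3) {h g : ℝ → ℝ} (hh : Continuous h) (hg : Continuous g) {D D' : ℝ}
    (hD : ∀ ξ, |h ξ| ≤ D) (hD' : ∀ ξ, |g ξ| ≤ D') (ξ : ℝ) :
    solOp m j (fun s => h s - g s) ξ = solOp m j h ξ - solOp m j g ξ := by
  unfold solOp
  rw [← trigSum_sub (summable_solOp hc hm hj hD) (summable_solOp hc hm hj hD')]
  congr 1
  ext n
  rw [coeff_sub hh hg]
  ring

lemma solOp_const_mul (j : ℕ) (c : ℝ) (h : ℝ → ℝ) (ξ : ℝ) :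
    solOp m j (fun s => c * h s) ξ = c * solOp m j h ξ := by
  unfold solOp
  rw [← trigSum_const_mul]
  congr 1
  ext n
  rw [coeff_const_mul]
  ring

lemma continuous_solOp (hc : 0 < c₀) (hm : ∀ n : ℤ, 2 ≤ |n| → c₀ * (n : ℝ) ^ 4 ≤ m n)
    {j : ℕ} (hj : j ≤ 3) {h : ℝ → ℝ} {D : ℝ} (hD : ∀ ξ, |h ξ| ≤ D) :
    Continuous (solOp m j h) :=
  continuous_trigSum (summable_solOp hc hm hj hD)

lemma periodic_solOp (j : ℕ) (h : ℝ → ℝ) : Function.Periodic (solOp m j h) (2 * π) :=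
  periodic_trigSum _

lemma hasDerivAt_solOp_aux {j : ℕ} {h : ℝ → ℝ}
    (h1 : Summable fun n : ℤ => ‖(Complex.I * n) ^ j * (invSymbol m n * coeff h n)‖)
    (h2 : Summable fun n : ℤ => ‖(Complex.I * n) ^ (j + 1) * (invSymbol m n * coeff h n)‖)
    (ξ : ℝ) : HasDerivAt (solOp m j h) (solOp m (j + 1) h ξ) ξ := by
  have e : ∀ n : ℤ, (Complex.I * n) ^ (j + 1) * (invSymbol m n * coeff h n) =
      Complex.I * n * ((Complex.I * n) ^ j * (invSymbol m n * coeff h n)) := by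
    intro n; ring
  unfold solOp
  simp_rw [e] at h2 ⊢
  exact hasDerivAt_trigSum h1 h2 ξ

lemma hasDerivAt_solOp (hc : 0 < c₀) (hm : ∀ n : ℤ, 2 ≤ |n| → c₀ * (n : ℝ) ^ 4 ≤ m n)
    {j : ℕ} (hj : j ≤ 2) {h : ℝ → ℝ} {D : ℝ} (hD : ∀ ξ, |h ξ| ≤ D) (ξ : ℝ) :
    HasDerivAt (solOp m j h) (solOp m (j + 1) h ξ) ξ :=
  hasDerivAt_solOp_aux (summable_solOp hc hm (by omega) hD) (summable_solOp hc hm (by omega) hD) ξ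

lemma iteratedDeriv_solOp (hc : 0 < c₀) (hm : ∀ n : ℤ, 2 ≤ |n| → c₀ * (n : ℝ) ^ 4 ≤ m n)
    {h : ℝ → ℝ} (hs : Summable fun n => ‖coeff h n‖) {j : ℕ} (hj : j ≤ 5) :
    iteratedDeriv j (solOp m 0 h) = solOp m j h := by
  induction j with
  | zero => simp
  | succ j ih =>
    rw [iteratedDeriv_succ, ih (by omega)]
    ext ξ
    exact (hasDerivAt_solOp_aux (summable_solOp_of_summable hc hm (by omega) hs)
      (summable_solOp_of_summable hc hm (by omega) hs) ξ).deriv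

lemma contDiff_solOp (hc : 0 < c₀) (hm : ∀ n : ℤ, 2 ≤ |n| → c₀ * (n : ℝ) ^ 4 ≤ m n)
    {h : ℝ → ℝ} (hs : Summable fun n => ‖coeff h n‖) : ContDiff ℝ 5 (solOp m 0 h) := by
  have h5 : ((5 : ℕ) : WithTop ℕ∞) = 5 := rfl
  rw [← h5, contDiff_nat_iff_iteratedDeriv]
  refine ⟨fun j hj => ?_, fun j hj => ?_⟩
  · rw [iteratedDeriv_solOp hc hm hs hj]
    exact continuous_trigSum (summable_solOp_of_summable hc hm hj hs)
  · rw [iteratedDeriv_solOp hc hm hs (by omega)]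
    exact fun ξ => (hasDerivAt_solOp_aux (summable_solOp_of_summable hc hm (by omega) hs)
      (summable_solOp_of_summable hc hm (by omega) hs) ξ).differentiableAt

lemma coeff_solOp_eq_zero (hc : 0 < c₀) (hm : ∀ n : ℤ, 2 ≤ |n| → c₀ * (n : ℝ) ^ 4 ≤ m n)
    {h : ℝ → ℝ} {D : ℝ} (hD : ∀ ξ, |h ξ| ≤ D) {k : ℤ} (hk : |k| ≤ 1) :
    coeff (solOp m 0 h) k = 0 := by
  have h1 : ¬ 2 ≤ |k| := by omega
  apply coeff_trigSum_eq_zero (summable_solOp hc hm (by omega) hD) <;>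
    simp [invSymbol, h1]

end

/-- The inverse operator respects the symmetry `h(ξ) ↦ -h(-ξ)`, since its multiplier is odd. -/
lemma solOp_reflect {m : ℤ → ℝ} (he : ∀ n, m (-n) = m n) {h : ℝ → ℝ}
    (hp : Function.Periodic h (2 * π)) (ξ : ℝ) :
    solOp m 0 (fun s => -h (-s)) ξ = solOp m 0 h (-ξ) := by
  unfold solOp trigSum
  congr 1
  rw [← (Equiv.neg ℤ).tsum_eq]
  congr 1
  ext n
  have h1 : coeff (fun s => -h (-s)) (-n) = -coeff h n := by
    have := coeff_const_mul (-1) (fun s => h (-s)) (-n)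
    rw [coeff_reflect hp, neg_neg] at this
    simpa using this
  have h2 : invSymbol m (-n) = -invSymbol m n := by
    unfold invSymbol
    rw [abs_neg, he]
    split_ifs
    · push_cast; rw [mul_neg, neg_mul, div_neg]
    · simp
  simp only [Equiv.neg_apply, pow_zero, one_mul, h1, h2]
  push_cast
  ring_nf

lemma trigSum_low_modes (c : ℤ → ℂ) (ξ : ℝ) :
    trigSum (fun n => if 2 ≤ |n| then 0 else c n) ξ =
      (c 0 + c 1 * Complex.exp (Complex.I * ξ) + c (-1) * Complex.exp (-(Complex.I * ξ))).re := by
  unfold trigSum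
  rw [tsum_eq_sum (s := {0, 1, -1})]
  · congr 1
    rw [Finset.sum_insert (by decide), Finset.sum_insert (by decide), Finset.sum_singleton]
    simp [add_assoc]
  · intro n hn
    have : 2 ≤ |n| := by
      simp only [Finset.mem_insert, Finset.mem_singleton, not_or] at hn
      rcases abs_cases n with ⟨h, _⟩ | ⟨h, _⟩ <;> omega
    simp [this]

lemma summable_low_modes (c : ℤ → ℂ) :
    Summable fun n : ℤ => ‖if 2 ≤ |n| then 0 else c n‖ := by
  apply summable_of_ne_finset_zero (s := {0, 1, -1})
  intro n hn
  have : 2 ≤ |n| := by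
    simp only [Finset.mem_insert, Finset.mem_singleton, not_or] at hn
    rcases abs_cases n with ⟨h, _⟩ | ⟨h, _⟩ <;> omega
  simp [this]

/-- `solOp` inverts the differential operator up to the modes `|n| ≤ 1`; for an odd right hand
side these are a multiple of `sin`. -/
lemma solOp_equation {p₄ p₂ p₀ c₀ : ℝ} (hc : 0 < c₀)
    (hm : ∀ n : ℤ, 2 ≤ |n| → c₀ * (n : ℝ) ^ 4 ≤ waveSymbol p₄ p₂ p₀ n)
    {h : ℝ → ℝ} (hh : Continuous h) (hp : Function.Periodic h (2 * π))
    (hs : Summable fun n => ‖coeff h n‖) (hodd : ∀ ξ, h (-ξ) = -h ξ) (ξ : ℝ) :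
    p₄ * solOp (waveSymbol p₄ p₂ p₀) 5 h ξ + p₂ * solOp (waveSymbol p₄ p₂ p₀) 3 h ξ +
      p₀ * solOp (waveSymbol p₄ p₂ p₀) 1 h ξ = h ξ + 2 * (coeff h 1).im * sin ξ := by
  set m := waveSymbol p₄ p₂ p₀ with hmdef
  have hneg : ∀ n, coeff h (-n) = -coeff h n := by
    intro n
    rw [← coeff_reflect hp]
    have := coeff_const_mul (-1) h n
    simp only [Complex.ofReal_neg, Complex.ofReal_one, neg_mul, one_mul] at this
    rw [← this]
    congr 1; ext ξ; rw [hodd]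
  have h0 : coeff h 0 = 0 := by
    have := hneg 0
    rw [neg_zero] at this
    exact self_eq_neg.mp this
  have S := fun j (hj : j ≤ 5) => summable_solOp_of_summable hc hm hj hs
  have sm : ∀ (c : ℝ) {a : ℤ → ℂ}, (Summable fun n => ‖a n‖) →
      Summable fun n => ‖(c : ℂ) * a n‖ := by
    intro c a ha
    simpa [norm_mul] using ha.mul_left |c|
  have e1 : p₄ * solOp m 5 h ξ + p₂ * solOp m 3 h ξ + p₀ * solOp m 1 h ξ =
      trigSum (fun n => coeff h n - if 2 ≤ |n| then 0 else coeff h n) ξ := by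
    unfold solOp
    rw [← trigSum_const_mul, ← trigSum_const_mul, ← trigSum_const_mul,
      ← trigSum_add (sm _ (S 5 (by omega))) (sm _ (S 3 (by omega))),
      ← trigSum_add (a := fun n : ℤ => (p₄ : ℂ) * ((Complex.I * n) ^ 5 *
        (invSymbol m n * coeff h n)) + (p₂ : ℂ) * ((Complex.I * n) ^ 3 *
        (invSymbol m n * coeff h n))) _ (sm _ (S 1 (by omega)))]
    · congr 1
      ext n
      unfold invSymbol
      split_ifs with hn
      · have hn0 : (n : ℂ) ≠ 0 := by
          rw [Int.cast_ne_zero]; rintro rfl; simp at hn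
        have hm0 : (m n : ℂ) ≠ 0 := by
          have h4 : 0 < c₀ * (n : ℝ) ^ 4 := by
            have : (n : ℝ) ≠ 0 := by exact_mod_cast hn0
            positivity
          exact_mod_cast (h4.trans_le (hm n hn)).ne'
        have hI5 : Complex.I ^ 5 = Complex.I := by
          rw [show (5 : ℕ) = 4 + 1 from rfl, pow_add, Complex.I_pow_four]; simp
        have hmn : (m n : ℂ) = p₄ * (n : ℂ) ^ 4 - p₂ * (n : ℂ) ^ 2 + p₀ := by
          rw [hmdef, waveSymbol]; push_cast; ring
        rw [mul_pow, mul_pow, hI5, Complex.I_pow_three]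
        field_simp
        rw [hmn]
        ring
      · simp
    · exact (((sm p₄ (S 5 (by omega))).add (sm p₂ (S 3 (by omega)))).of_nonneg_of_le
        (fun _ => norm_nonneg _) (fun _ => norm_add_le _ _))
  rw [e1, trigSum_sub hs (summable_low_modes _), ← eq_trigSum_coeff hh hp hs.of_norm,
    trigSum_low_modes, h0, hneg 1, sub_eq_add_neg]
  congr 1
  have e : (Complex.I * (ξ : ℂ)) = (ξ : ℂ) * Complex.I := mul_comm _ _
  rw [e, ← neg_mul, ← Complex.ofReal_neg]
  simp only [Complex.add_re, Complex.mul_re, Complex.neg_re, Complex.neg_im, Complex.zero_re,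
    Complex.exp_ofReal_mul_I_re, Complex.exp_ofReal_mul_I_im, Real.cos_neg, Real.sin_neg]
  ring

lemma coeff_iteratedDeriv {φ : ℝ → ℝ} {N : ℕ} (hφ : ContDiff ℝ N φ)
    (hp : Function.Periodic φ (2 * π)) {j : ℕ} (hj : j ≤ N) (n : ℤ) :
    Function.Periodic (iteratedDeriv j φ) (2 * π) ∧
      coeff (iteratedDeriv j φ) n = (Complex.I * n) ^ j * coeff φ n := by
  induction j with
  | zero => simpa using hp
  | succ j ih =>
    obtain ⟨h1, h2⟩ := ih (by omega)
    rw [iteratedDeriv_succ]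
    constructor
    · exact periodic_deriv h1
    · have hd : ContDiff ℝ 1 (iteratedDeriv j φ) := by
        apply ContDiff.iterate_deriv' 1 j _ |> fun h => by rw [iteratedDeriv_eq_iterate]; exact h
        exact hφ.of_le (by exact_mod_cast (by omega : 1 + j ≤ N))
      rw [coeff_deriv hd h1, h2]
      ring

/-- A periodic solution `φ` of `L φ = -h` with mean zero and real first Fourier coefficient `a` is
`2a cos` minus the solution operator applied to `h`. -/
lemma eq_sub_solOp {p₄ p₂ p₀ c₀ : ℝ} (hc : 0 < c₀)
    (hm : ∀ n : ℤ, 2 ≤ |n| → c₀ * (n : ℝ) ^ 4 ≤ waveSymbol p₄ p₂ p₀ n)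
    {φ h : ℝ → ℝ} (hφ : ContDiff ℝ 5 φ) (hp : Function.Periodic φ (2 * π))
    (h0 : coeff φ 0 = 0) {a : ℝ} (h1 : coeff φ 1 = a)
    {D : ℝ} (hD : ∀ ξ, |h ξ| ≤ D)
    (heq : ∀ ξ, p₄ * iteratedDeriv 5 φ ξ + p₂ * iteratedDeriv 3 φ ξ + p₀ * iteratedDeriv 1 φ ξ +
      h ξ = 0) (ξ : ℝ) :
    φ ξ = 2 * a * cos ξ - solOp (waveSymbol p₄ p₂ p₀) 0 h ξ := by
  set m := waveSymbol p₄ p₂ p₀ with hmdef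
  have hφ5 : ContDiff ℝ (5 : ℕ) φ := hφ
  have hcont : ∀ j ≤ 5, Continuous (iteratedDeriv j φ) := fun j hj =>
    hφ.continuous_iteratedDeriv j (by exact_mod_cast hj)
  have hch : ∀ n : ℤ, coeff h n = -(Complex.I * n * m n * coeff φ n) := by
    intro n
    have e : h = fun ξ => (-p₄) * iteratedDeriv 5 φ ξ + (-p₂) * iteratedDeriv 3 φ ξ +
        (-p₀) * iteratedDeriv 1 φ ξ := by
      ext ξ; linarith [heq ξ]
    have c5 := (coeff_iteratedDeriv hφ5 hp (j := 5) (by omega) n).2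
    have c3 := (coeff_iteratedDeriv hφ5 hp (j := 3) (by omega) n).2
    have c1 := (coeff_iteratedDeriv hφ5 hp (j := 1) (by omega) n).2
    have k5 : Continuous fun ξ => -p₄ * iteratedDeriv 5 φ ξ := (hcont 5 (by omega)).const_mul _
    have k3 : Continuous fun ξ => -p₂ * iteratedDeriv 3 φ ξ := (hcont 3 (by omega)).const_mul _
    have k1 : Continuous fun ξ => -p₀ * iteratedDeriv 1 φ ξ := (hcont 1 (by omega)).const_mul _
    rw [e, coeff_add (h := fun ξ => -p₄ * iteratedDeriv 5 φ ξ + -p₂ * iteratedDeriv 3 φ ξ)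
      (k5.add k3) k1, coeff_add k5 k3, coeff_const_mul, coeff_const_mul,
      coeff_const_mul, c5, c3, c1, hmdef, waveSymbol]
    have hI5 : Complex.I ^ 5 = Complex.I := by
      rw [show (5 : ℕ) = 4 + 1 from rfl, pow_add, Complex.I_pow_four]; simp
    rw [mul_pow, mul_pow, hI5, Complex.I_pow_three]
    push_cast
    ring
  have hcφ : coeff φ = fun n => (if 2 ≤ |n| then 0 else coeff φ n) -
      (Complex.I * n) ^ 0 * (invSymbol m n * coeff h n) := by
    ext n
    rw [hch n, invSymbol]
    split_ifs with hn
    · have hn0 : (n : ℂ) ≠ 0 := by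
        rw [Int.cast_ne_zero]; rintro rfl; simp at hn
      have hm0 : (m n : ℂ) ≠ 0 := by
        have h4 : 0 < c₀ * (n : ℝ) ^ 4 := by
          have : (n : ℝ) ≠ 0 := by exact_mod_cast hn0
          positivity
        exact_mod_cast (h4.trans_le (hm n hn)).ne'
      field_simp
      simp
    · simp
  have s1 := summable_low_modes (coeff φ)
  have s2 := summable_solOp hc hm (j := 0) (by omega) hD
  have hsum : Summable (coeff φ) := by
    rw [hcφ]; exact s1.of_norm.sub s2.of_norm
  rw [eq_trigSum_coeff hφ.continuous hp hsum ξ]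
  have hneg : coeff φ (-1) = a := by rw [← coeff_conj, h1, Complex.conj_ofReal]
  conv_lhs => rw [hcφ]
  rw [trigSum_sub s1 s2, trigSum_low_modes, h0, h1, hneg]
  unfold solOp
  congr 1
  have e : (Complex.I * (ξ : ℂ)) = (ξ : ℂ) * Complex.I := mul_comm _ _
  rw [e, ← neg_mul, ← Complex.ofReal_neg]
  simp only [Complex.add_re, Complex.re_ofReal_mul, Complex.zero_re,
    Complex.exp_ofReal_mul_I_re, Real.cos_neg]
  ring

/-! ### The bottom drag as a nonlinearity -/

/-- The nonlinear part of the bottom drag along a plane wave of shape `a χ`, divided by `a²`, as a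
function of `s = χ` and `p = χ'`; here `β = Q |k|`, `γ = -C θ / H` and `θ = f / g`. -/
def drag (H θ β γ a s p : ℝ) : ℝ := (β * (|p| * p) + γ * (s * p)) / (H + θ * a * s)

/-- The properties of the nonlinearity `ν a s p` used to construct wave shapes: on the box
`|s|, |p| ≤ 4` and for amplitudes `0 ≤ a ≤ ρ` it is bounded by and Lipschitz with constant `Λ`,
it preserves continuous differentiability, and it is odd in `p`. -/
structure IsDragLike (ν : ℝ → ℝ → ℝ → ℝ) (ρ Λ : ℝ) : Prop where
  bound : ∀ a s p, 0 ≤ a → a ≤ ρ → |s| ≤ 4 → |p| ≤ 4 → |ν a s p| ≤ Λ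
  lipschitz : ∀ a s p a' s' p', 0 ≤ a → a ≤ ρ → |s| ≤ 4 → |p| ≤ 4 → 0 ≤ a' → a' ≤ ρ →
    |s'| ≤ 4 → |p'| ≤ 4 → |ν a s p - ν a' s' p'| ≤ Λ * (|s - s'| + |p - p'| + |a - a'|)
  contDiff : ∀ a (f g : ℝ → ℝ), 0 ≤ a → a ≤ ρ → (∀ ξ, |f ξ| ≤ 4) → ContDiff ℝ 1 f →
    ContDiff ℝ 1 g → ContDiff ℝ 1 fun ξ => ν a (f ξ) (g ξ)
  odd : ∀ a s p, ν a s (-p) = -ν a s p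

lemma contDiff_abs_mul_self : ContDiff ℝ 1 fun x : ℝ => |x| * x := by
  have hd : ∀ x : ℝ, HasDerivAt (fun x : ℝ => |x| * x) (2 * |x|) x := by
    intro x
    rcases lt_trichotomy x 0 with hx | rfl | hx
    · have h1 : HasDerivAt (fun x : ℝ => -(x * x)) (2 * |x|) x := by
        rw [abs_of_neg hx]
        exact ((hasDerivAt_id' x).mul (hasDerivAt_id' x)).neg.congr_deriv (by ring)
      refine h1.congr_of_eventuallyEq ?_
      filter_upwards [eventually_lt_nhds hx] with y hy
      rw [abs_of_neg hy]; ring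
    · rw [abs_zero, mul_zero, hasDerivAt_iff_tendsto_slope]
      have : Filter.Tendsto (fun y : ℝ => |y|) (nhdsWithin 0 {0}ᶜ) (nhds 0) := by
        have := (continuous_abs : Continuous fun y : ℝ => |y|).tendsto 0
        rw [abs_zero] at this
        exact this.mono_left nhdsWithin_le_nhds
      refine this.congr' ?_
      filter_upwards [self_mem_nhdsWithin] with y hy
      have hy : y ≠ 0 := hy
      simp [slope_def_field, hy]
    · have h1 : HasDerivAt (fun x : ℝ => (x * x)) (2 * |x|) x := by
        rw [abs_of_pos hx]
        exact ((hasDerivAt_id' x).mul (hasDerivAt_id' x)).congr_deriv (by ring)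
      refine h1.congr_of_eventuallyEq ?_
      filter_upwards [eventually_gt_nhds hx] with y hy
      rw [abs_of_pos hy]
  rw [contDiff_one_iff_deriv]
  refine ⟨fun x => (hd x).differentiableAt, ?_⟩
  have : deriv (fun x : ℝ => |x| * x) = fun x => 2 * |x| := funext fun x => (hd x).deriv
  rw [this]
  fun_prop

section
variable {H θ β γ M : ℝ}

lemma half_depth_le {t : ℝ} (ht : |t| ≤ H / 2) : H / 2 ≤ H + t := by
  have := (abs_le.mp ht).1
  linarith

lemma abs_drag_num_le {s p D : ℝ} (hs : |s| ≤ D) (hp : |p| ≤ D) :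
    |β * (|p| * p) + γ * (s * p)| ≤ (|β| + |γ|) * D ^ 2 := by
  have hD : 0 ≤ D := (abs_nonneg s).trans hs
  calc |β * (|p| * p) + γ * (s * p)| ≤ |β * (|p| * p)| + |γ * (s * p)| := abs_add_le _ _
    _ = |β| * (|p| * |p|) + |γ| * (|s| * |p|) := by simp [abs_mul]
    _ ≤ |β| * (D * D) + |γ| * (D * D) := by gcongr
    _ = _ := by ring

lemma abs_drag_le (hH : 0 < H) {a s p D : ℝ} (hden : |θ * a * s| ≤ H / 2) (hs : |s| ≤ D)
    (hp : |p| ≤ D) : |drag H θ β γ a s p| ≤ 2 / H * (|β| + |γ|) * D ^ 2 := by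
  have h1 := half_depth_le hden
  have h2 : 0 < H + θ * a * s := by linarith
  unfold drag
  rw [abs_div, abs_of_pos h2, div_le_iff₀ h2]
  calc _ ≤ (|β| + |γ|) * D ^ 2 := abs_drag_num_le hs hp
    _ = 2 / H * (|β| + |γ|) * D ^ 2 * (H / 2) := by field_simp
    _ ≤ _ := by gcongr

/-- The Lipschitz constant of the drag nonlinearity relative to the size `|β| + |γ|` of its
coefficients. -/
def dragLip (H M : ℝ) : ℝ := 32 / H + 256 * M / H ^ 2

lemma abs_depth_le {ρ a s : ℝ} (hθ : |θ| ≤ M) (hρ : 8 * M * ρ ≤ H) (ha : 0 ≤ a) (ha' : a ≤ ρ)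
    (hs : |s| ≤ 4) : |θ * a * s| ≤ H / 2 := by
  have hM : 0 ≤ M := (abs_nonneg _).trans hθ
  rw [abs_mul, abs_mul, abs_of_nonneg ha]
  calc |θ| * a * |s| ≤ M * ρ * 4 := by gcongr; exact mul_nonneg hM (ha.trans ha')
    _ ≤ H / 2 := by linarith

lemma abs_drag_num_sub_le {s p s' p' : ℝ} (hp : |p| ≤ 4) (hs' : |s'| ≤ 4) (hp' : |p'| ≤ 4) :
    |(β * (|p| * p) + γ * (s * p)) - (β * (|p'| * p') + γ * (s' * p'))| ≤
      8 * (|β| + |γ|) * (|s - s'| + |p - p'|) := by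
  have e : (β * (|p| * p) + γ * (s * p)) - (β * (|p'| * p') + γ * (s' * p')) =
      β * (|p| * (p - p') + (|p| - |p'|) * p') + γ * ((s - s') * p + s' * (p - p')) := by ring
  rw [e]
  have h1 : |(|p| - |p'|)| ≤ |p - p'| := abs_abs_sub_abs_le_abs_sub p p'
  have h2 : |(|p| * (p - p') + (|p| - |p'|) * p')| ≤ 8 * |p - p'| := by
    calc _ ≤ |(|p| * (p - p'))| + |(|p| - |p'|) * p'| := abs_add_le _ _
      _ = |p| * |p - p'| + |(|p| - |p'|)| * |p'| := by simp [abs_mul]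
      _ ≤ 4 * |p - p'| + |p - p'| * 4 := by gcongr
      _ = _ := by ring
  have h3 : |(s - s') * p + s' * (p - p')| ≤ 4 * (|s - s'| + |p - p'|) := by
    calc _ ≤ |(s - s') * p| + |s' * (p - p')| := abs_add_le _ _
      _ = |s - s'| * |p| + |s'| * |p - p'| := by simp [abs_mul]
      _ ≤ |s - s'| * 4 + 4 * |p - p'| := by gcongr
      _ = _ := by ring
  calc _ ≤ |β| * |(|p| * (p - p') + (|p| - |p'|) * p')| +
        |γ| * |(s - s') * p + s' * (p - p')| := by
        rw [← abs_mul, ← abs_mul]; exact abs_add_le _ _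
    _ ≤ |β| * (8 * |p - p'|) + |γ| * (4 * (|s - s'| + |p - p'|)) := by gcongr
    _ ≤ _ := by
      nlinarith [mul_nonneg (abs_nonneg β) (abs_nonneg (s - s')),
        mul_nonneg (abs_nonneg γ) (abs_nonneg (s - s')),
        mul_nonneg (abs_nonneg γ) (abs_nonneg (p - p'))]

lemma abs_drag_sub_le {ρ : ℝ} (hH : 0 < H) (hθ : |θ| ≤ M) (hρ : 8 * M * ρ ≤ H) (hρ1 : ρ ≤ 1)
    {a s p a' s' p' : ℝ} (ha : 0 ≤ a) (haρ : a ≤ ρ) (hs : |s| ≤ 4) (hp : |p| ≤ 4)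
    (ha' : 0 ≤ a') (haρ' : a' ≤ ρ) (hs' : |s'| ≤ 4) (hp' : |p'| ≤ 4) :
    |drag H θ β γ a s p - drag H θ β γ a' s' p'| ≤
      dragLip H M * (|β| + |γ|) * (|s - s'| + |p - p'| + |a - a'|) := by
  have hM : 0 ≤ M := (abs_nonneg _).trans hθ
  have hD := half_depth_le (abs_depth_le hθ hρ ha haρ hs)
  have hD' := half_depth_le (abs_depth_le hθ hρ ha' haρ' hs')
  have hN' := abs_drag_num_le (β := β) (γ := γ) hs' hp'
  have hNN := abs_drag_num_sub_le (β := β) (γ := γ) (s := s) hp hs' hp'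
  have hDD : |(H + θ * a' * s') - (H + θ * a * s)| ≤
      4 * M * (|s - s'| + |p - p'| + |a - a'|) := by
    have e : (H + θ * a' * s') - (H + θ * a * s) = -(θ * (a * (s - s') + (a - a') * s')) := by ring
    rw [e, abs_neg, abs_mul]
    have h1 : |a * (s - s') + (a - a') * s'| ≤ 4 * (|s - s'| + |p - p'| + |a - a'|) := by
      calc _ ≤ |a * (s - s')| + |(a - a') * s'| := abs_add_le _ _
        _ = a * |s - s'| + |a - a'| * |s'| := by rw [abs_mul, abs_mul, abs_of_nonneg ha]
        _ ≤ 1 * |s - s'| + |a - a'| * 4 := by gcongr; linarith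
        _ ≤ _ := by linarith [abs_nonneg (s - s'), abs_nonneg (p - p')]
    calc _ ≤ M * (4 * (|s - s'| + |p - p'| + |a - a'|)) := by gcongr
      _ = _ := by ring
  unfold drag dragLip
  set N := β * (|p| * p) + γ * (s * p)
  set N' := β * (|p'| * p') + γ * (s' * p')
  set D := H + θ * a * s
  set D' := H + θ * a' * s'
  set G := |β| + |γ|
  set X := |s - s'| + |p - p'| + |a - a'|
  have hG : 0 ≤ G := by positivity
  have hX : 0 ≤ X := by positivity
  have hX' : |s - s'| + |p - p'| ≤ X := by linarith [abs_nonneg (a - a')]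
  have hDp : 0 < D := by linarith
  have hDp' : 0 < D' := by linarith
  have e : N / D - N' / D' = (N - N') / D + N' * (D' - D) / (D * D') := by
    field_simp; ring
  have hDD2 : H ^ 2 / 4 ≤ D * D' := by nlinarith
  rw [e]
  have t1 : |(N - N') / D| ≤ 16 / H * G * X := by
    rw [abs_div, abs_of_pos hDp, div_le_iff₀ hDp]
    calc |N - N'| ≤ 8 * G * X := hNN.trans (by gcongr)
      _ = 16 / H * G * X * (H / 2) := by field_simp; ring
      _ ≤ _ := by gcongr
  have t2 : |N' * (D' - D) / (D * D')| ≤ 256 * M / H ^ 2 * G * X := by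
    rw [abs_div, abs_of_pos (mul_pos hDp hDp'), div_le_iff₀ (mul_pos hDp hDp'), abs_mul]
    calc |N'| * |D' - D| ≤ (G * 4 ^ 2) * (4 * M * X) := by gcongr
      _ = 256 * M / H ^ 2 * G * X * (H ^ 2 / 4) := by field_simp; ring
      _ ≤ _ := by gcongr
  calc _ ≤ 16 / H * G * X + 256 * M / H ^ 2 * G * X := (abs_add_le _ _).trans (add_le_add t1 t2)
    _ ≤ (32 / H + 256 * M / H ^ 2) * G * X := by
      have : 0 ≤ 16 / H * G * X := by positivity
      have e32 : 32 / H = 16 / H + 16 / H := by ring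
      rw [e32]; linarith

/-- Rescaling the amplitude: the nonlinearity is quadratic, up to the depth in its denominator. -/
lemma drag_homogeneous {a : ℝ} (ha : 0 ≤ a) (s p : ℝ) :
    drag H θ β γ 1 (a * s) (a * p) = a ^ 2 * drag H θ β γ a s p := by
  unfold drag
  rw [abs_mul, abs_of_nonneg ha, ← mul_div_assoc]
  congr 1 <;> ring

/-- The drag of a plane wave is its linearization plus the nonlinearity `drag`; the deviation of the
linear drag coefficient from `C / H` accounts for the term with `γ`. -/
lemma drag_split {C Q k : ℝ} (hH : 0 < H) {s p : ℝ} (hs : 0 < H + θ * s) :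
    (C + Q * (k * |p|)) / (H + θ * s) * p =
      C / H * p + drag H θ (Q * k) (-(C * θ / H)) 1 s p := by
  unfold drag
  rw [mul_one]
  field_simp
  ring

lemma isDragLike_drag {ρ Λ : ℝ} (hH : 0 < H) (hθ : |θ| ≤ M) (hρ : 8 * M * ρ ≤ H) (hρ1 : ρ ≤ 1)
    (hΛ : dragLip H M * (|β| + |γ|) ≤ Λ) : IsDragLike (drag H θ β γ) ρ Λ where
  bound a s p ha ha' hs hp := by
    have hM : 0 ≤ M := (abs_nonneg _).trans hθ
    refine (abs_drag_le hH (abs_depth_le hθ hρ ha ha' hs) hs hp).trans (le_trans ?_ hΛ)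
    have : 2 / H * (|β| + |γ|) * 4 ^ 2 = 32 / H * (|β| + |γ|) := by ring
    rw [this]
    unfold dragLip
    gcongr
    have : 0 ≤ 256 * M / H ^ 2 := by positivity
    linarith
  lipschitz a s p a' s' p' ha haρ hs hp ha' haρ' hs' hp' :=
    (abs_drag_sub_le hH hθ hρ hρ1 ha haρ hs hp ha' haρ' hs' hp').trans
      (mul_le_mul_of_nonneg_right hΛ (by positivity))
  contDiff a f g ha ha' hf hfc hgc := by
    unfold drag
    apply ContDiff.div
    · have := contDiff_abs_mul_self.comp hgc
      exact (contDiff_const.mul this).add (contDiff_const.mul (hfc.mul hgc))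
    · exact contDiff_const.add (contDiff_const.mul hfc)
    · intro ξ
      have := half_depth_le (abs_depth_le hθ hρ ha ha' (hf ξ))
      have : 0 < H + θ * a * f ξ := by linarith
      exact this.ne'
  odd a s p := by
    unfold drag
    rw [abs_neg, ← neg_div]
    congr 1; ring

end

/-! ### Rescaled wave shapes by contraction -/

/-- `χ` is a rescaled wave shape of amplitude `a`: it stays in the box on which the nonlinearity
`ν` is controlled and solves `χ = 2 cos - a L⁻¹ P ν(χ, χ')`. The wave shape itself is `a χ`. -/
structure IsShape (m : ℤ → ℝ) (ν : ℝ → ℝ → ℝ → ℝ) (a : ℝ) (χ : ℝ → ℝ) : Prop where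
  contDiff : ContDiff ℝ 1 χ
  bound : ∀ ξ, |χ ξ| ≤ 4
  bound_deriv : ∀ ξ, |deriv χ ξ| ≤ 4
  eq : ∀ ξ, χ ξ = 2 * cos ξ - a * solOp m 0 (fun s => ν a (χ s) (deriv χ s)) ξ

/-- Truncation to the interval `[-4, 4]`. -/
def clamp (x : ℝ) : ℝ := max (-4) (min x 4)

lemma abs_clamp_le (x : ℝ) : |clamp x| ≤ 4 := by
  unfold clamp
  rw [abs_le]
  exact ⟨le_max_left _ _, max_le (by norm_num) (min_le_right _ _)⟩

lemma clamp_eq {x : ℝ} (hx : |x| ≤ 4) : clamp x = x := by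
  unfold clamp
  rw [min_eq_left (abs_le.mp hx).2, max_eq_right (abs_le.mp hx).1]

lemma abs_clamp_sub_le (x y : ℝ) : |clamp x - clamp y| ≤ |x - y| := by
  unfold clamp
  refine (abs_max_sub_max_le_max _ _ _ _).trans ?_
  rw [sub_self, abs_zero, max_eq_right (abs_nonneg _)]
  refine (abs_min_sub_min_le_max _ _ _ _).trans ?_
  rw [sub_self, abs_zero, max_eq_left (abs_nonneg _)]

lemma continuous_clamp : Continuous clamp := by unfold clamp; fun_prop

/-- Contraction principle for bounded continuous functions. -/
lemma exists_continuous_fixedPoint (F : (ℝ → ℝ × ℝ) → ℝ → ℝ × ℝ)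
    (hcont : ∀ u, Continuous u → Continuous (F u)) (B : ℝ)
    (hbdd : ∀ u, Continuous u → ∀ ξ, ‖F u ξ‖ ≤ B)
    (hlip : ∀ u v, Continuous u → Continuous v → ∀ D, (∀ ξ, ‖u ξ - v ξ‖ ≤ D) →
      ∀ ξ, ‖F u ξ - F v ξ‖ ≤ D / 2) :
    ∃ u, Continuous u ∧ F u = u := by
  let G : BoundedContinuousFunction ℝ (ℝ × ℝ) → BoundedContinuousFunction ℝ (ℝ × ℝ) := fun u =>
    BoundedContinuousFunction.ofNormedAddCommGroup (F u) (hcont u u.continuous) B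
      (hbdd u u.continuous)
  have hG : ContractingWith (1 / 2) G := by
    refine ⟨by norm_num, LipschitzWith.of_dist_le_mul fun u v => ?_⟩
    rw [BoundedContinuousFunction.dist_le (by positivity)]
    intro ξ
    rw [dist_eq_norm]
    refine (hlip u v u.continuous v.continuous (dist u v) (fun ξ => ?_) ξ).trans (le_of_eq ?_)
    · rw [← dist_eq_norm]; exact BoundedContinuousFunction.dist_coe_le_dist ξ
    · push_cast; ring
  let u : BoundedContinuousFunction ℝ (ℝ × ℝ) := ContractingWith.fixedPoint G hG
  have hu : G u = u := hG.fixedPoint_isFixedPt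
  exact ⟨⇑u, u.continuous, congrArg (fun w : BoundedContinuousFunction ℝ (ℝ × ℝ) => ⇑w) hu⟩

section
variable {m : ℤ → ℝ} {ν : ℝ → ℝ → ℝ → ℝ} {ρ Λ c₀ : ℝ}

lemma IsDragLike.continuous_comp (hν : IsDragLike ν ρ Λ) {a : ℝ} (ha : 0 ≤ a) (haρ : a ≤ ρ)
    {f g : ℝ → ℝ} (hf : Continuous f) (hg : Continuous g) (hfb : ∀ ξ, |f ξ| ≤ 4)
    (hgb : ∀ ξ, |g ξ| ≤ 4) : Continuous fun ξ => ν a (f ξ) (g ξ) := by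
  rw [continuous_iff_continuousAt]
  intro x
  rw [ContinuousAt, tendsto_iff_dist_tendsto_zero]
  have h1 : Continuous fun y => Λ * (|f y - f x| + |g y - g x| + |a - a|) := by fun_prop
  have h2 := h1.tendsto x
  simp only [sub_self, abs_zero, add_zero, mul_zero] at h2
  refine squeeze_zero (fun _ => dist_nonneg) (fun y => ?_) h2
  rw [Real.dist_eq]
  simpa using hν.lipschitz a (f y) (g y) a (f x) (g x) ha haρ (hfb y) (hgb y) ha haρ (hfb x) (hgb x)

/-- The system `χ = 2 cos - a L⁻¹ P ν(χ, χ')`, `p = χ'` has a solution for small `a`. -/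
lemma exists_isShape (hν : IsDragLike ν ρ Λ) (hc : 0 < c₀)
    (hm : ∀ n : ℤ, 2 ≤ |n| → c₀ * (n : ℝ) ^ 4 ≤ m n) (hΛ : 0 ≤ Λ)
    (hsmall : 4 * ρ * solBound c₀ * Λ ≤ 1) {a : ℝ} (ha : 0 ≤ a) (haρ : a ≤ ρ) :
    ∃ χ, IsShape m ν a χ := by
  have hS := solBound_nonneg hc
  set g : (ℝ → ℝ × ℝ) → ℝ → ℝ := fun u s => ν a (clamp (u s).1) (clamp (u s).2) with hg
  have hgb : ∀ u s, |g u s| ≤ Λ := fun u s =>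
    hν.bound a _ _ ha haρ (abs_clamp_le _) (abs_clamp_le _)
  have hgc : ∀ u, Continuous u → Continuous (g u) := fun u hu =>
    hν.continuous_comp ha haρ (continuous_clamp.comp (continuous_fst.comp hu))
      (continuous_clamp.comp (continuous_snd.comp hu)) (fun _ => abs_clamp_le _)
      (fun _ => abs_clamp_le _)
  have haS : a * (solBound c₀ * Λ) ≤ 1 := by
    have : a * (solBound c₀ * Λ) ≤ ρ * (solBound c₀ * Λ) := by gcongr
    nlinarith [mul_nonneg hS hΛ]
  have hsol : ∀ j ≤ 1, ∀ u ξ, |a * solOp m j (g u) ξ| ≤ 1 := by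
    intro j hj u ξ
    rw [abs_mul, abs_of_nonneg ha]
    have h1 := abs_solOp_le hc hm (j := j) (by omega) (hgb u) ξ
    calc _ ≤ a * (solBound c₀ * Λ) := by gcongr
      _ ≤ 1 := haS
  set F : (ℝ → ℝ × ℝ) → ℝ → ℝ × ℝ := fun u ξ =>
    (2 * cos ξ - a * solOp m 0 (g u) ξ, -2 * sin ξ - a * solOp m 1 (g u) ξ) with hF
  have hFb : ∀ u ξ, |(F u ξ).1| ≤ 3 ∧ |(F u ξ).2| ≤ 3 := by
    intro u ξ
    have h0 := abs_le.mp (hsol 0 (by omega) u ξ)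
    have h1 := abs_le.mp (hsol 1 (by omega) u ξ)
    have hc := abs_le.mp (abs_cos_le_one ξ)
    have hs := abs_le.mp (abs_sin_le_one ξ)
    simp only [hF, abs_le]
    refine ⟨⟨?_, ?_⟩, ?_, ?_⟩ <;> linarith [h0.1, h0.2, h1.1, h1.2, hc.1, hc.2, hs.1, hs.2]
  obtain ⟨u, huc, hu⟩ := exists_continuous_fixedPoint F
    (fun u hu => by
      have h0 := continuous_solOp hc hm (j := 0) (by omega) (hgb u)
      have h1 := continuous_solOp hc hm (j := 1) (by omega) (hgb u)
      simp only [hF]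
      fun_prop) 3
    (fun u hu ξ => by
      rw [Prod.norm_def]
      exact max_le (hFb u ξ).1 (hFb u ξ).2)
    (fun u v hu hv D hD ξ => by
      have hD0 : 0 ≤ D := (norm_nonneg _).trans (hD 0)
      have hgg : ∀ s, |g u s - g v s| ≤ Λ * (2 * D) := by
        intro s
        have h1 : |(u s).1 - (v s).1| ≤ D := (norm_fst_le (u s - v s)).trans (hD s)
        have h2 : |(u s).2 - (v s).2| ≤ D := (norm_snd_le (u s - v s)).trans (hD s)
        refine (hν.lipschitz a _ _ a _ _ ha haρ (abs_clamp_le _) (abs_clamp_le _) ha haρ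
          (abs_clamp_le _) (abs_clamp_le _)).trans ?_
        have h3 := (abs_clamp_sub_le (u s).1 (v s).1).trans h1
        have h4 := (abs_clamp_sub_le (u s).2 (v s).2).trans h2
        rw [sub_self, abs_zero]
        gcongr
        linarith
      have key : ∀ j ≤ 1, |a * solOp m j (g u) ξ - a * solOp m j (g v) ξ| ≤ D / 2 := by
        intro j hj
        rw [← mul_sub, ← solOp_sub hc hm (by omega) (hgc u hu) (hgc v hv) (hgb u) (hgb v), abs_mul,
          abs_of_nonneg ha]
        have := abs_solOp_le hc hm (j := j) (by omega) hgg ξ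
        calc _ ≤ ρ * (solBound c₀ * (Λ * (2 * D))) := by gcongr; exact ha.trans haρ
          _ = (4 * ρ * solBound c₀ * Λ) * (D / 2) := by ring
          _ ≤ 1 * (D / 2) := by gcongr
          _ = D / 2 := one_mul _
      rw [Prod.norm_def]
      have k0 := key 0 (by omega)
      have k1 := key 1 (by omega)
      rw [abs_sub_comm] at k0 k1
      refine max_le ?_ ?_
      · simp only [hF, Prod.fst_sub, Real.norm_eq_abs]
        rwa [sub_sub_sub_cancel_left]
      · simp only [hF, Prod.snd_sub, Real.norm_eq_abs]
        rwa [sub_sub_sub_cancel_left])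
  have hub : ∀ ξ, |(u ξ).1| ≤ 3 ∧ |(u ξ).2| ≤ 3 := fun ξ => by rw [← hu]; exact hFb u ξ
  have h1 : ∀ ξ, (u ξ).1 = 2 * cos ξ - a * solOp m 0 (g u) ξ := fun ξ =>
    congrArg Prod.fst (congrFun hu ξ).symm
  have h2 : ∀ ξ, (u ξ).2 = -2 * sin ξ - a * solOp m 1 (g u) ξ := fun ξ =>
    congrArg Prod.snd (congrFun hu ξ).symm
  have hder : ∀ ξ, HasDerivAt (fun ξ => (u ξ).1) (u ξ).2 ξ := by
    intro ξ
    rw [funext h1, h2 ξ]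
    have h3 := (hasDerivAt_solOp hc hm (j := 0) (by omega) (hgb u) ξ).const_mul a
    exact (((hasDerivAt_cos ξ).const_mul 2).sub h3).congr_deriv (by ring)
  have hdfun : deriv (fun ξ => (u ξ).1) = fun ξ => (u ξ).2 := funext fun ξ => (hder ξ).deriv
  refine ⟨fun ξ => (u ξ).1, ?_, fun ξ => by linarith [(hub ξ).1], fun ξ => ?_, fun ξ => ?_⟩
  · rw [contDiff_one_iff_deriv, hdfun]
    exact ⟨fun ξ => (hder ξ).differentiableAt, continuous_snd.comp huc⟩
  · rw [hdfun]; linarith [(hub ξ).2]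
  · rw [hdfun, h1 ξ]
    have : g u = fun s => ν a (u s).1 (u s).2 := by
      ext s
      rw [hg]
      simp only
      rw [clamp_eq (by linarith [(hub s).1]), clamp_eq (by linarith [(hub s).2])]
    rw [this]

namespace IsShape
variable {a : ℝ} {χ : ℝ → ℝ}

/-- The nonlinearity evaluated along the shape. -/
def load (ν : ℝ → ℝ → ℝ → ℝ) (a : ℝ) (χ : ℝ → ℝ) : ℝ → ℝ := fun s => ν a (χ s) (deriv χ s)

lemma abs_load_le (h : IsShape m ν a χ) (hν : IsDragLike ν ρ Λ) (ha : 0 ≤ a) (haρ : a ≤ ρ)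
    (ξ : ℝ) : |load ν a χ ξ| ≤ Λ :=
  hν.bound a _ _ ha haρ (h.bound ξ) (h.bound_deriv ξ)

lemma continuous_load (h : IsShape m ν a χ) (hν : IsDragLike ν ρ Λ) (ha : 0 ≤ a) (haρ : a ≤ ρ) :
    Continuous (load ν a χ) :=
  hν.continuous_comp ha haρ h.contDiff.continuous (h.contDiff.continuous_deriv le_rfl)
    h.bound h.bound_deriv

lemma deriv_eq (h : IsShape m ν a χ) (hν : IsDragLike ν ρ Λ) (hc : 0 < c₀)
    (hm : ∀ n : ℤ, 2 ≤ |n| → c₀ * (n : ℝ) ^ 4 ≤ m n) (ha : 0 ≤ a) (haρ : a ≤ ρ) (ξ : ℝ) :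
    deriv χ ξ = -2 * sin ξ - a * solOp m 1 (load ν a χ) ξ := by
  have e : χ = fun ξ => 2 * cos ξ - a * solOp m 0 (load ν a χ) ξ := funext h.eq
  have h3 := (hasDerivAt_solOp hc hm (j := 0) (by omega) (h.abs_load_le hν ha haρ) ξ).const_mul a
  have h4 := (((hasDerivAt_cos ξ).const_mul 2).sub h3)
  conv_lhs => rw [e]
  exact (h4.congr_deriv (by ring)).deriv

/-- Shapes depend on the amplitude in a Lipschitz way, in the `C¹` norm. In particular the shape of
a given amplitude is unique, and it is close to `2 cos` for a small amplitude. -/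
lemma stability (hν : IsDragLike ν ρ Λ) (hc : 0 < c₀)
    (hm : ∀ n : ℤ, 2 ≤ |n| → c₀ * (n : ℝ) ^ 4 ≤ m n) (hΛ : 0 ≤ Λ)
    (hsmall : 4 * ρ * solBound c₀ * Λ ≤ 1) {a' : ℝ} {χ' : ℝ → ℝ} (h : IsShape m ν a χ)
    (h' : IsShape m ν a' χ') (ha : 0 ≤ a) (haρ : a ≤ ρ) (ha' : 0 ≤ a') (haρ' : a' ≤ ρ) (ξ : ℝ) :
    |χ ξ - χ' ξ| ≤ (2 * solBound c₀ * Λ + 1) * |a - a'| ∧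
      |deriv χ ξ - deriv χ' ξ| ≤ (2 * solBound c₀ * Λ + 1) * |a - a'| := by
  have hS := solBound_nonneg hc
  set d : ℝ → ℝ := fun ξ => max |χ ξ - χ' ξ| |deriv χ ξ - deriv χ' ξ| with hd
  have hbdd : BddAbove (range d) := by
    refine ⟨8, ?_⟩
    rintro _ ⟨ξ, rfl⟩
    refine max_le ?_ ?_
    · have := abs_sub (χ ξ) (χ' ξ); linarith [h.bound ξ, h'.bound ξ]
    · have := abs_sub (deriv χ ξ) (deriv χ' ξ); linarith [h.bound_deriv ξ, h'.bound_deriv ξ]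
  set D := ⨆ ξ, d ξ with hD
  have hdD : ∀ ξ, d ξ ≤ D := fun ξ => le_ciSup hbdd ξ
  have hD0 : 0 ≤ D := (le_max_of_le_left (abs_nonneg _)).trans (hdD 0)
  have hl : ∀ s, |load ν a χ s - load ν a' χ' s| ≤ Λ * (2 * D + |a - a'|) := by
    intro s
    refine (hν.lipschitz a _ _ a' _ _ ha haρ (h.bound s) (h.bound_deriv s) ha' haρ' (h'.bound s)
      (h'.bound_deriv s)).trans ?_
    have h1 := (le_max_left _ _).trans (hdD s)
    have h2 := (le_max_right _ _).trans (hdD s)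
    gcongr
    linarith
  have key : ∀ j ≤ 1, ∀ ξ, |a * solOp m j (load ν a χ) ξ - a' * solOp m j (load ν a' χ') ξ| ≤
      (solBound c₀ * Λ + 1 / 2) * |a - a'| + D / 2 := by
    intro j hj ξ
    have e : a * solOp m j (load ν a χ) ξ - a' * solOp m j (load ν a' χ') ξ =
        (a - a') * solOp m j (load ν a χ) ξ +
          a' * solOp m j (fun s => load ν a χ s - load ν a' χ' s) ξ := by
      rw [solOp_sub hc hm (by omega) (h.continuous_load hν ha haρ) (h'.continuous_load hν ha' haρ')
        (h.abs_load_le hν ha haρ) (h'.abs_load_le hν ha' haρ')]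
      ring
    rw [e]
    have h1 := abs_solOp_le hc hm (j := j) (by omega) (h.abs_load_le hν ha haρ) ξ
    have h2 := abs_solOp_le hc hm (j := j) (by omega) hl ξ
    calc _ ≤ |a - a'| * |solOp m j (load ν a χ) ξ| +
          a' * |solOp m j (fun s => load ν a χ s - load ν a' χ' s) ξ| := by
          refine (abs_add_le _ _).trans (le_of_eq ?_)
          rw [abs_mul, abs_mul, abs_of_nonneg ha']
      _ ≤ |a - a'| * (solBound c₀ * Λ) + ρ * (solBound c₀ * (Λ * (2 * D + |a - a'|))) := by
          gcongr; exact ha'.trans haρ'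
      _ = |a - a'| * (solBound c₀ * Λ) + (4 * ρ * solBound c₀ * Λ) * ((2 * D + |a - a'|) / 4) := by
          ring
      _ ≤ |a - a'| * (solBound c₀ * Λ) + 1 * ((2 * D + |a - a'|) / 4) := by gcongr
      _ ≤ _ := by linarith [abs_nonneg (a - a')]
  have hstep : ∀ ξ, d ξ ≤ (solBound c₀ * Λ + 1 / 2) * |a - a'| + D / 2 := by
    intro ξ
    refine max_le ?_ ?_
    · rw [h.eq, h'.eq, sub_sub_sub_cancel_left, abs_sub_comm]
      exact key 0 (by omega) ξ
    · rw [h.deriv_eq hν hc hm ha haρ, h'.deriv_eq hν hc hm ha' haρ', sub_sub_sub_cancel_left,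
        abs_sub_comm]
      exact key 1 (by omega) ξ
  have hfin : D ≤ (solBound c₀ * Λ + 1 / 2) * |a - a'| + D / 2 := ciSup_le hstep
  have hfin' : D ≤ (2 * solBound c₀ * Λ + 1) * |a - a'| := by linarith
  exact ⟨((le_max_left _ _).trans (hdD ξ)).trans hfin',
    ((le_max_right _ _).trans (hdD ξ)).trans hfin'⟩

lemma unique (hν : IsDragLike ν ρ Λ) (hc : 0 < c₀)
    (hm : ∀ n : ℤ, 2 ≤ |n| → c₀ * (n : ℝ) ^ 4 ≤ m n) (hΛ : 0 ≤ Λ)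
    (hsmall : 4 * ρ * solBound c₀ * Λ ≤ 1) {χ' : ℝ → ℝ} (h : IsShape m ν a χ)
    (h' : IsShape m ν a χ') (ha : 0 ≤ a) (haρ : a ≤ ρ) : χ = χ' := by
  ext ξ
  have := (stability hν hc hm hΛ hsmall h h' ha haρ ha haρ ξ).1
  rw [sub_self, abs_zero, mul_zero] at this
  exact sub_eq_zero.mp (abs_nonpos_iff.mp this)

lemma periodic (h : IsShape m ν a χ) : Function.Periodic χ (2 * π) := by
  intro ξ
  rw [h.eq, h.eq, cos_add_two_pi, periodic_solOp]

lemma periodic_load (h : IsShape m ν a χ) : Function.Periodic (load ν a χ) (2 * π) := by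
  intro ξ
  simp only [load, h.periodic ξ, periodic_deriv h.periodic ξ]

/-- Shapes are even: reflecting a shape gives another shape of the same amplitude. -/
lemma even (hν : IsDragLike ν ρ Λ) (hc : 0 < c₀)
    (hm : ∀ n : ℤ, 2 ≤ |n| → c₀ * (n : ℝ) ^ 4 ≤ m n) (he : ∀ n, m (-n) = m n) (hΛ : 0 ≤ Λ)
    (hsmall : 4 * ρ * solBound c₀ * Λ ≤ 1) (h : IsShape m ν a χ) (ha : 0 ≤ a) (haρ : a ≤ ρ)
    (ξ : ℝ) : χ (-ξ) = χ ξ := by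
  have hd : ∀ s, deriv (fun s => χ (-s)) s = -deriv χ (-s) := fun s => deriv_comp_neg χ s
  have h' : IsShape m ν a fun s => χ (-s) := by
    refine ⟨h.contDiff.comp contDiff_neg, fun s => h.bound _, fun s => ?_, fun s => ?_⟩
    · rw [hd, abs_neg]; exact h.bound_deriv _
    · have e : (fun s => ν a (χ (-s)) (deriv (fun s => χ (-s)) s)) =
          fun s => -load ν a χ (-s) := by
        ext s
        rw [hd, hν.odd]
        rfl
      rw [e, solOp_reflect he h.periodic_load, h.eq (-s), cos_neg]
      rfl
  exact congrFun (unique hν hc hm hΛ hsmall h' h ha haρ) ξ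

lemma load_odd (hν : IsDragLike ν ρ Λ) (hc : 0 < c₀)
    (hm : ∀ n : ℤ, 2 ≤ |n| → c₀ * (n : ℝ) ^ 4 ≤ m n) (he : ∀ n, m (-n) = m n) (hΛ : 0 ≤ Λ)
    (hsmall : 4 * ρ * solBound c₀ * Λ ≤ 1) (h : IsShape m ν a χ) (ha : 0 ≤ a) (haρ : a ≤ ρ)
    (ξ : ℝ) : load ν a χ (-ξ) = -load ν a χ ξ := by
  have hev := even hν hc hm he hΛ hsmall h ha haρ
  have hd : deriv χ (-ξ) = -deriv χ ξ := by
    have h1 := deriv_comp_neg χ ξ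
    rw [funext hev] at h1
    linarith
  simp only [load, hev, hd, hν.odd]

/-- Since `χ'` gains a derivative through the integral equation, the load is `C¹`. -/
lemma contDiff_load (h : IsShape m ν a χ) (hν : IsDragLike ν ρ Λ) (hc : 0 < c₀)
    (hm : ∀ n : ℤ, 2 ≤ |n| → c₀ * (n : ℝ) ^ 4 ≤ m n) (ha : 0 ≤ a) (haρ : a ≤ ρ) :
    ContDiff ℝ 1 (load ν a χ) := by
  refine hν.contDiff a _ _ ha haρ h.bound h.contDiff ?_
  have hb := h.abs_load_le hν ha haρ
  rw [funext (h.deriv_eq hν hc hm ha haρ)]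
  have hs : ContDiff ℝ 1 (solOp m 1 (load ν a χ)) := by
    rw [contDiff_one_iff_deriv]
    have hd := hasDerivAt_solOp hc hm (j := 1) (by omega) hb
    refine ⟨fun ξ => (hd ξ).differentiableAt, ?_⟩
    rw [funext fun ξ => (hd ξ).deriv]
    exact continuous_solOp hc hm (by omega) hb
  exact (contDiff_const.mul contDiff_sin).sub (contDiff_const.mul hs)

/-- This summability is what the five-fold differentiation of the integral equation needs. -/
lemma summable_coeff_load (h : IsShape m ν a χ) (hν : IsDragLike ν ρ Λ) (hc : 0 < c₀)
    (hm : ∀ n : ℤ, 2 ≤ |n| → c₀ * (n : ℝ) ^ 4 ≤ m n) (ha : 0 ≤ a) (haρ : a ≤ ρ) :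
    Summable fun n => ‖coeff (load ν a χ) n‖ :=
  summable_coeff (h.contDiff_load hν hc hm ha haρ) h.periodic_load

end IsShape
end

/-! ### Sobolev estimates, regularity and closeness to the cosine -/

/-- A periodic function with a zero is bounded by the total variation over a period. -/
lemma abs_le_integral_abs_deriv {f : ℝ → ℝ} (hf : ContDiff ℝ 1 f)
    (hp : Function.Periodic f (2 * π)) {z : ℝ} (hz : f z = 0) (x : ℝ) :
    |f x| ≤ ∫ ξ in (0 : ℝ)..(2 * π), |deriv f ξ| := by
  have hc : Continuous (deriv f) := hf.continuous_deriv le_rfl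
  obtain ⟨y, hy, hxy⟩ := hp.exists_mem_Ico two_pi_pos x z
  have h1 : ∫ ξ in z..y, deriv f ξ = f y := by
    rw [intervalIntegral.integral_deriv_eq_sub (fun t _ => hf.differentiable one_ne_zero t)
      (hc.intervalIntegrable _ _), hz, sub_zero]
  have h2 : ∫ ξ in (0 : ℝ)..(2 * π), |deriv f ξ| = ∫ ξ in z..(z + 2 * π), |deriv f ξ| := by
    have h3 : Function.Periodic (fun ξ => |deriv f ξ|) (2 * π) := fun ξ => by
      simp only [periodic_deriv hp ξ]
    have := h3.intervalIntegral_add_eq 0 z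
    rwa [zero_add] at this
  rw [hxy, ← h1, h2]
  refine (intervalIntegral.abs_integral_le_integral_abs hy.1).trans ?_
  exact intervalIntegral.integral_mono_interval le_rfl hy.1 hy.2.le
    (Filter.Eventually.of_forall fun _ => abs_nonneg _) (hc.abs.intervalIntegrable _ _)

lemma integral_abs_le_of_integral_sq_le {g : ℝ → ℝ} (hg : Continuous g) {D : ℝ} (hD : 0 < D)
    (h : 1 / (2 * π) * ∫ ξ in (0 : ℝ)..(2 * π), (g ξ) ^ 2 ≤ D ^ 2) :
    ∫ ξ in (0 : ℝ)..(2 * π), |g ξ| ≤ 2 * π * D := by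
  -- `2 |g| ≤ g² / D + D`
  have h1 : ∫ ξ in (0 : ℝ)..(2 * π), |g ξ| ≤
      ∫ ξ in (0 : ℝ)..(2 * π), (1 / (2 * D) * (g ξ) ^ 2 + D / 2) := by
    apply intervalIntegral.integral_mono_on two_pi_pos.le (hg.abs.intervalIntegrable _ _)
      (Continuous.intervalIntegrable (by fun_prop) _ _)
    intro x _
    have : 0 ≤ (|g x| - D) ^ 2 / (2 * D) := by positivity
    have e : (|g x| - D) ^ 2 / (2 * D) = 1 / (2 * D) * (g x) ^ 2 + D / 2 - |g x| := by
      rw [sub_sq, sq_abs]; field_simp; ring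
    linarith
  rw [intervalIntegral.integral_add (Continuous.intervalIntegrable (by fun_prop) _ _)
    (Continuous.intervalIntegrable (by fun_prop) _ _), intervalIntegral.integral_const_mul,
    intervalIntegral.integral_const, smul_eq_mul, sub_zero] at h1
  have h2 : ∫ ξ in (0 : ℝ)..(2 * π), (g ξ) ^ 2 ≤ D ^ 2 * (2 * π) := by
    rw [one_div, inv_mul_le_iff₀ two_pi_pos] at h
    linarith
  have h3 : 1 / (2 * D) * ∫ ξ in (0 : ℝ)..(2 * π), (g ξ) ^ 2 ≤
      1 / (2 * D) * (D ^ 2 * (2 * π)) := by gcongr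
  have e : 1 / (2 * D) * (D ^ 2 * (2 * π)) = π * D := by field_simp
  linarith

lemma exists_zero_of_integral_eq_zero {f : ℝ → ℝ} (hf : Continuous f)
    (h0 : ∫ ξ in (0 : ℝ)..(2 * π), f ξ = 0) : ∃ z, f z = 0 := by
  have hd : ∀ x, HasDerivAt (fun y => ∫ ξ in (0 : ℝ)..y, f ξ) (f x) x := fun x =>
    (hf.integral_hasStrictDerivAt 0 x).hasDerivAt
  obtain ⟨c, _, hc⟩ := exists_hasDerivAt_eq_zero (f := fun y => ∫ ξ in (0 : ℝ)..y, f ξ) (f' := f)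
    two_pi_pos (fun x _ => (hd x).continuousAt.continuousWithinAt) (by simp [h0])
    (fun x _ => hd x)
  exact ⟨c, hc⟩

lemma exists_deriv_zero_of_periodic {f : ℝ → ℝ} (hf : Differentiable ℝ f)
    (hp : Function.Periodic f (2 * π)) : ∃ z, deriv f z = 0 := by
  obtain ⟨c, _, hc⟩ := exists_deriv_eq_zero two_pi_pos hf.continuous.continuousOn
    (by rw [← hp 0, zero_add])
  exact ⟨c, hc⟩

lemma mean_sq_le_of_normH5_lt {φ : ℝ → ℝ} {δ : ℝ} (hδ : normH5 φ < δ) {n : ℕ} (hn : n ≤ 5) :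
    1 / (2 * π) * ∫ ξ in (0 : ℝ)..(2 * π), (iteratedDeriv n φ ξ) ^ 2 ≤ δ ^ 2 := by
  have hnn : ∀ n, 0 ≤ 1 / (2 * π) * ∫ ξ in (0 : ℝ)..(2 * π), (iteratedDeriv n φ ξ) ^ 2 := fun n =>
    mul_nonneg (by positivity)
      (intervalIntegral.integral_nonneg two_pi_pos.le fun _ _ => sq_nonneg _)
  have h0 : 0 ≤ normH5 φ := Real.sqrt_nonneg _
  have h1 : normH5 φ ^ 2 = ∑ n ∈ Finset.range 6,
      1 / (2 * π) * ∫ ξ in (0 : ℝ)..(2 * π), (iteratedDeriv n φ ξ) ^ 2 :=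
    Real.sq_sqrt (Finset.sum_nonneg fun n _ => hnn n)
  calc _ ≤ normH5 φ ^ 2 := by
        rw [h1]
        exact Finset.single_le_sum (f := fun n => 1 / (2 * π) *
          ∫ ξ in (0 : ℝ)..(2 * π), (iteratedDeriv n φ ξ) ^ 2) (fun n _ => hnn n)
          (Finset.mem_range.mpr (by omega))
    _ ≤ δ ^ 2 := by gcongr

/-- The embedding of `H⁵`, restricted to periodic functions of mean zero, in `C¹`. -/
lemma abs_le_of_normH5_lt {φ : ℝ → ℝ} (hφ : ContDiff ℝ 5 φ) (hp : Function.Periodic φ (2 * π))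
    (h0 : ∫ ξ in (0 : ℝ)..(2 * π), φ ξ = 0) {δ : ℝ} (hδ : normH5 φ < δ) (ξ : ℝ) :
    |φ ξ| ≤ 2 * π * δ ∧ |deriv φ ξ| ≤ 2 * π * δ := by
  have hδ0 : 0 < δ := (Real.sqrt_nonneg _).trans_lt hδ
  have h1 : ContDiff ℝ 1 φ := hφ.of_le (by norm_num)
  have h2 : ContDiff ℝ 1 (deriv φ) := by
    have h3 : ContDiff ℝ (1 + 1) φ := hφ.of_le (by norm_num)
    exact (contDiff_succ_iff_deriv.mp h3).2.2
  obtain ⟨z, hz⟩ := exists_zero_of_integral_eq_zero hφ.continuous h0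
  obtain ⟨z', hz'⟩ := exists_deriv_zero_of_periodic (h1.differentiable one_ne_zero) hp
  have m1 := mean_sq_le_of_normH5_lt hδ (n := 1) (by omega)
  have m2 := mean_sq_le_of_normH5_lt hδ (n := 2) (by omega)
  rw [iteratedDeriv_one] at m1
  rw [iteratedDeriv_succ, iteratedDeriv_one] at m2
  exact ⟨(abs_le_integral_abs_deriv h1 hp hz ξ).trans
      (integral_abs_le_of_integral_sq_le (h1.continuous_deriv le_rfl) hδ0 m1),
    (abs_le_integral_abs_deriv h2 (periodic_deriv hp) hz' ξ).trans
      (integral_abs_le_of_integral_sq_le (h2.continuous_deriv le_rfl) hδ0 m2)⟩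

/-- The constant `3` bounds `√6`, for the six derivatives in the norm. -/
lemma normH5_le {φ : ℝ → ℝ} (hφ : ContDiff ℝ 5 φ) {D : ℝ}
    (h : ∀ n ≤ 5, ∀ ξ, |iteratedDeriv n φ ξ| ≤ D) : normH5 φ ≤ 3 * D := by
  have hD : 0 ≤ D := (abs_nonneg _).trans (h 0 (by omega) 0)
  unfold normH5
  refine Real.sqrt_le_iff.mpr ⟨by positivity, ?_⟩
  have h1 : ∀ n ∈ Finset.range 6, 1 / (2 * π) * ∫ ξ in (0 : ℝ)..(2 * π),
      (iteratedDeriv n φ ξ) ^ 2 ≤ D ^ 2 := by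
    intro n hn
    have hn5 : n ≤ 5 := by have := Finset.mem_range.mp hn; omega
    have hcont : Continuous (iteratedDeriv n φ) :=
      hφ.continuous_iteratedDeriv n (by exact_mod_cast hn5)
    have h2 : ∫ ξ in (0 : ℝ)..(2 * π), (iteratedDeriv n φ ξ) ^ 2 ≤
        ∫ ξ in (0 : ℝ)..(2 * π), D ^ 2 := by
      apply intervalIntegral.integral_mono_on two_pi_pos.le
        (Continuous.intervalIntegrable (by fun_prop) _ _)
        (Continuous.intervalIntegrable (by fun_prop) _ _)
      intro x _
      rw [← sq_abs]
      have := h n hn5 x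
      gcongr
    rw [intervalIntegral.integral_const, smul_eq_mul, sub_zero] at h2
    rw [one_div, inv_mul_le_iff₀ two_pi_pos]
    exact h2
  calc _ ≤ ∑ n ∈ Finset.range 6, D ^ 2 := Finset.sum_le_sum h1
    _ = 6 * D ^ 2 := by simp
    _ ≤ (3 * D) ^ 2 := by nlinarith [sq_nonneg D]

lemma abs_deriv_le_of_abs_deriv_deriv_le {f : ℝ → ℝ} (hf : ContDiff ℝ 2 f)
    (hp : Function.Periodic f (2 * π)) {D : ℝ} (hD : ∀ ξ, |deriv (deriv f) ξ| ≤ D) (ξ : ℝ) :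
    |deriv f ξ| ≤ 2 * π * D := by
  have h2 : ContDiff ℝ 1 (deriv f) := by
    have h3 : ContDiff ℝ (1 + 1) f := hf
    exact (contDiff_succ_iff_deriv.mp h3).2.2
  obtain ⟨z, hz⟩ := exists_deriv_zero_of_periodic (hf.differentiable two_ne_zero) hp
  refine (abs_le_integral_abs_deriv h2 (periodic_deriv hp) hz ξ).trans ?_
  have h3 : ∫ ξ in (0 : ℝ)..(2 * π), |deriv (deriv f) ξ| ≤ ∫ ξ in (0 : ℝ)..(2 * π), D :=
    intervalIntegral.integral_mono_on two_pi_pos.le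
      ((h2.continuous_deriv le_rfl).abs.intervalIntegrable _ _)
      (continuous_const.intervalIntegrable _ _) (fun x _ => hD x)
  rwa [intervalIntegral.integral_const, smul_eq_mul, sub_zero] at h3

lemma coeff_two_cos : coeff (fun ξ => 2 * cos ξ) 1 = 1 ∧ coeff (fun ξ => 2 * cos ξ) 0 = 0 := by
  have e : ∀ (n : ℤ) (ξ : ℝ), ((2 * cos ξ : ℝ) : ℂ) * Complex.exp (-(Complex.I * n * ξ)) =
      Complex.exp (Complex.I * (1 - n : ℤ) * ξ) + Complex.exp (Complex.I * (-1 - n : ℤ) * ξ) := by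
    intro n ξ
    push_cast
    rw [Complex.cos, mul_div_cancel₀ _ two_ne_zero, add_mul, ← Complex.exp_add, ← Complex.exp_add]
    ring_nf
  have hint : ∀ n : ℤ, IntervalIntegrable (fun ξ : ℝ => Complex.exp (Complex.I * n * ξ))
      MeasureTheory.volume 0 (2 * π) := fun n => Continuous.intervalIntegrable (by fun_prop) _ _
  have hpi : (π : ℂ) ≠ 0 := by exact_mod_cast pi_ne_zero
  unfold coeff
  simp_rw [e]
  constructor
  · rw [intervalIntegral.integral_add (hint _) (hint _),
      integral_exp_mode (by omega : (-1 - 1 : ℤ) ≠ 0)]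
    simp
    field_simp
  · rw [intervalIntegral.integral_add (hint _) (hint _),
      integral_exp_mode (by omega : (-1 - 0 : ℤ) ≠ 0),
      integral_exp_mode (by omega : (1 - 0 : ℤ) ≠ 0)]
    simp

lemma iteratedDeriv_two_cos (n : ℕ) :
    iteratedDeriv n (fun ξ => 2 * cos ξ) = fun ξ => 2 * iteratedDeriv n cos ξ :=
  funext fun ξ => by simp

lemma contDiff_two_cos : ContDiff ℝ 5 fun ξ => 2 * cos ξ := contDiff_const.mul contDiff_cos

namespace IsShape
variable {p₄ p₂ p₀ : ℝ} {ν : ℝ → ℝ → ℝ → ℝ} {ρ Λ c₀ a : ℝ} {χ : ℝ → ℝ}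

/-- Shapes are `C⁵`: their load has summable Fourier coefficients, and the inverse operator gains
five derivatives. -/
lemma smooth {m : ℤ → ℝ} (h : IsShape m ν a χ) (hν : IsDragLike ν ρ Λ) (hc : 0 < c₀)
    (hm : ∀ n : ℤ, 2 ≤ |n| → c₀ * (n : ℝ) ^ 4 ≤ m n) (ha : 0 ≤ a) (haρ : a ≤ ρ) :
    ContDiff ℝ 5 χ := by
  rw [funext h.eq]
  exact contDiff_two_cos.sub (contDiff_const.mul
    (contDiff_solOp hc hm (h.summable_coeff_load hν hc hm ha haρ)))

lemma iteratedDeriv_eq {m : ℤ → ℝ} (h : IsShape m ν a χ) (hν : IsDragLike ν ρ Λ) (hc : 0 < c₀)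
    (hm : ∀ n : ℤ, 2 ≤ |n| → c₀ * (n : ℝ) ^ 4 ≤ m n) (ha : 0 ≤ a) (haρ : a ≤ ρ)
    {j : ℕ} (hj : j ≤ 5) (ξ : ℝ) :
    iteratedDeriv j χ ξ = 2 * iteratedDeriv j cos ξ - a * solOp m j (load ν a χ) ξ := by
  have hs := h.summable_coeff_load hν hc hm ha haρ
  have hcd := contDiff_solOp hc hm hs
  have hj' : (j : WithTop ℕ∞) ≤ 5 := by exact_mod_cast hj
  have e : χ = (fun ξ => 2 * cos ξ) - fun ξ => a * solOp m 0 (load ν a χ) ξ := funext h.eq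
  conv_lhs => rw [e]
  rw [iteratedDeriv_sub (contDiff_two_cos.of_le hj').contDiffAt
    ((contDiff_const.mul hcd).of_le hj').contDiffAt, iteratedDeriv_two_cos,
    iteratedDeriv_const_mul_field, iteratedDeriv_solOp hc hm hs hj]

lemma coeff_eq {m : ℤ → ℝ} (h : IsShape m ν a χ) (hν : IsDragLike ν ρ Λ) (hc : 0 < c₀)
    (hm : ∀ n : ℤ, 2 ≤ |n| → c₀ * (n : ℝ) ^ 4 ≤ m n) (ha : 0 ≤ a) (haρ : a ≤ ρ) :
    coeff χ 1 = 1 ∧ coeff χ 0 = 0 := by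
  have hb := h.abs_load_le hν ha haρ
  have e : χ = fun ξ => 2 * cos ξ - a * solOp m 0 (load ν a χ) ξ := funext h.eq
  have k1 : Continuous fun ξ => 2 * cos ξ := by fun_prop
  have k2 : Continuous fun ξ => a * solOp m 0 (load ν a χ) ξ :=
    (continuous_solOp hc hm (by omega) hb).const_mul a
  constructor
  · rw [e, coeff_sub k1 k2, coeff_const_mul a, coeff_solOp_eq_zero hc hm hb (by norm_num),
      coeff_two_cos.1]
    simp
  · rw [e, coeff_sub k1 k2, coeff_const_mul a, coeff_solOp_eq_zero hc hm hb (by norm_num),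
      coeff_two_cos.2]
    simp

/-- The projection of the load on the critical mode. -/
def response (ν : ℝ → ℝ → ℝ → ℝ) (a : ℝ) (χ : ℝ → ℝ) : ℝ := -(coeff (load ν a χ) 1).im

lemma abs_response_le {m : ℤ → ℝ} (h : IsShape m ν a χ) (hν : IsDragLike ν ρ Λ) (ha : 0 ≤ a)
    (haρ : a ≤ ρ) : |response ν a χ| ≤ Λ := by
  rw [response, abs_neg]
  exact (Complex.abs_im_le_norm _).trans (norm_coeff_le (h.abs_load_le hν ha haρ) 1)

/-- A shape solves the wave equation up to a multiple of `sin`; its factor is the bifurcation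
equation. -/
lemma equation (hν : IsDragLike ν ρ Λ) (hc : 0 < c₀)
    (hm : ∀ n : ℤ, 2 ≤ |n| → c₀ * (n : ℝ) ^ 4 ≤ waveSymbol p₄ p₂ p₀ n) (hΛ : 0 ≤ Λ)
    (hsmall : 4 * ρ * solBound c₀ * Λ ≤ 1) (h : IsShape (waveSymbol p₄ p₂ p₀) ν a χ)
    (ha : 0 ≤ a) (haρ : a ≤ ρ) (ξ : ℝ) :
    p₄ * iteratedDeriv 5 χ ξ + p₂ * iteratedDeriv 3 χ ξ + p₀ * iteratedDeriv 1 χ ξ +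
      a * load ν a χ ξ = 2 * (a * response ν a χ - (p₄ - p₂ + p₀)) * sin ξ := by
  have hs := h.summable_coeff_load hν hc hm ha haρ
  have key := solOp_equation hc hm (h.continuous_load hν ha haρ) h.periodic_load hs
    (load_odd hν hc hm (waveSymbol_neg p₄ p₂ p₀) hΛ hsmall h ha haρ) ξ
  rw [h.iteratedDeriv_eq hν hc hm ha haρ (by omega), h.iteratedDeriv_eq hν hc hm ha haρ (by omega),
    h.iteratedDeriv_eq hν hc hm ha haρ (by omega)]
  have c5 : iteratedDeriv 5 cos ξ = -sin ξ := by simp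
  have c3 : iteratedDeriv 3 cos ξ = sin ξ := by simp
  have c1 : iteratedDeriv 1 cos ξ = -sin ξ := by simp
  rw [c5, c3, c1, response]
  linear_combination (-a) * key

/-- Closeness of a shape to `2 cos`, in `C⁵`. -/
lemma abs_iteratedDeriv_sub_le (hν : IsDragLike ν ρ Λ) (hc : 0 < c₀)
    (hm : ∀ n : ℤ, 2 ≤ |n| → c₀ * (n : ℝ) ^ 4 ≤ waveSymbol p₄ p₂ p₀ n) (hΛ : 0 ≤ Λ)
    (hsmall : 4 * ρ * solBound c₀ * Λ ≤ 1) (h : IsShape (waveSymbol p₄ p₂ p₀) ν a χ)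
    (ha : 0 ≤ a) (haρ : a ≤ ρ) {P e₀ : ℝ} (he₀ : 0 < e₀) (h4 : e₀ ≤ p₄) (h2P : |p₂| ≤ P)
    (h0P : |p₀| ≤ P) {j : ℕ} (hj : j ≤ 5) (ξ : ℝ) :
    |iteratedDeriv j (fun ξ => χ ξ - 2 * cos ξ) ξ| ≤
      (solBound c₀ * Λ + 7 * ((3 * Λ + 2 * P * (solBound c₀ * Λ)) / e₀)) * a := by
  have hS := solBound_nonneg hc
  have hP : 0 ≤ P := (abs_nonneg _).trans h2P
  have hs := h.summable_coeff_load hν hc hm ha haρ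
  have hb := h.abs_load_le hν ha haρ
  set m := waveSymbol p₄ p₂ p₀
  set W : ℝ := (3 * Λ + 2 * P * (solBound c₀ * Λ)) / e₀ with hW
  have hW0 : 0 ≤ W := by positivity
  have hSL : 0 ≤ solBound c₀ * Λ := by positivity
  have e : (fun ξ => χ ξ - 2 * cos ξ) = fun ξ => (-a) * solOp m 0 (load ν a χ) ξ := by
    ext ξ
    have h1 : χ ξ = 2 * cos ξ - a * solOp m 0 (load ν a χ) ξ := h.eq ξ
    linarith
  rw [e, iteratedDeriv_const_mul_field, iteratedDeriv_solOp hc hm hs hj, abs_mul, abs_neg,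
    abs_of_nonneg ha, mul_comm]
  refine mul_le_mul_of_nonneg_right ?_ ha
  have low : ∀ j ≤ 3, ∀ ξ, |solOp m j (load ν a χ) ξ| ≤ solBound c₀ * Λ := fun j hj ξ =>
    abs_solOp_le hc hm hj hb ξ
  -- the fifth derivative is controlled by the equation
  have five : ∀ ξ, |solOp m 5 (load ν a χ) ξ| ≤ W := by
    intro ξ
    have key := solOp_equation hc hm (h.continuous_load hν ha haρ) h.periodic_load hs
      (load_odd hν hc hm (waveSymbol_neg p₄ p₂ p₀) hΛ hsmall h ha haρ) ξ
    have hr := h.abs_response_le hν ha haρ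
    rw [hW, le_div_iff₀ he₀]
    have e5 : p₄ * solOp m 5 (load ν a χ) ξ = load ν a χ ξ - 2 * response ν a χ * sin ξ -
        p₂ * solOp m 3 (load ν a χ) ξ - p₀ * solOp m 1 (load ν a χ) ξ := by
      rw [response]; linear_combination key
    have b1 : |2 * response ν a χ * sin ξ| ≤ 2 * Λ := by
      rw [abs_mul, abs_mul, abs_two]
      calc 2 * |response ν a χ| * |sin ξ| ≤ 2 * Λ * 1 := by
            gcongr; exact abs_sin_le_one ξ
        _ = 2 * Λ := mul_one _
    have b2 : |p₂ * solOp m 3 (load ν a χ) ξ| ≤ P * (solBound c₀ * Λ) := by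
      rw [abs_mul]; gcongr; exact low 3 (by omega) ξ
    have b3 : |p₀ * solOp m 1 (load ν a χ) ξ| ≤ P * (solBound c₀ * Λ) := by
      rw [abs_mul]; gcongr; exact low 1 (by omega) ξ
    calc |solOp m 5 (load ν a χ) ξ| * e₀ ≤ |solOp m 5 (load ν a χ) ξ| * p₄ := by gcongr
      _ = |p₄ * solOp m 5 (load ν a χ) ξ| := by
          rw [abs_mul, abs_of_pos (he₀.trans_le h4), mul_comm]
      _ ≤ |load ν a χ ξ| + |2 * response ν a χ * sin ξ| + |p₂ * solOp m 3 (load ν a χ) ξ| +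
          |p₀ * solOp m 1 (load ν a χ) ξ| := by
          rw [e5]
          exact (abs_sub _ _).trans (add_le_add_left ((abs_sub _ _).trans
            (add_le_add_left (abs_sub _ _) _)) _)
      _ ≤ Λ + 2 * Λ + P * (solBound c₀ * Λ) + P * (solBound c₀ * Λ) := by
          gcongr; exact hb ξ
      _ = _ := by ring
  have four : ∀ ξ, |solOp m 4 (load ν a χ) ξ| ≤ 7 * W := by
    intro ξ
    have d3 : deriv (solOp m 3 (load ν a χ)) = solOp m 4 (load ν a χ) := by
      rw [← iteratedDeriv_solOp hc hm hs (j := 3) (by omega), ← iteratedDeriv_succ,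
        iteratedDeriv_solOp hc hm hs (j := 4) (by omega)]
    have d4 : deriv (solOp m 4 (load ν a χ)) = solOp m 5 (load ν a χ) := by
      rw [← iteratedDeriv_solOp hc hm hs (j := 4) (by omega), ← iteratedDeriv_succ,
        iteratedDeriv_solOp hc hm hs (j := 5) (by omega)]
    have cd : ContDiff ℝ 2 (solOp m 3 (load ν a χ)) := by
      rw [← iteratedDeriv_solOp hc hm hs (j := 3) (by omega), iteratedDeriv_eq_iterate]
      exact ContDiff.iterate_deriv' 2 3 ((contDiff_solOp hc hm hs).of_le (by norm_num))
    have := abs_deriv_le_of_abs_deriv_deriv_le cd (periodic_solOp 3 _) (D := W)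
      (fun ξ => by rw [d3, d4]; exact five ξ) ξ
    rw [d3] at this
    refine this.trans ?_
    have : 2 * π ≤ 7 := by linarith [pi_lt_d2]
    gcongr
  rcases (by omega : j ≤ 3 ∨ j = 4 ∨ j = 5) with hj3 | rfl | rfl
  · exact (low j hj3 ξ).trans (by linarith)
  · exact (four ξ).trans (by linarith)
  · exact (five ξ).trans (by linarith)

end IsShape

/-! ### Reduction of plane waves to an ordinary differential equation -/

lemma inner_perp_self (k : Plane) : inner ℝ k (perp k) = 0 := by
  simp [perp, PiLp.inner_apply, Fin.sum_univ_two]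
  ring

lemma perp_smul_perp (c : ℝ) (k : Plane) : perp (c • perp k) = -(c • k) := by
  ext i
  fin_cases i <;> simp [perp]

lemma norm_perp (k : Plane) : ‖perp k‖ = ‖k‖ := by
  rw [EuclideanSpace.norm_eq, EuclideanSpace.norm_eq]
  simp [perp, Fin.sum_univ_two, add_comm]

section
variable {ψ : ℝ → ℝ} {k w : Plane}

lemma hasFDerivAt_inner (k x : Plane) :
    HasFDerivAt (fun x : Plane => inner ℝ k x) (innerSL ℝ k) x :=
  (innerSL ℝ k).hasFDerivAt

lemma hasFDerivAt_planeWave (hψ : Differentiable ℝ ψ) (k w x : Plane) :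
    HasFDerivAt (fun x : Plane => ψ (inner ℝ k x) • w)
      (deriv ψ (inner ℝ k x) • (innerSL ℝ k).smulRight w) x := by
  have h1 := (hψ (inner ℝ k x)).hasDerivAt.comp_hasFDerivAt x (hasFDerivAt_inner k x)
  have h2 := h1.smul_const w
  refine h2.congr_fderiv ?_
  ext1 y
  simp [mul_smul]

lemma laplacian_planeWave (hψ : ContDiff ℝ 2 ψ) (k w : Plane) :
    Laplacian.laplacian (fun x : Plane => ψ (inner ℝ k x) • w) =
      fun x : Plane => (‖k‖ ^ 2 * deriv (deriv ψ) (inner ℝ k x)) • w := by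
  have hd : Differentiable ℝ ψ := hψ.differentiable two_ne_zero
  have hψ1 : ContDiff ℝ (1 + 1) ψ := hψ
  have hd2 : Differentiable ℝ (deriv ψ) :=
    (contDiff_succ_iff_deriv.mp hψ1).2.2.differentiable one_ne_zero
  rw [InnerProductSpace.laplacian_eq_iteratedFDeriv_orthonormalBasis _
    (EuclideanSpace.basisFun (Fin 2) ℝ)]
  ext1 x
  have h1 : fderiv ℝ (fun x : Plane => ψ (inner ℝ k x) • w) =
      fun x => deriv ψ (inner ℝ k x) • (innerSL ℝ k).smulRight w :=
    funext fun x => (hasFDerivAt_planeWave hd k w x).fderiv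
  have h2 : ∀ v : Plane, fderiv ℝ (fderiv ℝ (fun x : Plane => ψ (inner ℝ k x) • w)) x v v =
      (inner ℝ k v ^ 2 * deriv (deriv ψ) (inner ℝ k x)) • w := by
    intro v
    have h3 := (hd2 (inner ℝ k x)).hasDerivAt.comp_hasFDerivAt x (hasFDerivAt_inner k x)
    have h4 := h3.smul_const ((innerSL ℝ k).smulRight w)
    rw [h1]
    have h5 := h4.fderiv
    simp only [Function.comp_def] at h5
    rw [h5]
    simp only [ContinuousLinearMap.smulRight_apply, smul_apply,
      innerSL_apply_apply, smul_smul, smul_eq_mul]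
    congr 1; ring
  simp_rw [iteratedFDeriv_two_apply]
  simp only [Matrix.cons_val_zero, Matrix.cons_val_one]
  simp_rw [h2]
  rw [← Finset.sum_smul, ← Finset.sum_mul]
  congr 2
  rw [EuclideanSpace.norm_sq_eq]
  simp [PiLp.inner_apply, Fin.sum_univ_two]

lemma gradient_planeWave (hψ : Differentiable ℝ ψ) (c : ℝ) (k x : Plane) :
    gradient (fun x : Plane => c * ψ (inner ℝ k x)) x = (c * deriv ψ (inner ℝ k x)) • k := by
  apply HasGradientAt.gradient
  rw [hasGradientAt_iff_hasFDerivAt]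
  have h1 := ((hψ (inner ℝ k x)).hasDerivAt.comp_hasFDerivAt x (hasFDerivAt_inner k x)).const_mul c
  refine h1.congr_fderiv ?_
  ext1 y
  simp [mul_assoc]

lemma divergence_planeWave (hψ : Differentiable ℝ ψ) (k w x : Plane) :
    divergence (fun x : Plane => ψ (inner ℝ k x) • w) x = deriv ψ (inner ℝ k x) * inner ℝ k w := by
  unfold divergence
  rw [(hasFDerivAt_planeWave hψ k w x).fderiv]
  simp [PiLp.inner_apply, Fin.sum_univ_two]
  ring

end

/-- A plane wave solves the shallow water equations if and only if the depth is positive and its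
shape solves an ordinary differential equation: transport and divergence vanish because `v ⟂ k`,
and the Coriolis force balances the pressure gradient. -/
lemma isSteadyPlaneWave_iff {p : Params} (hg : p.g ≠ 0) {k : Plane} (hk : k ≠ 0) {φ : ℝ → ℝ} :
    IsSteadyPlaneWave p k φ ↔ ContDiff ℝ 5 φ ∧ Function.Periodic φ (2 * π) ∧
      (∫ ξ in (0 : ℝ)..(2 * π), φ ξ = 0) ∧ (∀ ξ, 0 < p.H₀ + p.f / p.g * φ ξ) ∧
      ∀ ξ, p.d * ‖k‖ ^ 4 * iteratedDeriv 5 φ ξ + p.b * ‖k‖ ^ 2 * iteratedDeriv 3 φ ξ +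
        (p.C + p.Q * (‖k‖ * |deriv φ ξ|)) / (p.H₀ + p.f / p.g * φ ξ) * deriv φ ξ = 0 := by
  have hperp : perp k ≠ 0 := by rw [← norm_ne_zero_iff, norm_perp, norm_ne_zero_iff]; exact hk
  have hsurj : ∀ ξ : ℝ, ∃ x : Plane, inner ℝ k x = ξ := by
    intro ξ
    refine ⟨(ξ / ‖k‖ ^ 2) • k, ?_⟩
    have : ‖k‖ ≠ 0 := norm_ne_zero_iff.mpr hk
    rw [inner_smul_right, real_inner_self_eq_norm_sq]
    field_simp
  -- the residual of the momentum equation is the residual of the shape equation times `perp k`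
  have key : ContDiff ℝ 5 φ → ∀ x : Plane,
      -(p.f • perp (deriv φ (inner ℝ k x) • perp k)) -
        p.g • gradient (fun x : Plane => p.f / p.g * φ (inner ℝ k x)) x -
        backscatter p (fun x : Plane => deriv φ (inner ℝ k x) • perp k) x -
        bottomDrag p (deriv φ (inner ℝ k x) • perp k) (p.f / p.g * φ (inner ℝ k x)) =
      -(p.d * ‖k‖ ^ 4 * iteratedDeriv 5 φ (inner ℝ k x) +
        p.b * ‖k‖ ^ 2 * iteratedDeriv 3 φ (inner ℝ k x) +
        (p.C + p.Q * (‖k‖ * |deriv φ (inner ℝ k x)|)) / (p.H₀ + p.f / p.g * φ (inner ℝ k x)) *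
          deriv φ (inner ℝ k x)) • perp k := by
    intro hφ x
    have c2 : ContDiff ℝ 2 (deriv φ) := by
      have := ContDiff.iterate_deriv' 2 1 (hφ.of_le (by norm_num))
      simpa using this
    have c4 : ContDiff ℝ 2 (fun ξ => ‖k‖ ^ 2 * deriv (deriv (deriv φ)) ξ) := by
      have := ContDiff.iterate_deriv' 2 3 hφ
      exact contDiff_const.mul (by simpa using this)
    have e3 : iteratedDeriv 3 φ = deriv (deriv (deriv φ)) := by
      simp [iteratedDeriv_succ]
    have e5 : ∀ ξ, deriv (deriv fun ξ => ‖k‖ ^ 2 * deriv (deriv (deriv φ)) ξ) ξ =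
        ‖k‖ ^ 2 * iteratedDeriv 5 φ ξ := by
      intro ξ
      have h1 : (deriv fun ξ => ‖k‖ ^ 2 * deriv (deriv (deriv φ)) ξ) =
          fun ξ => ‖k‖ ^ 2 * deriv (deriv (deriv (deriv φ))) ξ := funext fun ξ => by
        rw [deriv_const_mul_field]
      rw [h1, deriv_const_mul_field]
      simp [iteratedDeriv_succ]
    rw [perp_smul_perp, gradient_planeWave (hφ.differentiable (by norm_num)), backscatter,
      laplacian_planeWave c2, laplacian_planeWave c4, bottomDrag, norm_smul, norm_perp, e3,
      Real.norm_eq_abs]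
    simp only [e5]
    have h2 : p.g • (p.f / p.g * deriv φ (inner ℝ k x)) • k = p.f • deriv φ (inner ℝ k x) • k := by
      rw [smul_smul, smul_smul]
      congr 1; field_simp
    rw [h2]
    module
  constructor
  · rintro ⟨h5, hp, h0, hs⟩
    refine ⟨h5, hp, h0, fun ξ => ?_, fun ξ => ?_⟩
    · obtain ⟨x, rfl⟩ := hsurj ξ
      exact hs.depth_pos 1 x one_pos
    · obtain ⟨x, rfl⟩ := hsurj ξ
      have c1 : Differentiable ℝ (deriv φ) := by
        have := ContDiff.iterate_deriv' 4 1 h5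
        exact ContDiff.differentiable (by simpa using this) (n := 4) (by norm_num)
      have hm := hs.momentum 1 x one_pos
      rw [key h5 x, (hasFDerivAt_planeWave c1 k (perp k) x).fderiv] at hm
      simp only [deriv_const, zero_add, smul_apply,
        ContinuousLinearMap.smulRight_apply, innerSL_apply_apply, inner_smul_right,
        inner_perp_self, mul_zero, zero_smul, smul_zero] at hm
      have := (smul_eq_zero.mp hm.symm).resolve_right hperp
      linarith
  · rintro ⟨h5, hp, h0, hpos, heq⟩
    have hφ4 : ContDiff ℝ 4 (deriv φ) := by
      have := ContDiff.iterate_deriv' 4 1 h5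
      simpa using this
    have hin : ContDiff ℝ 5 fun x : Plane => (inner ℝ k x : ℝ) := (innerSL ℝ k).contDiff
    refine ⟨h5, hp, h0, ?_, ?_, ?_, ?_, ?_, ?_, ?_⟩
    · intro t _
      exact (hφ4.comp (hin.of_le (by norm_num))).smul contDiff_const
    · intro t _
      exact contDiff_const.mul ((h5.comp hin).of_le (by norm_num))
    · intro t x _
      exact differentiableAt_const _
    · intro t x _
      exact differentiableAt_const _
    · intro t x _
      exact hpos _
    · intro t x _
      rw [key h5 x, heq, (hasFDerivAt_planeWave (hφ4.differentiable (by norm_num))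
        k (perp k) x).fderiv]
      simp [inner_perp_self]
    · intro t x _
      rw [divergence_planeWave (hφ4.differentiable (by norm_num))]
      have h1 := (((h5.differentiable (by norm_num)) (inner ℝ k x)).hasDerivAt.comp_hasFDerivAt x
        (hasFDerivAt_inner k x)).const_mul (p.f / p.g)
      have h2 : fderiv ℝ (fun x : Plane => p.f / p.g * φ (inner ℝ k x)) x = _ := h1.fderiv
      rw [h2]
      simp [inner_perp_self]

/-! ### Linear instability of the trivial flow -/

/-- The characteristic equation of the linearization, a cubic in which `k` enters through `|k|`
only. -/
lemma mem_spectrum_linearSymbol (p : Params) (k : Plane) (z : ℂ) :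
    z ∈ spectrum ℂ (linearSymbol p k) ↔
      z * (z + ((p.d * ‖k‖ ^ 4 - p.b * ‖k‖ ^ 2 + p.C / p.H₀ : ℝ) : ℂ)) ^ 2 +
        ((p.g * p.H₀ * ‖k‖ ^ 2 : ℝ) : ℂ) *
          (z + ((p.d * ‖k‖ ^ 4 - p.b * ‖k‖ ^ 2 + p.C / p.H₀ : ℝ) : ℂ)) +
        ((p.f ^ 2 : ℝ) : ℂ) * z = 0 := by
  have hk : ‖k‖ ^ 2 = k 0 ^ 2 + k 1 ^ 2 := by
    rw [EuclideanSpace.norm_sq_eq]; simp [Fin.sum_univ_two]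
  rw [spectrum.mem_iff, Matrix.isUnit_iff_isUnit_det, isUnit_iff_ne_zero, not_not,
    Matrix.det_fin_three, linearSymbol]
  simp only [Matrix.sub_apply, Matrix.algebraMap_matrix_apply]
  set F : ℝ := p.d * ‖k‖ ^ 4 - p.b * ‖k‖ ^ 2 + p.C / p.H₀
  rw [hk]
  simp
  constructor
  · intro h
    linear_combination h + (p.g * p.H₀ * (k 0 ^ 2 + k 1 ^ 2) * (z + F)) * Complex.I_sq
  · intro h
    linear_combination h - (p.g * p.H₀ * (k 0 ^ 2 + k 1 ^ 2) * (z + F)) * Complex.I_sq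

/-- The trivial flow is unstable exactly when the symbol of drag and backscatter is negative. For
a root `z` of the characteristic polynomial,
`(z + F) + g H₀ |k|² / z + f² / (z + F) = 0`, and if `F ≥ 0` and `Re z > 0`, then the summands have
nonnegative real part and the first one has positive real part. -/
lemma trivialFlowUnstable_iff {p : Params} {k : Plane} (hg : 0 < p.g) (hH : 0 < p.H₀)
    (hk : k ≠ 0) : TrivialFlowUnstable p k ↔
      p.d * ‖k‖ ^ 4 - p.b * ‖k‖ ^ 2 + p.C / p.H₀ < 0 := by
  unfold TrivialFlowUnstable
  simp_rw [mem_spectrum_linearSymbol]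
  set F : ℝ := p.d * ‖k‖ ^ 4 - p.b * ‖k‖ ^ 2 + p.C / p.H₀
  have hk0 : 0 < ‖k‖ := norm_pos_iff.mpr hk
  have hG : 0 < p.g * p.H₀ * ‖k‖ ^ 2 := by positivity
  set G : ℝ := p.g * p.H₀ * ‖k‖ ^ 2
  constructor
  · rintro ⟨z, hz, hre⟩
    by_contra! hF
    have hw : 0 < (z + F).re := by simp; linarith
    have hz0 : z ≠ 0 := by rintro rfl; simp at hre
    have hw0 : z + F ≠ 0 := by intro h; rw [h] at hw; simp at hw
    have e : (z + F) + (G : ℂ) * z⁻¹ + ((p.f ^ 2 : ℝ) : ℂ) * (z + F)⁻¹ = 0 := by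
      field_simp
      linear_combination hz
    have e' := congrArg Complex.re e
    rw [Complex.add_re, Complex.add_re, Complex.re_ofReal_mul, Complex.re_ofReal_mul,
      Complex.inv_re, Complex.inv_re, Complex.zero_re] at e'
    have h1 : 0 < Complex.normSq z := Complex.normSq_pos.mpr hz0
    have h2 : 0 < Complex.normSq (z + F) := Complex.normSq_pos.mpr hw0
    have h3 : 0 < G * (z.re / Complex.normSq z) := by positivity
    have h4 : 0 ≤ p.f ^ 2 * ((z + F).re / Complex.normSq (z + F)) := by positivity
    linarith
  · intro hF
    have hcont : ContinuousOn (fun x : ℝ => x * (x + F) ^ 2 + G * (x + F) + p.f ^ 2 * x)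
        (Icc 0 (-F)) := by fun_prop
    -- the characteristic polynomial is negative at `0` and nonnegative at `-F`
    obtain ⟨x, hx, hx0⟩ := intermediate_value_Icc (by linarith : (0 : ℝ) ≤ -F) hcont
      (show (0 : ℝ) ∈ Icc _ _ by
        constructor
        · simp only [zero_add, zero_mul, mul_zero, add_zero]
          nlinarith
        · simp only [neg_add_cancel]
          nlinarith [sq_nonneg p.f])
    simp only at hx0
    refine ⟨x, by exact_mod_cast hx0, ?_⟩
    rw [Complex.ofReal_re]
    rcases hx.1.lt_or_eq with h | h
    · exact h
    · rw [← h] at hx0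
      nlinarith

/-! ### The response of the critical mode, and uniqueness of small waves -/

namespace IsShape
variable {m : ℤ → ℝ} {ν : ℝ → ℝ → ℝ → ℝ} {ρ Λ c₀ a : ℝ} {χ : ℝ → ℝ}

lemma two_cos (m : ℤ → ℝ) (ν : ℝ → ℝ → ℝ → ℝ) : IsShape m ν 0 fun ξ => 2 * cos ξ := by
  have hd : ∀ ξ, deriv (fun ξ => 2 * cos ξ) ξ = 2 * -sin ξ := fun ξ => by simp
  refine ⟨contDiff_two_cos.of_le (by norm_num), fun ξ => ?_, fun ξ => ?_, fun ξ => by simp⟩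
  · rw [abs_mul, abs_two]; linarith [abs_cos_le_one ξ]
  · rw [hd, abs_mul, abs_two, abs_neg]; linarith [abs_sin_le_one ξ]

/-- The response is Lipschitz in the amplitude. The constant `Λ'`, which may be smaller than `Λ`,
keeps track of the size of the nonlinearity. -/
lemma abs_response_sub_le (hν : IsDragLike ν ρ Λ) (hc : 0 < c₀)
    (hm : ∀ n : ℤ, 2 ≤ |n| → c₀ * (n : ℝ) ^ 4 ≤ m n) (hΛ : 0 ≤ Λ)
    (hsmall : 4 * ρ * solBound c₀ * Λ ≤ 1) {Λ' : ℝ} (hν' : IsDragLike ν ρ Λ') (hΛ' : 0 ≤ Λ')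
    {a' : ℝ} {χ' : ℝ → ℝ} (h : IsShape m ν a χ) (h' : IsShape m ν a' χ')
    (ha : 0 ≤ a) (haρ : a ≤ ρ) (ha' : 0 ≤ a') (haρ' : a' ≤ ρ) :
    |response ν a χ - response ν a' χ'| ≤ Λ' * (4 * solBound c₀ * Λ + 3) * |a - a'| := by
  have hb : ∀ ξ, |load ν a χ ξ - load ν a' χ' ξ| ≤
      Λ' * (4 * solBound c₀ * Λ + 3) * |a - a'| := by
    intro ξ
    have h1 := stability hν hc hm hΛ hsmall h h' ha haρ ha' haρ' ξ
    refine (hν'.lipschitz a _ _ a' _ _ ha haρ (h.bound ξ) (h.bound_deriv ξ) ha' haρ' (h'.bound ξ)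
      (h'.bound_deriv ξ)).trans ?_
    rw [mul_assoc]
    gcongr
    linarith [h1.1, h1.2]
  have e : response ν a χ - response ν a' χ' =
      -(coeff (fun ξ => load ν a χ ξ - load ν a' χ' ξ) 1).im := by
    rw [coeff_sub (h.continuous_load hν ha haρ) (h'.continuous_load hν ha' haρ'), response,
      response, Complex.sub_im]
    ring
  rw [e, abs_neg]
  exact (Complex.abs_im_le_norm _).trans (norm_coeff_le hb 1)

end IsShape

lemma coeff_one_im {h : ℝ → ℝ} (hh : Continuous h) :
    (coeff h 1).im = -(1 / (2 * π) * ∫ ξ in (0 : ℝ)..(2 * π), h ξ * sin ξ) := by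
  have e : ∀ ξ : ℝ, (h ξ : ℂ) * Complex.exp (-(Complex.I * ((1 : ℤ) : ℂ) * ξ)) =
      ((h ξ * cos ξ : ℝ) : ℂ) + (-Complex.I) * ((h ξ * sin ξ : ℝ) : ℂ) := by
    intro ξ
    have h1 : -(Complex.I * ((1 : ℤ) : ℂ) * ξ) = ((-ξ : ℝ) : ℂ) * Complex.I := by
      push_cast; ring
    rw [h1, Complex.exp_mul_I, ← Complex.ofReal_cos, ← Complex.ofReal_sin, Real.cos_neg,
      Real.sin_neg]
    push_cast; ring
  unfold coeff
  simp_rw [e]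
  rw [intervalIntegral.integral_add (Continuous.intervalIntegrable (by fun_prop) _ _)
    (Continuous.intervalIntegrable (by fun_prop) _ _), intervalIntegral.integral_const_mul,
    intervalIntegral.integral_ofReal, intervalIntegral.integral_ofReal]
  have h2 : (1 / (2 * (π : ℂ))) = ((1 / (2 * π) : ℝ) : ℂ) := by push_cast; ring
  rw [h2, Complex.im_ofReal_mul]
  simp

lemma integral_abs_sin_mul_sin_sq :
    ∫ ξ in (0 : ℝ)..(2 * π), |sin ξ| * sin ξ * sin ξ = 8 / 3 := by
  have hc : Continuous fun ξ : ℝ => |sin ξ| * sin ξ * sin ξ := by fun_prop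
  have hp : ∫ ξ in (0 : ℝ)..π, |sin ξ| * sin ξ * sin ξ = 4 / 3 := by
    have e : ∫ ξ in (0 : ℝ)..π, |sin ξ| * sin ξ * sin ξ = ∫ ξ in (0 : ℝ)..π, sin ξ ^ 3 := by
      apply intervalIntegral.integral_congr
      intro ξ hξ
      rw [uIcc_of_le pi_pos.le] at hξ
      simp only [abs_of_nonneg (sin_nonneg_of_mem_Icc hξ)]
      ring
    rw [e]
    have h3 := integral_sin_pow (a := 0) (b := π) 1
    rw [h3]
    norm_num
  have hq : ∫ ξ in π..(2 * π), |sin ξ| * sin ξ * sin ξ = 4 / 3 := by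
    have h1 := intervalIntegral.integral_comp_add_right (a := 0) (b := π)
      (fun ξ : ℝ => |sin ξ| * sin ξ * sin ξ) π
    rw [zero_add, ← two_mul] at h1
    rw [← h1, ← hp]
    congr 1
    ext ξ
    rw [sin_add_pi, abs_neg]; ring
  rw [← intervalIntegral.integral_add_adjacent_intervals (hc.intervalIntegrable 0 π)
    (hc.intervalIntegrable π (2 * π)), hp, hq]
  norm_num

lemma integral_cos_mul_sin_sq : ∫ ξ in (0 : ℝ)..(2 * π), cos ξ * sin ξ * sin ξ = 0 := by
  have h1 : ∀ x ∈ uIcc 0 (2 * π),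
      HasDerivAt (fun ξ => sin ξ ^ 3 / 3) (cos x * sin x * sin x) x := by
    intro x _
    have := ((hasDerivAt_sin x).pow 3).div_const 3
    refine this.congr_deriv ?_
    push_cast; ring
  rw [intervalIntegral.integral_eq_sub_of_hasDerivAt h1
    (Continuous.intervalIntegrable (by fun_prop) _ _)]
  simp

/-- The response at zero amplitude comes from the quadratic drag alone: the term `s p` contributes
`cos sin`, which is orthogonal to the critical mode. -/
lemma response_drag_zero (H θ β γ : ℝ) :
    IsShape.response (drag H θ β γ) 0 (fun ξ => 2 * cos ξ) = -(16 * β / (3 * π * H)) := by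
  have e : IsShape.load (drag H θ β γ) 0 (fun ξ => 2 * cos ξ) =
      fun ξ => -(4 * β / H) * (|sin ξ| * sin ξ) + -(4 * γ / H) * (cos ξ * sin ξ) := by
    ext ξ
    have hd : deriv (fun ξ => 2 * cos ξ) ξ = -(2 * sin ξ) := by simp
    rw [IsShape.load, hd, drag, abs_neg, abs_mul, abs_two]
    ring
  rw [IsShape.response, e, coeff_one_im (by fun_prop)]
  have e2 : ∫ ξ in (0 : ℝ)..(2 * π), (-(4 * β / H) * (|sin ξ| * sin ξ) +
      -(4 * γ / H) * (cos ξ * sin ξ)) * sin ξ = -(4 * β / H) * (8 / 3) := by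
    have e3 : ∀ ξ : ℝ, (-(4 * β / H) * (|sin ξ| * sin ξ) + -(4 * γ / H) * (cos ξ * sin ξ)) * sin ξ =
        -(4 * β / H) * (|sin ξ| * sin ξ * sin ξ) + -(4 * γ / H) * (cos ξ * sin ξ * sin ξ) := by
      intro ξ; ring
    simp_rw [e3]
    rw [intervalIntegral.integral_add (Continuous.intervalIntegrable (by fun_prop) _ _)
      (Continuous.intervalIntegrable (by fun_prop) _ _), intervalIntegral.integral_const_mul,
      intervalIntegral.integral_const_mul, integral_abs_sin_mul_sin_sq, integral_cos_mul_sin_sq]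
    ring
  rw [e2]
  have := pi_ne_zero
  field_simp
  ring

/-- A small periodic solution of the wave equation with first Fourier coefficient `a ≥ 0` is `a`
times the shape of amplitude `a`. The bound `|φ|, |φ'| ≤ 4a`, which makes `φ / a` a shape, follows
since the nonlinearity is quadratic. -/
lemma eq_mul_of_isShape {H θ β γ ρ Λ c₀ p₄ p₂ p₀ a D : ℝ} {χ φ : ℝ → ℝ} (hH : 0 < H)
    (hν : IsDragLike (drag H θ β γ) ρ Λ) (hc : 0 < c₀)
    (hm : ∀ n : ℤ, 2 ≤ |n| → c₀ * (n : ℝ) ^ 4 ≤ waveSymbol p₄ p₂ p₀ n) (hΛ : 0 ≤ Λ)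
    (hsmall : 4 * ρ * solBound c₀ * Λ ≤ 1) (ha : 0 ≤ a) (haρ : a ≤ ρ)
    (hχ : IsShape (waveSymbol p₄ p₂ p₀) (drag H θ β γ) a χ)
    (hφ : ContDiff ℝ 5 φ) (hp : Function.Periodic φ (2 * π)) (h0 : coeff φ 0 = 0)
    (h1 : coeff φ 1 = a) (hφD : ∀ ξ, |φ ξ| ≤ D ∧ |deriv φ ξ| ≤ D) (hθD : |θ| * D ≤ H / 2)
    (hD : solBound c₀ * (2 / H * (|β| + |γ|) * D) ≤ 1 / 2)
    (heq : ∀ ξ, p₄ * iteratedDeriv 5 φ ξ + p₂ * iteratedDeriv 3 φ ξ + p₀ * iteratedDeriv 1 φ ξ +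
      drag H θ β γ 1 (φ ξ) (deriv φ ξ) = 0) :
    φ = fun ξ => a * χ ξ := by
  have hS := solBound_nonneg hc
  set G := |β| + |γ| with hG
  have hG0 : 0 ≤ G := by positivity
  set h : ℝ → ℝ := fun ξ => drag H θ β γ 1 (φ ξ) (deriv φ ξ) with hh
  -- `E` is the `C¹` norm of `φ`; the quadratic bound on the load gives `E ≤ 2a + E / 2`
  set d : ℝ → ℝ := fun ξ => max |φ ξ| |deriv φ ξ| with hd
  have hbdd : BddAbove (range d) := ⟨D, by
    rintro _ ⟨ξ, rfl⟩
    exact max_le (hφD ξ).1 (hφD ξ).2⟩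
  set E := ⨆ ξ, d ξ with hE
  have hdE : ∀ ξ, d ξ ≤ E := fun ξ => le_ciSup hbdd ξ
  have hE0 : 0 ≤ E := (le_max_of_le_left (abs_nonneg _)).trans (hdE 0)
  have hED : E ≤ D := ciSup_le fun ξ => max_le (hφD ξ).1 (hφD ξ).2
  have hb : ∀ ξ, |h ξ| ≤ 2 / H * G * E ^ 2 := by
    intro ξ
    refine abs_drag_le hH ?_ ((le_max_left _ _).trans (hdE ξ)) ((le_max_right _ _).trans (hdE ξ))
    rw [mul_one, abs_mul]
    exact (mul_le_mul_of_nonneg_left (hφD ξ).1 (abs_nonneg _)).trans hθD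
  have e0 : ∀ ξ, φ ξ = 2 * a * cos ξ - solOp (waveSymbol p₄ p₂ p₀) 0 h ξ :=
    eq_sub_solOp hc hm hφ hp h0 h1 hb heq
  have e1 : ∀ ξ, deriv φ ξ = -(2 * a * sin ξ) - solOp (waveSymbol p₄ p₂ p₀) 1 h ξ := by
    intro ξ
    conv_lhs => rw [funext e0]
    exact (((hasDerivAt_cos ξ).const_mul (2 * a)).sub
      (hasDerivAt_solOp hc hm (j := 0) (by omega) hb ξ)).congr_deriv (by ring) |>.deriv
  have hsol : ∀ j ≤ 1, ∀ ξ, |solOp (waveSymbol p₄ p₂ p₀) j h ξ| ≤ E / 2 := by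
    intro j hj ξ
    calc _ ≤ solBound c₀ * (2 / H * G * E ^ 2) := abs_solOp_le hc hm (by omega) hb ξ
      _ = solBound c₀ * (2 / H * G * E) * E := by ring
      _ ≤ solBound c₀ * (2 / H * G * D) * E := by gcongr
      _ ≤ 1 / 2 * E := by gcongr
      _ = E / 2 := by ring
  have hE4 : E ≤ 4 * a := by
    have : E ≤ 2 * a + E / 2 := by
      refine ciSup_le fun ξ => max_le ?_ ?_
      · rw [e0]
        refine (abs_sub _ _).trans (add_le_add ?_ (hsol 0 (by omega) ξ))
        rw [abs_mul, abs_of_nonneg (by positivity : 0 ≤ 2 * a)]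
        nlinarith [abs_cos_le_one ξ]
      · rw [e1]
        refine (abs_sub _ _).trans (add_le_add ?_ (hsol 1 (by omega) ξ))
        rw [abs_neg, abs_mul, abs_of_nonneg (by positivity : 0 ≤ 2 * a)]
        nlinarith [abs_sin_le_one ξ]
    linarith
  have hb4 : ∀ ξ, |φ ξ| ≤ 4 * a ∧ |deriv φ ξ| ≤ 4 * a := fun ξ =>
    ⟨((le_max_left _ _).trans (hdE ξ)).trans hE4, ((le_max_right _ _).trans (hdE ξ)).trans hE4⟩
  rcases ha.eq_or_lt with rfl | hapos
  · ext ξ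
    have := (hb4 ξ).1
    rw [mul_zero] at this
    rw [zero_mul, abs_nonpos_iff.mp this]
  · have hder : ∀ ξ, deriv (fun ξ => a⁻¹ * φ ξ) ξ = a⁻¹ * deriv φ ξ := fun ξ => by
      rw [deriv_const_mul_field]
    have hscale : ∀ x : ℝ, |x| ≤ 4 * a → |a⁻¹ * x| ≤ 4 := by
      intro x hx
      rw [abs_mul, abs_of_pos (inv_pos.mpr hapos), inv_mul_le_iff₀ hapos]
      linarith
    have hshape : IsShape (waveSymbol p₄ p₂ p₀) (drag H θ β γ) a fun ξ => a⁻¹ * φ ξ := by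
      refine ⟨contDiff_const.mul (hφ.of_le (by norm_num)), fun ξ => hscale _ (hb4 ξ).1,
        fun ξ => ?_, fun ξ => ?_⟩
      · rw [hder]; exact hscale _ (hb4 ξ).2
      · have e2 : h = fun s => a ^ 2 *
            drag H θ β γ a (a⁻¹ * φ s) (deriv (fun ξ => a⁻¹ * φ ξ) s) := by
          ext s
          rw [hder, ← drag_homogeneous ha, mul_inv_cancel_left₀ hapos.ne',
            mul_inv_cancel_left₀ hapos.ne']
        rw [e0 ξ, e2, solOp_const_mul]
        field_simp
    have := IsShape.unique hν hc hm hΛ hsmall hshape hχ ha haρ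
    ext ξ
    rw [← this, mul_inv_cancel_left₀ hapos.ne']

/-! ### Uniform families of wave shapes -/

/-- The residual of the equation for the shape `φ` of a steady plane wave with wave number
`k_c + κ`; here `θ = f / g`. -/
def waveResidual (d b H Q θ α κ : ℝ) (φ : ℝ → ℝ) (ξ : ℝ) : ℝ :=
  d * (kCrit d b + κ) ^ 4 * iteratedDeriv 5 φ ξ + b * (kCrit d b + κ) ^ 2 * iteratedDeriv 3 φ ξ +
    (CCrit d b H - α * H + Q * ((kCrit d b + κ) * |deriv φ ξ|)) / (H + θ * φ ξ) * deriv φ ξ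

/-- The value of `α` at which the trivial flow loses stability at wave number `k_c + κ`. -/
def criticalAlpha (d b κ : ℝ) : ℝ := d * ((kCrit d b + κ) ^ 2 - kCrit d b ^ 2) ^ 2

/-- A family of rescaled wave shapes `χ a α κ` with responses `σ a α κ`: the function `a χ` solves
the wave equation up to the multiple `2a (α - α_* + a σ)` of `sin`, and every small wave whose
first Fourier coefficient is `a ≥ 0` is of this form. -/
structure IsWaveFamily (d b H Q θ ε ρ δ K : ℝ) (χ : ℝ → ℝ → ℝ → ℝ → ℝ) (σ : ℝ → ℝ → ℝ → ℝ) :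
    Prop where
  wavenumber_pos : ∀ κ, |κ| < ε → 0 < kCrit d b + κ
  contDiff : ∀ a α κ, 0 ≤ a → a < ρ → |α| < ε → |κ| < ε → ContDiff ℝ 5 (χ a α κ)
  periodic : ∀ a α κ, 0 ≤ a → a < ρ → |α| < ε → |κ| < ε → Function.Periodic (χ a α κ) (2 * π)
  coeff : ∀ a α κ, 0 ≤ a → a < ρ → |α| < ε → |κ| < ε →
    coeff (χ a α κ) 1 = 1 ∧ coeff (χ a α κ) 0 = 0
  depth_pos : ∀ a α κ, 0 ≤ a → a < ρ → |α| < ε → |κ| < ε → ∀ ξ, 0 < H + θ * (a * χ a α κ ξ)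
  residual : ∀ a α κ, 0 ≤ a → a < ρ → |α| < ε → |κ| < ε → ∀ ξ,
    waveResidual d b H Q θ α κ (fun ξ => a * χ a α κ ξ) ξ =
      2 * a * (α - criticalAlpha d b κ + a * σ a α κ) * sin ξ
  close : ∀ a α κ, 0 ≤ a → a < ρ → |α| < ε → |κ| < ε → ∀ j ≤ 5, ∀ ξ,
    |iteratedDeriv j (fun ξ => χ a α κ ξ - 2 * cos ξ) ξ| ≤ K * a
  small : ∀ a α κ, 0 ≤ a → a < ρ → |α| < ε → |κ| < ε → normH5 (fun ξ => a * χ a α κ ξ) < δ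
  response : ∀ a α κ, 0 ≤ a → a < ρ → |α| < ε → |κ| < ε →
    |σ a α κ + dragCoeff d b H Q| ≤ K * (Q + |θ|) * (a + |κ|)
  response_lipschitz : ∀ a a' α κ, 0 ≤ a → a < ρ → 0 ≤ a' → a' < ρ → |α| < ε → |κ| < ε →
    |σ a α κ - σ a' α κ| ≤ K * |a - a'|
  unique : ∀ a α κ, 0 ≤ a → a < ρ → |α| < ε → |κ| < ε → ∀ φ : ℝ → ℝ, ContDiff ℝ 5 φ →
    Function.Periodic φ (2 * π) → (∫ ξ in (0 : ℝ)..(2 * π), φ ξ = 0) → normH5 φ < δ →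
    firstFourierCoeff φ = (a : ℂ) → (∀ ξ, 0 < H + θ * φ ξ) →
    (∀ ξ, waveResidual d b H Q θ α κ φ ξ = 0) → φ = fun ξ => a * χ a α κ ξ

lemma exists_pos_mul_le_one {A : ℝ} (hA : 0 ≤ A) : ∃ x > 0, A * x ≤ 1 :=
  ⟨1 / (A + 1), by positivity, by rw [mul_one_div, div_le_one (by linarith)]; linarith⟩

lemma kCrit_pos {d b : ℝ} (hd : 0 < d) (hb : 0 < b) : 0 < kCrit d b :=
  Real.sqrt_pos.mpr (by positivity)

lemma kCrit_sq {d b : ℝ} (hd : 0 < d) (hb : 0 < b) : kCrit d b ^ 2 = b / (2 * d) :=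
  Real.sq_sqrt (by positivity)

lemma dragCoeff_eq (d b H Q : ℝ) (hb : 0 ≤ b) :
    dragCoeff d b H Q = 16 * (Q * kCrit d b) / (3 * π * H) := by
  unfold dragCoeff kCrit
  rw [Real.sqrt_div hb, ← mul_div_assoc, ← mul_div_assoc, div_div,
    mul_comm (√(2 * d)), mul_assoc 16]

/-- The symbol of the wave equation in completed-square form. -/
lemma waveSymbol_eq {d b H : ℝ} (hd : 0 < d) (hb : 0 < b) (hH : 0 < H) (α κ : ℝ) (n : ℤ) :
    waveSymbol (d * (kCrit d b + κ) ^ 4) (b * (kCrit d b + κ) ^ 2) ((CCrit d b H - α * H) / H) n =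
      d * ((kCrit d b + κ) ^ 2 * (n : ℝ) ^ 2 - kCrit d b ^ 2) ^ 2 - α := by
  have h1 : b = 2 * d * kCrit d b ^ 2 := by rw [kCrit_sq hd hb]; field_simp
  have h2 : (CCrit d b H - α * H) / H = d * kCrit d b ^ 4 - α := by
    have : kCrit d b ^ 4 = (b / (2 * d)) ^ 2 := by rw [← kCrit_sq hd hb]; ring
    rw [this, CCrit]; field_simp; ring
  rw [waveSymbol, h2]
  generalize hk : kCrit d b = k at *
  rw [h1]
  ring

/-- Uniform ellipticity off the critical modes: for `|n| ≥ 2` and `|κ| ≤ k_c / 10` the square in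
`waveSymbol_eq` is at least `(14/25 k_c² n²)²`, which leaves room for `α`. -/
lemma waveSymbol_ge {d b H : ℝ} (hd : 0 < d) (hb : 0 < b) (hH : 0 < H) {α κ : ℝ}
    (hκ : |κ| ≤ kCrit d b / 10) (hα : |α| ≤ d * kCrit d b ^ 4 / 8) (n : ℤ) (hn : 2 ≤ |n|) :
    d * kCrit d b ^ 4 / 8 * (n : ℝ) ^ 4 ≤
      waveSymbol (d * (kCrit d b + κ) ^ 4) (b * (kCrit d b + κ) ^ 2)
        ((CCrit d b H - α * H) / H) n := by
  rw [waveSymbol_eq hd hb hH]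
  have hk := kCrit_pos hd hb
  set k := kCrit d b
  have hn4 : (4 : ℝ) ≤ (n : ℝ) ^ 2 := by
    have : (2 : ℝ) ≤ |(n : ℝ)| := by rw [← Int.cast_abs]; exact_mod_cast hn
    rw [← sq_abs]; nlinarith
  have hκ1 := (abs_le.mp hκ).1
  have hα1 := (abs_le.mp hα).2
  have hK : 81 / 100 * k ^ 2 ≤ (k + κ) ^ 2 := by nlinarith
  have h1 : 56 / 100 * (k ^ 2 * (n : ℝ) ^ 2) ≤ (k + κ) ^ 2 * (n : ℝ) ^ 2 - k ^ 2 := by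
    have : 81 / 100 * k ^ 2 * (n : ℝ) ^ 2 ≤ (k + κ) ^ 2 * (n : ℝ) ^ 2 := by gcongr
    nlinarith [sq_nonneg k]
  have h2 : (56 / 100 * (k ^ 2 * (n : ℝ) ^ 2)) ^ 2 ≤
      ((k + κ) ^ 2 * (n : ℝ) ^ 2 - k ^ 2) ^ 2 := by gcongr
  have h3 : d * (56 / 100 * (k ^ 2 * (n : ℝ) ^ 2)) ^ 2 ≤
      d * ((k + κ) ^ 2 * (n : ℝ) ^ 2 - k ^ 2) ^ 2 := by gcongr
  have h4 : α ≤ d * k ^ 4 / 8 * (n : ℝ) ^ 4 := by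
    refine hα1.trans ?_
    have : (1 : ℝ) ≤ (n : ℝ) ^ 4 := by nlinarith
    exact le_mul_of_one_le_right (by positivity) this
  have h5 : 0 ≤ d * k ^ 4 * (n : ℝ) ^ 4 := by positivity
  nlinarith

lemma integral_eq_zero_iff_coeff (φ : ℝ → ℝ) :
    (∫ ξ in (0 : ℝ)..(2 * π), φ ξ = 0) ↔ coeff φ 0 = 0 := by
  have hpi : (1 / (2 * (π : ℂ))) ≠ 0 := by
    simp
  unfold coeff
  rw [mul_eq_zero, or_iff_right hpi]
  simp only [Int.cast_zero, mul_zero, zero_mul, neg_zero, Complex.exp_zero, mul_one]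
  rw [intervalIntegral.integral_ofReal, Complex.ofReal_eq_zero]

/-- The symbol of the linear part of the wave equation. -/
def shapeSymbol (d b H α κ : ℝ) : ℤ → ℝ :=
  waveSymbol (d * (kCrit d b + κ) ^ 4) (b * (kCrit d b + κ) ^ 2) ((CCrit d b H - α * H) / H)

/-- The coefficient `γ` of the nonlinearity of the wave equation. -/
def pressureCoeff (d b H θ α : ℝ) : ℝ := -((CCrit d b H - α * H) * θ / H)

/-- The rescaled nonlinearity of the wave equation. -/
def shapeDrag (d b H Q θ α κ : ℝ) : ℝ → ℝ → ℝ → ℝ :=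
  drag H θ (Q * (kCrit d b + κ)) (pressureCoeff d b H θ α)

/-- Wave families exist under explicit conditions. Here `c₀` is the ellipticity constant on the
modes `|n| ≥ 2`, `Λ` a uniform Lipschitz constant of the nonlinearity and `Λ'` one that is
proportional to `Q + |θ|`, while `P` and `e₀` bound the coefficients of the linear operator. The conditions on `ρ`
make the fixed point problem a contraction and its solutions small; those on `δ` keep the depth away
from zero and make the nonlinearity a small perturbation. -/
theorem exists_waveFamily_of_bounds {d b H Q θ ε ρ δ K c₀ Λ Λ' P e₀ : ℝ}
    (hd : 0 < d) (hb : 0 < b) (hH : 0 < H) (hQ : 0 < Q) (hρ : 0 < ρ) (hc : 0 < c₀)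
    (hΛ : 0 ≤ Λ) (hΛ' : 0 ≤ Λ') (he₀ : 0 < e₀) (hρb : ρ ≤ 1)
    (hκ0 : ∀ κ, |κ| < ε → 0 < kCrit d b + κ)
    (hm : ∀ α κ, |α| < ε → |κ| < ε → ∀ n : ℤ, 2 ≤ |n| →
      c₀ * (n : ℝ) ^ 4 ≤ shapeSymbol d b H α κ n)
    (hν : ∀ α κ, |α| < ε → |κ| < ε → IsDragLike (shapeDrag d b H Q θ α κ) ρ Λ)
    (hν' : ∀ α κ, |α| < ε → |κ| < ε → IsDragLike (shapeDrag d b H Q θ α κ) ρ Λ')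
    (hθρ : ∀ a s, 0 ≤ a → a ≤ ρ → |s| ≤ 4 → |θ * a * s| ≤ H / 2)
    (hρc : 4 * ρ * solBound c₀ * Λ ≤ 1)
    (hp₄ : ∀ κ, |κ| < ε → e₀ ≤ d * (kCrit d b + κ) ^ 4)
    (hp₂ : ∀ κ, |κ| < ε → |b * (kCrit d b + κ) ^ 2| ≤ P)
    (hp₀ : ∀ α, |α| < ε → |(CCrit d b H - α * H) / H| ≤ P)
    (hK : solBound c₀ * Λ + 7 * ((3 * Λ + 2 * P * (solBound c₀ * Λ)) / e₀) ≤ K)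
    (hKδ : 3 * (K + 2) * ρ ≤ δ)
    (hKL' : Λ' * (4 * solBound c₀ * Λ + 3) ≤ K * (Q + |θ|)) (hKH : 16 / (3 * π * H) ≤ K)
    (hKL : Λ * (4 * solBound c₀ * Λ + 3) ≤ K) (hδa : |θ| * (2 * π * δ) ≤ H / 2)
    (hδb : ∀ α κ, |α| < ε → |κ| < ε → solBound c₀ * (2 / H *
      (|Q * (kCrit d b + κ)| + |pressureCoeff d b H θ α|) * (2 * π * δ)) ≤ 1 / 2) :
    ∃ χ σ, IsWaveFamily d b H Q θ ε ρ δ K χ σ := by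
  have hK0 : 0 < K := lt_of_lt_of_le (by positivity) hKH
  -- a shape is chosen only where one exists; elsewhere the value of `χ` is irrelevant
  set χ : ℝ → ℝ → ℝ → ℝ → ℝ := fun a α κ =>
    Classical.epsilon (IsShape (shapeSymbol d b H α κ) (shapeDrag d b H Q θ α κ) a) with hχdef
  have hχ : ∀ a α κ, 0 ≤ a → a < ρ → |α| < ε → |κ| < ε →
      IsShape (shapeSymbol d b H α κ) (shapeDrag d b H Q θ α κ) a (χ a α κ) :=
    fun a α κ ha haρ hα hκ =>
      Classical.epsilon_spec (exists_isShape (hν α κ hα hκ) hc (hm α κ hα hκ) hΛ hρc ha haρ.le)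
  have hdepth : ∀ a α κ, 0 ≤ a → a < ρ → |α| < ε → |κ| < ε →
      ∀ ξ, 0 < H + θ * (a * χ a α κ ξ) := by
    intro a α κ ha haρ hα hκ ξ
    have := half_depth_le (hθρ a _ ha haρ.le ((hχ a α κ ha haρ hα hκ).bound ξ))
    rw [mul_assoc] at this
    linarith
  have hclose : ∀ a α κ, 0 ≤ a → a < ρ → |α| < ε → |κ| < ε →
      ∀ j ≤ 5, ∀ ξ, |iteratedDeriv j (fun ξ => χ a α κ ξ - 2 * cos ξ) ξ| ≤ K * a := by
    intro a α κ ha haρ hα hκ j hj ξ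
    have h1 := IsShape.abs_iteratedDeriv_sub_le (hν α κ hα hκ) hc (hm α κ hα hκ) hΛ hρc
      (hχ a α κ ha haρ hα hκ) ha haρ.le he₀ (hp₄ κ hκ) (hp₂ κ hκ) (hp₀ α hα) hj ξ
    exact h1.trans (mul_le_mul_of_nonneg_right hK ha)
  refine ⟨χ, fun a α κ => IsShape.response (shapeDrag d b H Q θ α κ) a (χ a α κ), ?_⟩
  constructor
  case wavenumber_pos => exact hκ0
  case contDiff =>
    intro a α κ ha haρ hα hκ
    exact (hχ a α κ ha haρ hα hκ).smooth (hν α κ hα hκ) hc (hm α κ hα hκ) ha haρ.le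
  case periodic =>
    intro a α κ ha haρ hα hκ
    exact (hχ a α κ ha haρ hα hκ).periodic
  case coeff =>
    intro a α κ ha haρ hα hκ
    exact (hχ a α κ ha haρ hα hκ).coeff_eq (hν α κ hα hκ) hc (hm α κ hα hκ) ha haρ.le
  case depth_pos => exact hdepth
  case residual =>
    intro a α κ ha haρ hα hκ ξ
    have key := IsShape.equation (hν α κ hα hκ) hc (hm α κ hα hκ) hΛ hρc
      (hχ a α κ ha haρ hα hκ) ha haρ.le ξ
    have h1 : (kCrit d b + κ) ^ 2 * (1 : ℤ) ^ 2 - kCrit d b ^ 2 =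
        (kCrit d b + κ) ^ 2 - kCrit d b ^ 2 := by push_cast; ring
    have h2 := waveSymbol_eq hd hb hH α κ 1
    rw [h1, waveSymbol, Int.cast_one, one_pow, one_pow, mul_one, mul_one] at h2
    have hsplit := drag_split (θ := θ) (C := CCrit d b H - α * H) (Q := Q) (k := kCrit d b + κ) hH
      (p := a * deriv (χ a α κ) ξ) (hdepth a α κ ha haρ hα hκ ξ)
    rw [drag_homogeneous ha] at hsplit
    have hd1 : deriv (fun ξ => a * χ a α κ ξ) ξ = a * deriv (χ a α κ) ξ := by
      rw [deriv_const_mul_field]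
    rw [waveResidual, hd1, iteratedDeriv_const_mul_field, iteratedDeriv_const_mul_field,
      hsplit, criticalAlpha]
    rw [iteratedDeriv_one] at key
    simp only [IsShape.load] at key
    have hfold : drag H θ (Q * (kCrit d b + κ)) (-((CCrit d b H - α * H) * θ / H)) =
        shapeDrag d b H Q θ α κ := rfl
    rw [hfold]
    linear_combination a * key - 2 * a * sin ξ * h2
  case close => exact hclose
  case small =>
    intro a α κ ha haρ hα hκ
    have hcd := (hχ a α κ ha haρ hα hκ).smooth (hν α κ hα hκ) hc (hm α κ hα hκ) ha haρ.le
    have hbd : ∀ j ≤ 5, ∀ ξ, |iteratedDeriv j (fun ξ => a * χ a α κ ξ) ξ| ≤ (K + 2) * a := by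
      intro j hj ξ
      have hj' : (j : WithTop ℕ∞) ≤ 5 := by exact_mod_cast hj
      have h1 := hclose a α κ ha haρ hα hκ j hj ξ
      have e : iteratedDeriv j (fun ξ => χ a α κ ξ - 2 * cos ξ) ξ =
          iteratedDeriv j (χ a α κ) ξ - 2 * iteratedDeriv j cos ξ := by
        have := iteratedDeriv_sub (x := ξ) (hcd.of_le hj').contDiffAt
          (contDiff_two_cos.of_le hj').contDiffAt
        rw [iteratedDeriv_two_cos] at this
        exact this
      rw [iteratedDeriv_const_mul_field, abs_mul, abs_of_nonneg ha, mul_comm]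
      refine mul_le_mul_of_nonneg_right ?_ ha
      have e2 : iteratedDeriv j (χ a α κ) ξ = iteratedDeriv j (fun ξ => χ a α κ ξ - 2 * cos ξ) ξ +
          2 * iteratedDeriv j cos ξ := by rw [e]; ring
      rw [e2]
      refine (abs_add_le _ _).trans (add_le_add (h1.trans ?_) ?_)
      · exact mul_le_of_le_one_right hK0.le (haρ.le.trans hρb)
      · rw [abs_mul, abs_two]
        linarith [Real.abs_iteratedDeriv_cos_le_one j ξ]
    calc normH5 (fun ξ => a * χ a α κ ξ) ≤ 3 * ((K + 2) * a) :=
          normH5_le (contDiff_const.mul hcd) hbd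
      _ < 3 * ((K + 2) * ρ) := by gcongr
      _ = 3 * (K + 2) * ρ := by ring
      _ ≤ δ := hKδ
  case response =>
    intro a α κ ha haρ hα hκ
    have h1 := IsShape.abs_response_sub_le (hν α κ hα hκ) hc (hm α κ hα hκ) hΛ hρc
      (hν' α κ hα hκ) hΛ' (hχ a α κ ha haρ hα hκ) (IsShape.two_cos _ _) ha haρ.le
      le_rfl hρ.le
    have h2 : IsShape.response (shapeDrag d b H Q θ α κ) 0 (fun ξ => 2 * cos ξ) =
        -(16 * (Q * (kCrit d b + κ)) / (3 * π * H)) := response_drag_zero H θ _ _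
    rw [sub_zero, abs_of_nonneg ha] at h1
    have e : IsShape.response (shapeDrag d b H Q θ α κ) a (χ a α κ) + dragCoeff d b H Q =
        (IsShape.response (shapeDrag d b H Q θ α κ) a (χ a α κ) -
          IsShape.response (shapeDrag d b H Q θ α κ) 0 fun ξ => 2 * cos ξ) +
          -(16 / (3 * π * H) * Q * κ) := by
      rw [h2, dragCoeff_eq d b H Q hb.le]
      ring
    rw [e]
    calc _ ≤ Λ' * (4 * solBound c₀ * Λ + 3) * a + 16 / (3 * π * H) * Q * |κ| := by
          refine (abs_add_le _ _).trans (add_le_add h1 (le_of_eq ?_))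
          rw [abs_neg, abs_mul, abs_of_nonneg (by positivity : 0 ≤ 16 / (3 * π * H) * Q)]
      _ ≤ K * (Q + |θ|) * a + K * (Q + |θ|) * |κ| := by
          gcongr
          linarith [abs_nonneg θ]
      _ = _ := by ring
  case response_lipschitz =>
    intro a a' α κ ha haρ ha' haρ' hα hκ
    refine (IsShape.abs_response_sub_le (hν α κ hα hκ) hc (hm α κ hα hκ) hΛ hρc
      (hν α κ hα hκ) hΛ (hχ a α κ ha haρ hα hκ) (hχ a' α κ ha' haρ' hα hκ) ha haρ.le
      ha' haρ'.le).trans ?_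
    gcongr
  case unique =>
    intro a α κ ha haρ hα hκ φ hφ hp h0 hδφ h1 hpos hres
    have hbd := abs_le_of_normH5_lt hφ hp h0 hδφ
    refine eq_mul_of_isShape (D := 2 * π * δ) hH (hν α κ hα hκ) hc (hm α κ hα hκ) hΛ hρc ha
      haρ.le (hχ a α κ ha haρ hα hκ) hφ hp ((integral_eq_zero_iff_coeff φ).mp h0)
      (by rw [← firstFourierCoeff_eq_coeff]; exact h1) hbd ?_ ?_ ?_
    · exact hδa
    · exact hδb α κ hα hκ
    · intro ξ
      have h2 := hres ξ
      have hsplit := drag_split (θ := θ) (C := CCrit d b H - α * H) (Q := Q) (k := kCrit d b + κ) hH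
        (p := deriv φ ξ) (hpos ξ)
      rw [waveResidual, hsplit] at h2
      rw [iteratedDeriv_one, pressureCoeff]
      linarith

/-- Wave families exist, with constants that depend on `d`, `b`, `H` and a bound `M` for `Q` and
`|θ|` only. -/
theorem exists_waveFamily {d b H M : ℝ} (hd : 0 < d) (hb : 0 < b) (hH : 0 < H) (hM : 0 < M) :
    ∃ ε > 0, ε ≤ kCrit d b ∧ ∃ ρ > 0, ∃ δ > 0, ∃ K > 0, ∀ Q θ : ℝ, 0 < Q → Q ≤ M → |θ| ≤ M →
      ∃ χ σ, IsWaveFamily d b H Q θ ε ρ δ K χ σ := by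
  have hk := kCrit_pos hd hb
  set k := kCrit d b with hkdef
  set c₀ := d * k ^ 4 / 8 with hc₀
  have hc : 0 < c₀ := by positivity
  set S := solBound c₀ with hSdef
  have hS : 0 ≤ S := solBound_nonneg hc
  -- the coefficients of the nonlinearity satisfy `|β| + |γ| ≤ g₁ (Q + |θ|)`
  obtain ⟨g₁, hg₁⟩ : ∃ x, x = 2 * k + (b ^ 2 / (4 * d) + c₀) := ⟨_, rfl⟩
  have hg : 0 < g₁ := by rw [hg₁]; positivity
  have hdl : 0 < dragLip H M := by unfold dragLip; positivity
  obtain ⟨Λ, hΛdef⟩ : ∃ x, x = dragLip H M * (g₁ * (2 * M)) := ⟨_, rfl⟩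
  have hΛ : 0 < Λ := by rw [hΛdef]; positivity
  obtain ⟨P, hP⟩ : ∃ x, x = 4 * (b * k ^ 2) + (b ^ 2 / (4 * d) + c₀) := ⟨_, rfl⟩
  obtain ⟨e₀, he₀def⟩ : ∃ x, x = d * (k / 2) ^ 4 := ⟨_, rfl⟩
  have he₀ : 0 < e₀ := by rw [he₀def]; positivity
  have hP0 : 0 ≤ P := by rw [hP]; positivity
  obtain ⟨K₁, hK₁⟩ : ∃ x, x = S * Λ + 7 * ((3 * Λ + 2 * P * (S * Λ)) / e₀) := ⟨_, rfl⟩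
  have hK₁0 : 0 ≤ K₁ := by rw [hK₁]; positivity
  obtain ⟨L, hL⟩ : ∃ x, x = dragLip H M * g₁ * (4 * S * Λ + 3) := ⟨_, rfl⟩
  have hL0 : 0 ≤ L := by rw [hL]; positivity
  obtain ⟨K, hK⟩ : ∃ x, x = K₁ + L + L * (2 * M) + 16 / (3 * π * H) := ⟨_, rfl⟩
  have hKpos : 0 < K := by rw [hK]; positivity
  -- each smallness condition on `δ`, and then on `ρ`, is met because it is one of the summands of a
  -- sum of nonnegative numbers whose product with `δ` or `ρ` is at most one
  obtain ⟨δ, hδ, hδ1⟩ := exists_pos_mul_le_one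
    (A := 4 * π * M / H + 2 * (S * (2 / H * (g₁ * (2 * M)) * (2 * π)))) (by positivity)
  obtain ⟨ρ, hρ, hρ1⟩ := exists_pos_mul_le_one
    (A := 8 * M / H + 1 + 4 * S * Λ + 3 * (K + 2) / δ) (by positivity)
  have hδa : M * (2 * π * δ) ≤ H / 2 := by
    have : 4 * π * M / H * δ ≤ 1 := by
      refine le_trans ?_ hδ1
      gcongr
      have : 0 ≤ 2 * (S * (2 / H * (g₁ * (2 * M)) * (2 * π))) := by positivity
      linarith
    have e : 4 * π * M / H * δ = 4 * π * M * δ / H := by ring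
    rw [e, div_le_one hH] at this
    linarith
  have hδb : S * (2 / H * (g₁ * (2 * M)) * (2 * π * δ)) ≤ 1 / 2 := by
    have : 2 * (S * (2 / H * (g₁ * (2 * M)) * (2 * π))) * δ ≤ 1 := by
      refine le_trans ?_ hδ1
      gcongr
      have : 0 ≤ 4 * π * M / H := by positivity
      linarith
    linarith
  have hρa : 8 * M * ρ ≤ H := by
    have h1 : 8 * M / H * ρ ≤ 1 := by
      refine le_trans ?_ hρ1
      gcongr
      have : 0 ≤ 1 + 4 * S * Λ + 3 * (K + 2) / δ := by positivity
      linarith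
    have e : 8 * M / H * ρ = 8 * M * ρ / H := by ring
    rwa [e, div_le_one hH] at h1
  have hρb : ρ ≤ 1 := by
    have h1 : 1 * ρ ≤ 1 := by
      refine le_trans ?_ hρ1
      gcongr
      have h2 : 0 ≤ 8 * M / H := by positivity
      have h3 : 0 ≤ 4 * S * Λ + 3 * (K + 2) / δ := by positivity
      linarith
    linarith
  have hρc : 4 * ρ * S * Λ ≤ 1 := by
    have h1 : 4 * S * Λ * ρ ≤ 1 := by
      refine le_trans ?_ hρ1
      gcongr
      have h2 : 0 ≤ 8 * M / H := by positivity
      have h3 : 0 ≤ 3 * (K + 2) / δ := by positivity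
      linarith
    linarith
  have hρd : 3 * (K + 2) * ρ ≤ δ := by
    have h1 : 3 * (K + 2) / δ * ρ ≤ 1 := by
      refine le_trans ?_ hρ1
      gcongr
      have h2 : 0 ≤ 8 * M / H := by positivity
      have h3 : 0 ≤ 4 * S * Λ := by positivity
      linarith
    have e : 3 * (K + 2) / δ * ρ = 3 * (K + 2) * ρ / δ := by ring
    rwa [e, div_le_one hδ] at h1
  refine ⟨min (k / 10) c₀, by positivity, (min_le_left _ _).trans (by linarith), ρ, hρ, δ, hδ, K,
    hKpos, fun Q θ hQ hQM hθ => ?_⟩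
  have hκ10 : ∀ κ, |κ| < min (k / 10) c₀ → |κ| ≤ k / 10 := fun κ h =>
    (h.trans_le (min_le_left _ _)).le
  have hαc : ∀ α, |α| < min (k / 10) c₀ → |α| ≤ c₀ := fun κ h => (h.trans_le (min_le_right _ _)).le
  have hKk : ∀ κ, |κ| < min (k / 10) c₀ → k / 2 ≤ k + κ ∧ k + κ ≤ 2 * k := by
    intro κ hκ
    have := abs_le.mp (hκ10 κ hκ)
    constructor <;> linarith [this.1, this.2]
  have hCb : ∀ α, |α| < min (k / 10) c₀ →
      |(CCrit d b H - α * H) / H| ≤ b ^ 2 / (4 * d) + c₀ := by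
    intro α hα
    have e : (CCrit d b H - α * H) / H = b ^ 2 / (4 * d) - α := by
      rw [CCrit]; field_simp
    rw [e]
    refine (abs_sub _ _).trans ?_
    rw [abs_of_pos (by positivity : 0 < b ^ 2 / (4 * d))]
    linarith [hαc α hα]
  have hG : ∀ α κ, |α| < min (k / 10) c₀ → |κ| < min (k / 10) c₀ →
      |Q * (k + κ)| + |pressureCoeff d b H θ α| ≤ g₁ * (Q + |θ|) := by
    intro α κ hα hκ
    have h1 : |Q * (k + κ)| ≤ 2 * k * Q := by
      rw [abs_mul, abs_of_pos hQ, abs_of_pos (by linarith [(hKk κ hκ).1])]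
      nlinarith [(hKk κ hκ).2]
    have h2 : |pressureCoeff d b H θ α| ≤ (b ^ 2 / (4 * d) + c₀) * |θ| := by
      have e : pressureCoeff d b H θ α = -((CCrit d b H - α * H) / H * θ) := by
        rw [pressureCoeff]; ring
      rw [e, abs_neg, abs_mul]
      exact mul_le_mul_of_nonneg_right (hCb α hα) (abs_nonneg _)
    have h3 : 0 ≤ 2 * k * |θ| := by positivity
    have h4 : 0 ≤ (b ^ 2 / (4 * d) + c₀) * Q := by positivity
    rw [hg₁]
    linarith
  have hGM : ∀ α κ, |α| < min (k / 10) c₀ → |κ| < min (k / 10) c₀ →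
      |Q * (k + κ)| + |pressureCoeff d b H θ α| ≤ g₁ * (2 * M) := by
    intro α κ hα hκ
    refine (hG α κ hα hκ).trans (mul_le_mul_of_nonneg_left (by linarith) hg.le)
  refine exists_waveFamily_of_bounds (Λ := Λ) (Λ' := dragLip H M * (g₁ * (Q + |θ|))) (P := P)
    (e₀ := e₀) hd hb hH hQ hρ hc hΛ.le (by positivity) he₀ hρb
    (fun κ hκ => by linarith [(hKk κ hκ).1])
    (fun α κ hα hκ => waveSymbol_ge hd hb hH (hκ10 κ hκ) (hαc α hα))
    (fun α κ hα hκ => isDragLike_drag hH hθ hρa hρb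
      (by rw [hΛdef]; exact mul_le_mul_of_nonneg_left (hGM α κ hα hκ) hdl.le))
    (fun α κ hα hκ => isDragLike_drag hH hθ hρa hρb
      (mul_le_mul_of_nonneg_left (hG α κ hα hκ) hdl.le))
    (fun a s ha haρ hs => abs_depth_le hθ hρa ha haρ hs) hρc ?_ ?_ ?_ ?_ hρd ?_ ?_ ?_ ?_ ?_
  · intro κ hκ
    rw [he₀def]
    exact mul_le_mul_of_nonneg_left (pow_le_pow_left₀ (by positivity) (hKk κ hκ).1 4) hd.le
  · intro κ hκ
    have h3 : 0 < k + κ := by linarith [(hKk κ hκ).1]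
    rw [abs_of_pos (by positivity)]
    have h4 : (k + κ) ^ 2 ≤ (2 * k) ^ 2 := pow_le_pow_left₀ h3.le (hKk κ hκ).2 2
    have h5 : b * (k + κ) ^ 2 ≤ b * (2 * k) ^ 2 := mul_le_mul_of_nonneg_left h4 hb.le
    have h6 : 0 ≤ b ^ 2 / (4 * d) + c₀ := by positivity
    rw [hP]; linarith
  · intro α hα
    have : 0 ≤ 4 * (b * k ^ 2) := by positivity
    rw [hP]; linarith [hCb α hα]
  · have : 0 ≤ L + L * (2 * M) + 16 / (3 * π * H) := by positivity
    rw [← hSdef, ← hK₁, hK]; linarith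
  · have h1 : dragLip H M * (g₁ * (Q + |θ|)) * (4 * S * Λ + 3) = L * (Q + |θ|) := by
      rw [hL]; ring
    rw [h1]
    have h2 : 0 ≤ K₁ + L * (2 * M) + 16 / (3 * π * H) := by positivity
    exact mul_le_mul_of_nonneg_right (by rw [hK]; linarith) (by positivity)
  · have : 0 ≤ K₁ + L + L * (2 * M) := by positivity
    rw [hK]; linarith
  · have h1 : Λ * (4 * S * Λ + 3) = L * (2 * M) := by
      rw [hL]; nth_rewrite 1 [hΛdef]; ring
    rw [h1]
    have h3 : 0 ≤ K₁ + L + 16 / (3 * π * H) := by positivity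
    rw [hK]; linarith
  · exact (mul_le_mul_of_nonneg_right hθ (by positivity)).trans hδa
  · intro α κ hα hκ
    refine le_trans (mul_le_mul_of_nonneg_left (mul_le_mul_of_nonneg_right
      (mul_le_mul_of_nonneg_left (hGM α κ hα hκ) (by positivity)) (by positivity)) hS) hδb

/-! ### The pitchfork, translations and signed amplitudes -/

/-- Roots of `0 = Λ + a (σ a)` for a function `σ` close to `-c` with small Lipschitz constant: since
`a (σ a)` decreases strictly, there is one positive root if `Λ > 0` and none otherwise. -/
lemma pitchfork {σ : ℝ → ℝ} {c ρ L Λ : ℝ} (hc : 0 < c) (hρ : 0 < ρ)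
    (hσ : ∀ a, 0 ≤ a → a < ρ → |σ a + c| ≤ c / 2)
    (hlip : ∀ a a', 0 ≤ a → a < ρ → 0 ≤ a' → a' < ρ → |σ a - σ a'| ≤ L * |a - a'|)
    (hL : L * ρ ≤ c / 4) :
    (Λ ≤ 0 → ∀ a, 0 < a → a < ρ → Λ + a * σ a ≠ 0) ∧
    (0 < Λ → Λ < c * ρ / 4 → ∃ a, 0 < a ∧ a < ρ ∧ Λ + a * σ a = 0 ∧ a * c ≤ 2 * Λ ∧
      ∀ a', 0 < a' → a' < ρ → Λ + a' * σ a' = 0 → a' = a) := by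
  have hneg : ∀ a, 0 < a → a < ρ → a * σ a ≤ -(a * c / 2) := by
    intro a ha haρ
    have := (abs_le.mp (hσ a ha.le haρ)).2
    nlinarith
  have hanti : ∀ a a', 0 < a → a < a' → a' < ρ → a' * σ a' < a * σ a := by
    intro a a' ha haa ha'
    have hσ' := (abs_le.mp (hσ a' (ha.trans haa).le ha')).2
    have h1 := (abs_le.mp (hlip a' a (ha.trans haa).le ha' ha.le (haa.trans ha'))).2
    rw [abs_of_pos (sub_pos.mpr haa)] at h1
    have hd : 0 < a' - a := sub_pos.mpr haa
    have hL0 : 0 ≤ L := by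
      have := (abs_nonneg _).trans (hlip a' a (ha.trans haa).le ha' ha.le (haa.trans ha'))
      rw [abs_of_pos hd] at this
      exact nonneg_of_mul_nonneg_left this hd
    -- `a'σ(a') - aσ(a) = (a' - a) σ(a') + a (σ(a') - σ(a))`
    have h2 : a * (σ a' - σ a) ≤ c / 4 * (a' - a) := by
      calc a * (σ a' - σ a) ≤ a * (L * (a' - a)) := by gcongr
        _ = L * a * (a' - a) := by ring
        _ ≤ L * ρ * (a' - a) := by gcongr; linarith
        _ ≤ c / 4 * (a' - a) := by gcongr
    have h3 : (a' - a) * σ a' ≤ (a' - a) * -(c / 2) := by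
      apply mul_le_mul_of_nonneg_left _ hd.le
      linarith
    nlinarith [mul_pos hc hd]
  refine ⟨fun hΛ a ha haρ h => ?_, fun hΛ hΛρ => ?_⟩
  · have := hneg a ha haρ
    nlinarith [mul_pos ha hc]
  · have hcont : ContinuousOn (fun a => Λ + a * σ a) (Icc 0 (ρ / 2)) := by
      have hσc : ContinuousOn σ (Icc 0 (ρ / 2)) := by
        have : LipschitzOnWith L.toNNReal σ (Icc 0 (ρ / 2)) := by
          refine LipschitzOnWith.of_dist_le_mul fun x hx y hy => ?_
          rw [Real.dist_eq, Real.dist_eq]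
          refine (hlip x y hx.1 (by linarith [hx.2]) hy.1 (by linarith [hy.2])).trans ?_
          gcongr
          exact Real.le_coe_toNNReal L
        exact this.continuousOn
      fun_prop
    obtain ⟨a, ha, ha0⟩ := intermediate_value_Icc' (by linarith : (0 : ℝ) ≤ ρ / 2) hcont
      (show (0 : ℝ) ∈ Icc _ _ by
        constructor
        · have := hneg (ρ / 2) (by linarith) (by linarith)
          linarith
        · simpa using hΛ.le)
    simp only at ha0
    have hapos : 0 < a := by
      rcases ha.1.lt_or_eq with h | h
      · exact h
      · rw [← h] at ha0; simp at ha0; linarith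
    have haρ : a < ρ := by linarith [ha.2]
    refine ⟨a, hapos, haρ, ha0, ?_, fun a' ha' haρ' h => ?_⟩
    · have := hneg a hapos haρ
      linarith
    · rcases lt_trichotomy a' a with h1 | h1 | h1
      · have := hanti a' a ha' h1 haρ; linarith
      · exact h1
      · have := hanti a a' hapos h1 haρ'; linarith

lemma criticalAlpha_eq {d b : ℝ} (hd : 0 < d) (hb : 0 < b) (κ : ℝ) :
    criticalAlpha d b κ = 2 * b * κ ^ 2 + (4 * d * kCrit d b * κ ^ 3 + d * κ ^ 4) := by
  have h1 : b = 2 * d * kCrit d b ^ 2 := by rw [kCrit_sq hd hb]; field_simp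
  rw [criticalAlpha]
  generalize kCrit d b = k at *
  rw [h1]; ring

lemma abs_higher_order_le {d k κ : ℝ} (hd : 0 < d) (hk : 0 < k) (hκ : |κ| ≤ k) :
    |4 * d * k * κ ^ 3 + d * κ ^ 4| ≤ 5 * d * k * |κ| ^ 3 := by
  calc _ ≤ |4 * d * k * κ ^ 3| + |d * κ ^ 4| := abs_add_le _ _
    _ = 4 * d * k * |κ| ^ 3 + d * |κ| * |κ| ^ 3 := by
        rw [abs_mul, abs_mul d, abs_of_pos hd, abs_of_pos (by positivity : 0 < 4 * d * k), abs_pow,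
          abs_pow]
        ring
    _ ≤ 4 * d * k * |κ| ^ 3 + d * k * |κ| ^ 3 := by gcongr
    _ = _ := by ring

lemma trivialFlowUnstable_paramsAt_iff {d b H Q f g α κ : ℝ} (hd : 0 < d) (hb : 0 < b) (hH : 0 < H)
    (hg : 0 < g) {k : Plane} (hk : ‖k‖ = kCrit d b + κ) (hκ : 0 < kCrit d b + κ) :
    TrivialFlowUnstable (paramsAt d b H Q f g α) k ↔ criticalAlpha d b κ < α := by
  have hk0 : k ≠ 0 := by rw [← norm_pos_iff, hk]; exact hκ
  rw [trivialFlowUnstable_iff (p := paramsAt d b H Q f g α) hg hH hk0, hk]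
  have h2 := waveSymbol_eq hd hb hH α κ 1
  have h1 : (kCrit d b + κ) ^ 2 * ((1 : ℤ) : ℝ) ^ 2 - kCrit d b ^ 2 =
    (kCrit d b + κ) ^ 2 - kCrit d b ^ 2 := by push_cast; ring
  rw [h1, waveSymbol, Int.cast_one, one_pow, one_pow, mul_one, mul_one] at h2
  simp only [paramsAt]
  rw [h2, criticalAlpha, sub_neg]

section shift
variable {φ : ℝ → ℝ}

lemma iteratedDeriv_shift (φ : ℝ → ℝ) (θ : ℝ) (n : ℕ) :
    iteratedDeriv n (shift φ θ) = shift (iteratedDeriv n φ) θ := by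
  unfold shift
  rw [iteratedDeriv_comp_add_const]

lemma contDiff_shift (h : ContDiff ℝ 5 φ) (θ : ℝ) : ContDiff ℝ 5 (shift φ θ) :=
  h.comp (contDiff_id.add contDiff_const)

lemma periodic_shift (h : Function.Periodic φ (2 * π)) (θ : ℝ) :
    Function.Periodic (shift φ θ) (2 * π) := by
  intro ξ
  unfold shift
  rw [add_right_comm, h]

lemma shift_shift (φ : ℝ → ℝ) (s t : ℝ) : shift (shift φ s) t = shift φ (t + s) := by
  ext ξ; simp only [shift]; congr 1; ring

lemma shift_zero (φ : ℝ → ℝ) : shift φ 0 = φ := by ext ξ; simp [shift]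

lemma integral_shift (h : Function.Periodic φ (2 * π)) (θ : ℝ) :
    ∫ ξ in (0 : ℝ)..(2 * π), shift φ θ ξ = ∫ ξ in (0 : ℝ)..(2 * π), φ ξ := by
  unfold shift
  rw [intervalIntegral.integral_comp_add_right, zero_add, add_comm]
  have := h.intervalIntegral_add_eq θ 0
  rwa [zero_add] at this

lemma normH5_shift (hφ : ContDiff ℝ 5 φ) (h : Function.Periodic φ (2 * π)) (θ : ℝ) :
    normH5 (shift φ θ) = normH5 φ := by
  unfold normH5
  congr 1
  refine Finset.sum_congr rfl fun n hn => ?_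
  have hn5 : n ≤ 5 := by have := Finset.mem_range.mp hn; omega
  have hp : Function.Periodic (fun ξ => (iteratedDeriv n φ ξ) ^ 2) (2 * π) := fun ξ => by
    simp only [(coeff_iteratedDeriv (N := 5) hφ h hn5 0).1 ξ]
  rw [← integral_shift hp θ, iteratedDeriv_shift]
  rfl

lemma waveResidual_shift (d b H Q θ α κ : ℝ) (φ : ℝ → ℝ) (t ξ : ℝ) :
    waveResidual d b H Q θ α κ (shift φ t) ξ = waveResidual d b H Q θ α κ φ (ξ + t) := by
  have h1 : deriv (shift φ t) ξ = deriv φ (ξ + t) := by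
    have := congrFun (iteratedDeriv_shift φ t 1) ξ
    rwa [iteratedDeriv_one, iteratedDeriv_one] at this
  rw [waveResidual, waveResidual, iteratedDeriv_shift, iteratedDeriv_shift, h1]
  rfl

lemma firstFourierCoeff_shift (h : Function.Periodic φ (2 * π)) (θ : ℝ) :
    firstFourierCoeff (shift φ θ) = Complex.exp (Complex.I * θ) * firstFourierCoeff φ := by
  rw [firstFourierCoeff_eq_coeff, firstFourierCoeff_eq_coeff, coeff_shift h]
  simp

end shift

/-- Membership in the set of small waves in terms of the shape equation alone. -/
lemma mem_smallWaves_iff {d b H Q f g α κ δ ρ : ℝ} (hg : 0 < g) {k : Plane}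
    (hk : ‖k‖ = kCrit d b + κ) (hκ : 0 < kCrit d b + κ) {φ : ℝ → ℝ} :
    φ ∈ smallWaves (paramsAt d b H Q f g α) k δ ρ ↔
      (ContDiff ℝ 5 φ ∧ Function.Periodic φ (2 * π) ∧ (∫ ξ in (0 : ℝ)..(2 * π), φ ξ = 0) ∧
        (∀ ξ, 0 < H + f / g * φ ξ) ∧ ∀ ξ, waveResidual d b H Q (f / g) α κ φ ξ = 0) ∧
        normH5 φ < δ ∧ ‖firstFourierCoeff φ‖ < ρ := by
  have hk0 : k ≠ 0 := by rw [← norm_pos_iff, hk]; exact hκ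
  unfold smallWaves
  change IsSteadyPlaneWave _ _ _ ∧ _ ↔ _
  rw [isSteadyPlaneWave_iff (p := paramsAt d b H Q f g α) hg.ne' hk0, hk]
  rfl

lemma shift_mem_smallWaves {d b H Q f g α κ δ ρ : ℝ} (hg : 0 < g) {k : Plane}
    (hk : ‖k‖ = kCrit d b + κ) (hκ : 0 < kCrit d b + κ) {φ : ℝ → ℝ}
    (hφ : φ ∈ smallWaves (paramsAt d b H Q f g α) k δ ρ) (θ : ℝ) :
    shift φ θ ∈ smallWaves (paramsAt d b H Q f g α) k δ ρ := by
  rw [mem_smallWaves_iff hg hk hκ] at hφ ⊢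
  obtain ⟨⟨h5, hp, h0, hpos, hres⟩, hδ, hρ⟩ := hφ
  refine ⟨⟨contDiff_shift h5 θ, periodic_shift hp θ, by rw [integral_shift hp, h0],
    fun ξ => hpos _, fun ξ => by rw [waveResidual_shift, hres]⟩, by rwa [normH5_shift h5 hp], ?_⟩
  rw [firstFourierCoeff_shift hp, norm_mul]
  have := norm_exp_mode 1 θ
  rw [Int.cast_one, mul_one] at this
  rwa [this, one_mul]

/-- The wave shape of signed amplitude `A`: for `A < 0` the one of amplitude `|A|` translated by
half a period, which changes the sign of the first Fourier coefficient. -/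
def waveShape (χ : ℝ → ℝ → ℝ → ℝ → ℝ) (A α κ : ℝ) : ℝ → ℝ :=
  shift (fun ξ => |A| * χ |A| α κ ξ) (if A < 0 then π else 0)

lemma exp_signShift (A : ℝ) :
    Complex.exp (Complex.I * ((if A < 0 then π else 0 : ℝ) : ℂ)) * (|A| : ℝ) = (A : ℂ) := by
  split_ifs with h
  · rw [mul_comm Complex.I, Complex.exp_pi_mul_I, abs_of_neg h]; push_cast; ring
  · rw [abs_of_nonneg (not_lt.mp h)]; simp

namespace IsWaveFamily
variable {d b H Q f g ε ρ δ K : ℝ} {χ : ℝ → ℝ → ℝ → ℝ → ℝ} {σ : ℝ → ℝ → ℝ → ℝ} {A α κ : ℝ}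
  {k : Plane}

lemma firstFourierCoeff_waveShape {θ : ℝ} (hF : IsWaveFamily d b H Q θ ε ρ δ K χ σ)
    (hA : |A| < ρ) (hα : |α| < ε) (hκ : |κ| < ε) :
    firstFourierCoeff (waveShape χ A α κ) = (A : ℂ) := by
  have hp := hF.periodic |A| α κ (abs_nonneg _) hA hα hκ
  have hp' : Function.Periodic (fun ξ => |A| * χ |A| α κ ξ) (2 * π) := fun ξ => by simp only [hp ξ]
  rw [waveShape, firstFourierCoeff_shift hp', firstFourierCoeff_eq_coeff, coeff_const_mul,
    (hF.coeff |A| α κ (abs_nonneg _) hA hα hκ).1, mul_one, exp_signShift]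

/-- The wave shape of a root is a small wave. -/
lemma waveShape_mem_smallWaves (hF : IsWaveFamily d b H Q (f / g) ε ρ δ K χ σ) (hg : 0 < g)
    (hA : |A| < ρ) (hα : |α| < ε) (hκ : |κ| < ε) (hk : ‖k‖ = kCrit d b + κ)
    (hroot : A = 0 ∨ α - criticalAlpha d b κ + |A| * σ |A| α κ = 0) :
    waveShape χ A α κ ∈ smallWaves (paramsAt d b H Q f g α) k δ ρ := by
  have hκ0 := hF.wavenumber_pos κ hκ
  have hA0 := abs_nonneg A
  have hp := hF.periodic |A| α κ hA0 hA hα hκ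
  have hp' : Function.Periodic (fun ξ => |A| * χ |A| α κ ξ) (2 * π) := fun ξ => by simp only [hp ξ]
  apply shift_mem_smallWaves hg hk hκ0
  rw [mem_smallWaves_iff hg hk hκ0]
  refine ⟨⟨contDiff_const.mul (hF.contDiff |A| α κ hA0 hA hα hκ), hp', ?_,
    hF.depth_pos |A| α κ hA0 hA hα hκ, fun ξ => ?_⟩, hF.small |A| α κ hA0 hA hα hκ, ?_⟩
  · rw [integral_eq_zero_iff_coeff, coeff_const_mul, (hF.coeff |A| α κ hA0 hA hα hκ).2, mul_zero]
  · rw [hF.residual |A| α κ hA0 hA hα hκ]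
    rcases hroot with h | h
    · rw [h]; simp
    · rw [h]; simp
  · rw [firstFourierCoeff_eq_coeff, coeff_const_mul, (hF.coeff |A| α κ hA0 hA hα hκ).1, mul_one,
      Complex.norm_real, Real.norm_eq_abs, abs_abs]
    exact hA

/-- A small wave with first Fourier coefficient `a ≥ 0` is `a χ`, and `a` is a root. -/
lemma eq_of_mem_smallWaves (hF : IsWaveFamily d b H Q (f / g) ε ρ δ K χ σ) (hg : 0 < g)
    (hα : |α| < ε) (hκ : |κ| < ε) (hk : ‖k‖ = kCrit d b + κ) {φ : ℝ → ℝ}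
    (hφ : φ ∈ smallWaves (paramsAt d b H Q f g α) k δ ρ) {a : ℝ} (ha : 0 ≤ a)
    (hφa : firstFourierCoeff φ = (a : ℂ)) :
    a < ρ ∧ (φ = fun ξ => a * χ a α κ ξ) ∧
      (a = 0 ∨ α - criticalAlpha d b κ + a * σ a α κ = 0) := by
  rw [mem_smallWaves_iff hg hk (hF.wavenumber_pos κ hκ)] at hφ
  obtain ⟨⟨h5, hp, h0, hpos, hres⟩, hδ, hρ⟩ := hφ
  rw [hφa, Complex.norm_real, Real.norm_eq_abs, abs_of_nonneg ha] at hρ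
  have e := hF.unique a α κ ha hρ hα hκ φ h5 hp h0 hδ hφa hpos hres
  refine ⟨hρ, e, ?_⟩
  have h1 := hF.residual a α κ ha hρ hα hκ (π / 2)
  rw [← e, hres, sin_pi_div_two, mul_one] at h1
  rcases mul_eq_zero.mp h1.symm with h | h
  · left; linarith
  · right; exact h

/-- A small wave with real first Fourier coefficient `A` is the wave shape of the root `A`. -/
lemma eq_waveShape (hF : IsWaveFamily d b H Q (f / g) ε ρ δ K χ σ) (hg : 0 < g)
    (hα : |α| < ε) (hκ : |κ| < ε) (hk : ‖k‖ = kCrit d b + κ) {φ : ℝ → ℝ}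
    (hφ : φ ∈ smallWaves (paramsAt d b H Q f g α) k δ ρ)
    (hφA : firstFourierCoeff φ = (A : ℂ)) :
    |A| < ρ ∧ φ = waveShape χ A α κ ∧
      (A = 0 ∨ α - criticalAlpha d b κ + |A| * σ |A| α κ = 0) := by
  have hκ0 := hF.wavenumber_pos κ hκ
  have hφ' := (mem_smallWaves_iff hg hk hκ0).mp hφ
  have hp := hφ'.1.2.1
  -- undo the translation by half a period for negative `A`
  set s : ℝ := if A < 0 then π else 0 with hs
  have h1 : firstFourierCoeff (shift φ (-s)) = ((|A| : ℝ) : ℂ) := by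
    rw [firstFourierCoeff_shift hp, hφA, ← exp_signShift A, ← hs, ← mul_assoc, ← Complex.exp_add]
    push_cast
    simp
  obtain ⟨h2, h3, h4⟩ := hF.eq_of_mem_smallWaves hg hα hκ hk
    (shift_mem_smallWaves hg hk hκ0 hφ (-s)) (abs_nonneg A) h1
  refine ⟨h2, ?_, by simpa using h4⟩
  rw [waveShape, ← h3, shift_shift, ← hs, add_neg_cancel, shift_zero]

/-- The wave shapes of roots `A` and `-A` are translates of each other. -/
lemma waveShape_neg {θ : ℝ} (hF : IsWaveFamily d b H Q θ ε ρ δ K χ σ)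
    (hA : |A| < ρ) (hα : |α| < ε) (hκ : |κ| < ε) :
    waveShape χ (-A) α κ = shift (waveShape χ A α κ) π := by
  have hp := hF.periodic |A| α κ (abs_nonneg _) hA hα hκ
  have key : ∀ ξ, χ |A| α κ (ξ + (π + π)) = χ |A| α κ ξ := fun ξ => by rw [← two_mul, hp]
  unfold waveShape
  rw [shift_shift, abs_neg]
  ext ξ
  rcases lt_trichotomy A 0 with h | rfl | h
  · have h1 : ¬ (-A < 0) := by linarith
    simp only [shift, if_pos h, if_neg h1, key, add_zero]
  · simp [shift]
  · have h1 : -A < 0 := by linarith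
    have h2 : ¬ A < 0 := by linarith
    simp only [shift, if_pos h1, if_neg h2, add_zero]

lemma normH5_waveShape_sub_le {θ : ℝ} (hF : IsWaveFamily d b H Q θ ε ρ δ K χ σ)
    (hA : |A| < ρ) (hα : |α| < ε) (hκ : |κ| < ε) :
    normH5 (fun ξ => waveShape χ A α κ ξ - 2 * A * cos ξ) ≤ 3 * K * (|A| * |A|) := by
  have hA0 := abs_nonneg A
  have hcd := hF.contDiff |A| α κ hA0 hA hα hκ
  set w : ℝ → ℝ := fun ξ => |A| * (χ |A| α κ ξ - 2 * cos ξ) with hw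
  have hwc : ContDiff ℝ 5 w := contDiff_const.mul (hcd.sub contDiff_two_cos)
  have hwp : Function.Periodic w (2 * π) := fun ξ => by
    simp only [hw, hF.periodic |A| α κ hA0 hA hα hκ ξ, cos_add_two_pi]
  have e : (fun ξ => waveShape χ A α κ ξ - 2 * A * cos ξ) = shift w (if A < 0 then π else 0) := by
    ext ξ
    simp only [waveShape, shift, hw]
    split_ifs with h
    · rw [cos_add_pi, abs_of_neg h]; ring
    · rw [abs_of_nonneg (not_lt.mp h), add_zero]; ring
  rw [e, normH5_shift hwc hwp]
  refine (normH5_le hwc (D := |A| * (K * |A|)) fun n hn ξ => ?_).trans (le_of_eq (by ring))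
  rw [hw, iteratedDeriv_const_mul_field, abs_mul, abs_abs]
  exact mul_le_mul_of_nonneg_left (hF.close |A| α κ hA0 hA hα hκ n hn ξ) hA0

end IsWaveFamily

/-! ### The bifurcation theorem -/

/-- The roots of the bifurcation equation in terms of the response `σ`. -/
lemma mem_smallRoots_iff {d b c : ℝ} (hd : 0 < d) (hb : 0 < b) (σ : ℝ → ℝ → ℝ → ℝ)
    {R : ℝ → ℝ → ℝ → ℝ} {A α κ ρ : ℝ} (hR : R A α κ = |A| * (σ |A| α κ + c) +
      -(4 * d * kCrit d b * κ ^ 3 + d * κ ^ 4)) :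
    A ∈ smallRoots b c R α κ ρ ↔
      |A| < ρ ∧ (A = 0 ∨ α - criticalAlpha d b κ + |A| * σ |A| α κ = 0) := by
  have e : α - 2 * b * κ ^ 2 - c * |A| + R A α κ =
      α - criticalAlpha d b κ + |A| * σ |A| α κ := by
    rw [hR, criticalAlpha_eq hd hb]; ring
  change |A| < ρ ∧ 0 = A * (α - 2 * b * κ ^ 2 - c * |A| + R A α κ) ↔ _
  rw [e, eq_comm, mul_eq_zero]

end

theorem theoremt (d b H₀ M : ℝ) (hd : 0 < d) (hb : 0 < b) (hH₀ : 0 < H₀) (hM : 0 < M) :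
    -- the constants are uniform for drag `0 < Q ≤ M` and rescaled Coriolis `|f / g| ≤ M`
    ∃ ε > 0, ∃ ρ > 0, ∃ δ > 0, ∃ K > 0,
      ∀ Q f g : ℝ, 0 < Q → Q ≤ M → 0 < g → |f / g| ≤ M →
      ∃ (R : ℝ → ℝ → ℝ → ℝ) (Φ : ℝ → ℝ → ℝ → ℝ → ℝ),
        -- form of the remainder
        (∃ R₁ R₂ R₃ : ℝ → ℝ → ℝ → ℝ, ∀ A α κ : ℝ, |A| < ρ → |α| < ε → |κ| < ε →
          R A α κ = Q * (f / g) * R₁ A α κ + (Q + |f / g|) * R₂ A α κ + R₃ A α κ ∧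
          |R₁ A α κ| ≤ K * |A| ^ 2 ∧
          |R₂ A α κ| ≤ K * (|A| * (|A| + |α| + |κ|)) ∧
          |R₃ A α κ| ≤ K * |κ| ^ 3) ∧
        -- correspondence between waves and roots, and the wave shape
        (∀ α κ : ℝ, |α| < ε → |κ| < ε → ∀ k : Plane, ‖k‖ = kCrit d b + κ →
          -- waves, normalized by a translation, are in bijection with the roots
          Set.BijOn (fun A => Φ A α κ)
            (smallRoots b (dragCoeff d b H₀ Q) R α κ ρ)
            {φ | φ ∈ smallWaves (paramsAt d b H₀ Q f g α) k δ ρ ∧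
              (firstFourierCoeff φ).im = 0} ∧
          (∀ A ∈ smallRoots b (dragCoeff d b H₀ Q) R α κ ρ,
            firstFourierCoeff (Φ A α κ) = (A : ℂ) ∧
            normH5 (fun ξ => Φ A α κ ξ - 2 * A * Real.cos ξ) ≤
              K * (|A| * (|A| + |α| + |κ|))) ∧
          -- every wave is a translate of a normalized one
          (∀ φ ∈ smallWaves (paramsAt d b H₀ Q f g α) k δ ρ,
            ∃ A ∈ smallRoots b (dragCoeff d b H₀ Q) R α κ ρ, ∃ θ : ℝ,
              φ = shift (Φ A α κ) θ) ∧
          -- normalized waves are translates of each other only if the roots agree up to sign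
          (∀ A ∈ smallRoots b (dragCoeff d b H₀ Q) R α κ ρ,
            ∀ A' ∈ smallRoots b (dragCoeff d b H₀ Q) R α κ ρ,
              (∃ θ : ℝ, Φ A' α κ = shift (Φ A α κ) θ) ↔ A' = A ∨ A' = -A)) ∧
        -- supercritical degenerate pitchfork with amplitude linear in `α`
        (∃ ε₁ > 0, ε₁ ≤ ε ∧ ∃ ρ₁ > 0, ρ₁ ≤ ρ ∧ ∃ K₁ > 0, ∃ αs : ℝ → ℝ,
          ∀ α κ : ℝ, |α| < ε₁ → |κ| < ε₁ →
            |αs κ - 2 * b * κ ^ 2| ≤ K₁ * |κ| ^ 3 ∧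
            (∀ k : Plane, ‖k‖ = kCrit d b + κ →
              (TrivialFlowUnstable (paramsAt d b H₀ Q f g α) k ↔ αs κ < α)) ∧
            (α ≤ αs κ → smallRoots b (dragCoeff d b H₀ Q) R α κ ρ₁ = {0}) ∧
            (αs κ < α → ∃ a : ℝ, 0 < a ∧
              smallRoots b (dragCoeff d b H₀ Q) R α κ ρ₁ = {0, a, -a} ∧
              |a - (α - αs κ) / dragCoeff d b H₀ Q| ≤
                K₁ * ((α - αs κ) * (|α| + |κ|)))) := by
  obtain ⟨ε, hε, hεk, ρ, hρ, δ, hδ, K, hK, hfam⟩ := exists_waveFamily hd hb hH₀ hM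
  have hk := kCrit_pos hd hb
  have hKge : K ≤ 3 * K + 5 * d * kCrit d b := by
    have : 0 ≤ 5 * d * kCrit d b := by positivity
    linarith
  refine ⟨ε, hε, ρ, hρ, δ, hδ, 3 * K + 5 * d * kCrit d b, by positivity,
    fun Q f g hQ hQM hg hfg => ?_⟩
  obtain ⟨χ, σ, hF⟩ := hfam Q (f / g) hQ hQM hfg
  set c := dragCoeff d b H₀ Q with hcdef
  have hc : 0 < c := by rw [hcdef, dragCoeff_eq d b H₀ Q hb.le]; positivity
  have hQθ : 0 < Q + |f / g| := by positivity
  set R : ℝ → ℝ → ℝ → ℝ := fun A α κ => |A| * (σ |A| α κ + c) +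
      -(4 * d * kCrit d b * κ ^ 3 + d * κ ^ 4) with hR
  have hroots : ∀ {A α κ r}, A ∈ smallRoots b c R α κ r ↔
      |A| < r ∧ (A = 0 ∨ α - criticalAlpha d b κ + |A| * σ |A| α κ = 0) := fun {A α κ r} =>
    mem_smallRoots_iff hd hb σ rfl
  refine ⟨R, waveShape χ, ?_, ?_, ?_⟩
  · -- since `Q |θ| A²` is dominated by `(Q + |θ|) A²`, the first remainder can be taken to vanish
    refine ⟨fun _ _ _ => 0, fun A α κ => |A| * (σ |A| α κ + c) / (Q + |f / g|),
      fun _ _ κ => -(4 * d * kCrit d b * κ ^ 3 + d * κ ^ 4), fun A α κ hA hα hκ =>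
      ⟨?_, ?_, ?_, ?_⟩⟩
    · rw [hR]; field_simp; ring
    · rw [abs_zero]; positivity
    · have h1 := hF.response |A| α κ (abs_nonneg A) hA hα hκ
      rw [abs_div, abs_of_pos hQθ, div_le_iff₀ hQθ, abs_mul, abs_abs]
      calc |A| * |σ |A| α κ + c| ≤ |A| * (K * (Q + |f / g|) * (|A| + |κ|)) := by gcongr
        _ = K * (|A| * (|A| + 0 + |κ|)) * (Q + |f / g|) := by ring
        _ ≤ _ := by gcongr; exact abs_nonneg α
    · rw [abs_neg]
      refine (abs_higher_order_le hd hk (hκ.le.trans hεk)).trans ?_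
      gcongr
      linarith
  · intro α κ hα hκ k hkk
    have hκ0 := hF.wavenumber_pos κ hκ
    refine ⟨⟨?_, ?_, ?_⟩, ?_, ?_, ?_⟩
    · intro A hA
      obtain ⟨h1, h2⟩ := hroots.mp hA
      refine ⟨hF.waveShape_mem_smallWaves hg h1 hα hκ hkk h2, ?_⟩
      rw [hF.firstFourierCoeff_waveShape h1 hα hκ, Complex.ofReal_im]
    · intro A hA A' hA' h
      have h1 := hF.firstFourierCoeff_waveShape (hroots.mp hA).1 hα hκ
      have h2 := hF.firstFourierCoeff_waveShape (hroots.mp hA').1 hα hκ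
      have h : waveShape χ A α κ = waveShape χ A' α κ := h
      rw [h, h2] at h1
      exact (Complex.ofReal_injective h1).symm
    · rintro φ ⟨hφ, him⟩
      have h1 : firstFourierCoeff φ = ((firstFourierCoeff φ).re : ℂ) :=
        Complex.ext (by simp) (by simp [him])
      obtain ⟨h2, h3, h4⟩ := hF.eq_waveShape hg hα hκ hkk hφ h1
      exact ⟨_, hroots.mpr ⟨h2, h4⟩, h3.symm⟩
    · intro A hA
      have h1 := (hroots.mp hA).1
      refine ⟨hF.firstFourierCoeff_waveShape h1 hα hκ,
        (hF.normH5_waveShape_sub_le h1 hα hκ).trans ?_⟩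
      have h2 : 0 ≤ 5 * d * kCrit d b := by positivity
      have h3 : |A| ≤ |A| + |α| + |κ| := by linarith [abs_nonneg α, abs_nonneg κ]
      gcongr
      linarith
    · intro φ hφ
      -- rotate the first Fourier coefficient onto the positive real axis
      have hp := ((mem_smallWaves_iff hg hkk hκ0).mp hφ).1.2.1
      set z := firstFourierCoeff φ with hz
      have h1 : firstFourierCoeff (shift φ (-z.arg)) = ((‖z‖ : ℝ) : ℂ) := by
        rw [firstFourierCoeff_shift hp, ← hz]
        nth_rewrite 2 [← Complex.norm_mul_exp_arg_mul_I z]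
        rw [mul_left_comm, ← Complex.exp_add]
        have : Complex.I * ((-z.arg : ℝ) : ℂ) + (z.arg : ℂ) * Complex.I = 0 := by push_cast; ring
        rw [this, Complex.exp_zero, mul_one]
      obtain ⟨h2, h3, h4⟩ := hF.eq_waveShape hg hα hκ hkk
        (shift_mem_smallWaves hg hkk hκ0 hφ _) h1
      refine ⟨‖z‖, hroots.mpr ⟨h2, h4⟩, z.arg, ?_⟩
      rw [← h3, shift_shift, add_neg_cancel, shift_zero]
    · intro A hA A' hA'
      have h1 := (hroots.mp hA).1
      constructor
      · rintro ⟨θ, hθ⟩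
        have hp : Function.Periodic (waveShape χ A α κ) (2 * π) :=
          ((mem_smallWaves_iff hg hkk hκ0).mp (hF.waveShape_mem_smallWaves hg h1 hα hκ hkk
            (hroots.mp hA).2)).1.2.1
        have h2 := hF.firstFourierCoeff_waveShape (hroots.mp hA').1 hα hκ
        rw [hθ, firstFourierCoeff_shift hp, hF.firstFourierCoeff_waveShape h1 hα hκ] at h2
        have h3 := congrArg norm h2
        have h4 := norm_exp_mode 1 θ
        rw [Int.cast_one, mul_one] at h4
        rw [norm_mul, h4, one_mul, Complex.norm_real, Complex.norm_real, Real.norm_eq_abs,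
          Real.norm_eq_abs] at h3
        exact abs_eq_abs.mp h3.symm
      · rintro (rfl | rfl)
        · exact ⟨0, (shift_zero _).symm⟩
        · exact ⟨π, hF.waveShape_neg h1 hα hκ⟩
  · -- on `a < ρ₁`, `|κ| < ε₁` the response is within `c / 2` of `-c`
    set L := K * (Q + |f / g|) with hL
    have hLpos : 0 < L := by positivity
    set ρ₁ := min ρ (c / (4 * (L + K))) with hρ₁
    have hρ₁0 : 0 < ρ₁ := by positivity
    have hρ₁c : (L + K) * ρ₁ ≤ c / 4 := by
      calc (L + K) * ρ₁ ≤ (L + K) * (c / (4 * (L + K))) := by gcongr; exact min_le_right _ _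
        _ = c / 4 := by field_simp
    set ε₁ := min ε (min ρ₁ (c * ρ₁ / 4)) with hε₁
    have hε₁0 : 0 < ε₁ := by positivity
    have hε₁ρ : ε₁ ≤ ρ₁ := (min_le_right _ _).trans (min_le_left _ _)
    have hε₁c : ε₁ ≤ c * ρ₁ / 4 := (min_le_right _ _).trans (min_le_right _ _)
    have hL1 : L * ρ₁ ≤ c / 4 := by nlinarith
    have hL2 : K * ρ₁ ≤ c / 4 := by nlinarith
    refine ⟨ε₁, hε₁0, min_le_left _ _, ρ₁, hρ₁0, min_le_left _ _,
      5 * d * kCrit d b + 2 * L / c ^ 2 * (2 / c + 1), by positivity, criticalAlpha d b,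
      fun α κ hα₁ hκ₁ => ?_⟩
    have hα : |α| < ε := hα₁.trans_le (min_le_left _ _)
    have hκ : |κ| < ε := hκ₁.trans_le (min_le_left _ _)
    have hρ₁ρ : ρ₁ ≤ ρ := min_le_left _ _
    have hcrit0 : 0 ≤ criticalAlpha d b κ := by unfold criticalAlpha; positivity
    obtain ⟨hp1, hp2⟩ := pitchfork (σ := fun a => σ a α κ) (Λ := α - criticalAlpha d b κ) hc hρ₁0
      (fun a ha haρ => by
        refine (hF.response a α κ ha (haρ.trans_le hρ₁ρ) hα hκ).trans ?_
        calc L * (a + |κ|) ≤ L * (ρ₁ + ρ₁) := by gcongr; exact hκ₁.le.trans hε₁ρ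
          _ ≤ c / 2 := by linarith)
      (fun a a' ha haρ ha' haρ' => hF.response_lipschitz a a' α κ ha (haρ.trans_le hρ₁ρ) ha'
        (haρ'.trans_le hρ₁ρ) hα hκ) hL2
    refine ⟨?_, fun k hkk => trivialFlowUnstable_paramsAt_iff hd hb hH₀ hg hkk
      (hF.wavenumber_pos κ hκ), fun hle => ?_, fun hlt => ?_⟩
    · rw [criticalAlpha_eq hd hb, add_sub_cancel_left]
      refine (abs_higher_order_le hd hk (hκ.le.trans hεk)).trans ?_
      gcongr
      have : 0 ≤ 2 * L / c ^ 2 * (2 / c + 1) := by positivity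
      linarith
    · ext A
      rw [hroots, mem_singleton_iff]
      constructor
      · rintro ⟨hAρ, h | h⟩
        · exact h
        · by_contra hA
          exact hp1 (by linarith) |A| (abs_pos.mpr hA) hAρ h
      · rintro rfl
        exact ⟨by rwa [abs_zero], Or.inl rfl⟩
    · have hαle : α - criticalAlpha d b κ ≤ |α| := by linarith [le_abs_self α]
      obtain ⟨a, ha, haρ, ha0, hac, hauniq⟩ := hp2 (by linarith) (by linarith)
      refine ⟨a, ha, ?_, ?_⟩
      · ext A
        rw [hroots, mem_insert_iff, mem_insert_iff, mem_singleton_iff]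
        constructor
        · rintro ⟨hAρ, h | h⟩
          · exact Or.inl h
          · by_cases hA : A = 0
            · exact Or.inl hA
            · have := hauniq |A| (abs_pos.mpr hA) hAρ h
              exact Or.inr ((abs_eq ha.le).mp this)
        · rintro (rfl | rfl | rfl)
          · exact ⟨by rwa [abs_zero], Or.inl rfl⟩
          · rw [abs_of_pos ha]; exact ⟨haρ, Or.inr ha0⟩
          · rw [abs_neg, abs_of_pos ha]; exact ⟨haρ, Or.inr ha0⟩
      · have hr := hF.response a α κ ha.le (haρ.trans_le hρ₁ρ) hα hκ
        set Λ := α - criticalAlpha d b κ with hΛ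
        have hΛ0 : 0 < Λ := by rw [hΛ]; linarith
        have hac' : a ≤ 2 * Λ / c := by rw [le_div_iff₀ hc]; exact hac
        have e : a - Λ / c = a * (σ a α κ + c) / c := by
          have ha0' : Λ + a * σ a α κ = 0 := ha0
          field_simp
          linear_combination -ha0'
        rw [e, abs_div, abs_of_pos hc, abs_mul, abs_of_pos ha, div_le_iff₀ hc]
        have h5 : a + |κ| ≤ (2 / c + 1) * (|α| + |κ|) := by
          have h6 : 2 * Λ / c ≤ 2 / c * |α| := by
            rw [mul_div_right_comm]; gcongr
          have h7 : 0 ≤ 2 / c * |κ| := by positivity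
          linarith [abs_nonneg α]
        calc a * |σ a α κ + c| ≤ 2 * Λ / c * (L * ((2 / c + 1) * (|α| + |κ|))) := by
              gcongr
              exact hr.trans (by gcongr)
          _ = 2 * L / c ^ 2 * (2 / c + 1) * (Λ * (|α| + |κ|)) * c := by field_simp
          _ ≤ _ := by
              gcongr
              have : 0 ≤ 5 * d * kCrit d b := by positivity
              linarith
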